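/- Let $k$ be a perfect field of characteristic $2$ with ring of Witt vectors $W(k)$. Let $t\ge 1$ and let $G\subset \mathrm{Aut}_k\,k[[y]]$ be a subgroup isomorphic to $(\mathbf Z/2\mathbf Z)^t$ acting with conductor $1$, i.e. the lower ramification groups $G_i=\{\sigma\in G:\ \mathrm{ord}_y(\sigma(y)-y)>i\}$ satisfy $G_1=G$ and $G_2=1$. Let $\widehat{\mathcal C}_k$ be the category of complete noetherian local $W(k)$-algebras with residue field $k$, and $\mathcal C_k$ its full subcategory of artinian rings. A lift of the action of $G$ to an object $A$ of $\widehat{\mathcal C}_k$ is a homomorphism $G\to\mathrm{Aut}_A\,A[[y]]$ that reduces to the given inclusion $G\subset\mathrm{Aut}_k\,k[[y]]$. Let $D_G:\mathcal C_k\to\mathrm{Sets}$ be the functor that sends $A$ to the set of lifts of the action to $A$ modulo conjugation by the automorphisms of $A[[y]]$ that reduce to the identity of $k[[y]]$. A versal deformation ring of $G$ is an object $R_G$ of $\widehat{\mathcal C}_k$ together with a lift of the action to $R_G$ for which the induced morphism $\mathrm{Hom}(R_G,-)\to D_G$ is smooth and bijective on $k[\varepsilon]$. Then $D_G$ has a versal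 deformation ring, and: (i) If $t\le 2$, the action of $G$ lifts to an object of $\widehat{\mathcal C}_k$ of characteristic $0$; every versal deformation ring $R_G$ has characteristic $0$ and is isomorphic to $W(k)[[\alpha]]$ as a $W(k)$-algebra. (ii) If $t\ge 3$, the action of $G$ does not lift to any object of $\widehat{\mathcal C}_k$ of characteristic $4$, and every versal deformation ring $R_G$ has characteristic $2$. -/

import Mathlib

universe u

open scoped PowerSeries DualNumber

section Ramification

variable {k : Type u} [Field k]

/-- The `i`-th lower ramification group of a group `G` of `k`-automorphisms of `k⟦X⟧`, as a set:
the `σ ∈ G` with `ord (σ X - X) > i`. -/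
def ramificationGroup (G : Subgroup (k⟦X⟧ ≃ₐ[k] k⟦X⟧)) (i : ℕ) : Set (k⟦X⟧ ≃ₐ[k] k⟦X⟧) :=
  {σ | σ ∈ G ∧ (i : ℕ∞) < (σ PowerSeries.X - PowerSeries.X).order}

/-- The action of `G` has conductor `1`: `G = G₁` and `G₂ = 1`. -/
def HasConductorOne (G : Subgroup (k⟦X⟧ ≃ₐ[k] k⟦X⟧)) : Prop :=
  ramificationGroup G 1 = (G : Set (k⟦X⟧ ≃ₐ[k] k⟦X⟧)) ∧ ramificationGroup G 2 = {1}

end Ramification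

/-- A complete noetherian local `W(k)`-algebra with residue field `k`. The residue field is
recorded by the ring homomorphism `residue` onto `k` that is compatible with `W(k) → k`; it is
unique, and surjective because `W(k) → k` is. The artinian ones are those with
`IsArtinianRing A`. Morphisms are the homomorphisms of `W(k)`-algebras; they are automatically
local and compatible with `residue`. -/
structure CoeffRing (p : ℕ) [Fact p.Prime] (k : Type u) [Field k] where
  carrier : Type u
  [commRing : CommRing carrier]
  [algebra : Algebra (WittVector p k) carrier]
  [isLocalRing : IsLocalRing carrier]
  [isNoetherianRing : IsNoetherianRing carrier]
  [isAdicComplete : IsAdicComplete (IsLocalRing.maximalIdeal carrier) carrier]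
  residue : carrier →+* k
  residue_algebraMap : ∀ w : WittVector p k,
    residue (algebraMap (WittVector p k) carrier w) = WittVector.constantCoeff w

namespace CoeffRing

instance (p : ℕ) [Fact p.Prime] (k : Type u) [Field k] : CoeSort (CoeffRing p k) (Type u) :=
  ⟨CoeffRing.carrier⟩

attribute [instance] commRing algebra isLocalRing isNoetherianRing isAdicComplete

instance isArtinianRing_dualNumber (k : Type u) [Field k] : IsArtinianRing k[ε] := by
  rw [isArtinianRing_iff_isNilpotent_maximalIdeal, DualNumber.maximalIdeal_eq_span_singleton_eps]
  refine ⟨2, ?_⟩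
  rw [Ideal.span_singleton_pow, pow_two, DualNumber.eps_mul_eps]
  simp

/-- The ring `k[ε]` of dual numbers, with the structure map `W(k) → k → k[ε]`. -/
noncomputable def dualNumber (p : ℕ) [Fact p.Prime] (k : Type u) [Field k] : CoeffRing p k :=
  letI : Algebra (WittVector p k) k[ε] :=
    ((TrivSqZeroExt.inlHom k k).comp (WittVector.constantCoeff (p := p))).toAlgebra
  { carrier := k[ε]
    residue := (TrivSqZeroExt.fstHom k k k).toRingHom
    residue_algebraMap := fun _ => rfl }

end CoeffRing

section Deformations

variable {p : ℕ} [Fact p.Prime] {k : Type u} [Field k]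

/-- A lift to `A` of the action of `G` on `k⟦X⟧`: an action of `G` on `A⟦X⟧` by `A`-algebra
automorphisms that reduces to the given one. -/
structure Lift (G : Subgroup (k⟦X⟧ ≃ₐ[k] k⟦X⟧)) (A : CoeffRing p k) where
  toHom : G →* (A⟦X⟧ ≃ₐ[A] A⟦X⟧)
  reduces : ∀ (g : G) (h : A⟦X⟧),
    PowerSeries.map A.residue (toHom g h) =
      (g : k⟦X⟧ ≃ₐ[k] k⟦X⟧) (PowerSeries.map A.residue h)

variable {G : Subgroup (k⟦X⟧ ≃ₐ[k] k⟦X⟧)}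

/-- Two lifts are equivalent, that is, define the same deformation (element of `D_G(A)`), if they
are conjugate by an automorphism of `A⟦X⟧` that reduces to the identity of `k⟦X⟧`. -/
def Lift.Equivalent {A : CoeffRing p k} (ρ ρ' : Lift G A) : Prop :=
  ∃ γ : A⟦X⟧ ≃ₐ[A] A⟦X⟧,
    (∀ h : A⟦X⟧, PowerSeries.map A.residue (γ h) = PowerSeries.map A.residue h) ∧
    ∀ g : G, ρ'.toHom g = γ * ρ.toHom g * γ⁻¹

/-- The lift `ρ'` to `B` is the base change of the lift `ρ` to `A` along `f : A → B`. It exists and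
is unique for every `ρ` and `f`: it sends `g` to the automorphism `X ↦ f (ρ g X)`. -/
def Lift.IsBaseChange {A B : CoeffRing p k} (f : A →ₐ[WittVector p k] B)
    (ρ : Lift G A) (ρ' : Lift G B) : Prop :=
  ∀ (g : G) (h : A⟦X⟧), PowerSeries.map (f : A →+* B) (ρ.toHom g h) =
    ρ'.toHom g (PowerSeries.map (f : A →+* B) h)

/-- The equality `D_G(f)([ρ]) = [ρ']` in `D_G(B)`. -/
def Lift.Induces {A B : CoeffRing p k} (f : A →ₐ[WittVector p k] B)
    (ρ : Lift G A) (ρ' : Lift G B) : Prop :=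
  ∃ ρ'' : Lift G B, ρ.IsBaseChange f ρ'' ∧ ρ''.Equivalent ρ'

/-- The lift `ξ` to `R` is a versal deformation: the morphism of functors `Hom(R, -) → D_G` on
artinian rings that it defines is smooth and bijective on tangent spaces. -/
structure Lift.IsVersal {R : CoeffRing p k} (ξ : Lift G R) : Prop where
  smooth : ∀ (A B : CoeffRing p k), IsArtinianRing A → IsArtinianRing B →
    ∀ φ : A →ₐ[WittVector p k] B, Function.Surjective φ →
    ∀ (f : R →ₐ[WittVector p k] B) (η : Lift G A) (ηB : Lift G B),
      η.IsBaseChange φ ηB → ξ.Induces f ηB →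
      ∃ f' : R →ₐ[WittVector p k] A, φ.comp f' = f ∧ ξ.Induces f' η
  tangent : ∀ η : Lift G (CoeffRing.dualNumber p k),
    ∃! f : R →ₐ[WittVector p k] CoeffRing.dualNumber p k, ξ.Induces f η

/-- `R` is a versal deformation ring of the action of `G`. -/
def IsVersalRing (G : Subgroup (k⟦X⟧ ≃ₐ[k] k⟦X⟧)) (R : CoeffRing p k) : Prop :=
  ∃ ξ : Lift G R, ξ.IsVersal

end Deformations

/-! In characteristic 2, conductor 1 says that G translates 1/X up to an error: 1/g(X) - 1/X is a
constant u_g plus an element of the maximal ideal 𝔪 of k⟦X⟧, and g ↦ u_g is an injective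
homomorphism from G to the additive group of k. The errors form a 1-cocycle, and H¹(G, 𝔪) = 0
(`exists_coboundary`), so in a suitable parameter y the generators are exactly y ↦ y / (1 + u_i y)
(`HasConductorOne.exists_mobiusFrame`).

The same vanishing removes the obstructions along small extensions (`Lift.NormalForm.lift_step`).
Hence over an artinian A every lift is, in a parameter Y above y, a tuple of Möbius involutions Y ↦
(b_i - Y) / (1 + c_i Y), given by the trace-zero matrices M_i = [[-1, b_i], [c_i, 1]]. Deforming the
action thus means deforming these matrices. Now M_i M_j + M_j M_i is the scalar tr(M_i M_j) = 2 +
b_i c_j + b_j c_i, and since the c_i have distinct residues, two of the involutions commute exactly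
when this trace vanishes.

Given three independent involutions, M_l anticommutes with M_i and M_j, hence commutes with M_i M_j.
But M_i M_j is itself a trace-zero involution independent of M_l, so it also anticommutes with M_l.
Therefore 2 = 0 (`Lift.NormalForm.two_eq_zero`), which is the obstruction for t ≥ 3. It passes to
complete rings through their artinian quotients.

Affine changes of Y bring the first two c_i to Teichmüller representatives. For t ≤ 2 the first b_i
then remains free and the trace relation determines the other one, if any, so the normalised data
are represented by W(k)⟦α⟧. For t ≥ 3 the relations 2 = 0 and b_i c_j = b_j c_i leave t - 1 free
parameters over k. A ring representing normalised data is versal (`MobiusFrame.isVersalRing`),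
because normal forms lift along surjections and normalised ones are unique over k[ε]. Versal rings
are isomorphic to each other (`IsVersalRing.nonempty_algEquiv`), so the description holds for each
of them. -/

set_option linter.unusedSectionVars false

/-! ### Power series rings over complete local rings -/

section AdicRings

theorem PowerSeries.exists_ringHom_of_mem {A B : Type*} [CommRing A] [CommRing B] (I : Ideal B)
    [IsAdicComplete I B] (f : A →+* B) {b : B} (hb : b ∈ I) :
    ∃ F : A⟦X⟧ →+* B, (∀ a, F (PowerSeries.C a) = f a) ∧ F PowerSeries.X = b := by
  -- With the I-adic topology on B and the discrete one on A, f is continuous and evaluation at the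
  -- topologically nilpotent b is defined.
  let _ : WithIdeal B := ⟨I⟩
  let _ : UniformSpace A := ⊥
  have : DiscreteTopology A := ⟨rfl⟩
  have hI : IsAdic I := rfl
  obtain ⟨h1, h2⟩ := hI.isAdicComplete_iff.mp inferInstance
  have hf : Continuous f := continuous_of_discreteTopology
  have hb' : PowerSeries.HasEval b := by
    rw [PowerSeries.hasEval_def, IsTopologicallyNilpotent, hI.hasBasis_nhds_zero.tendsto_right_iff]
    intro n _
    filter_upwards [Filter.eventually_ge_atTop n] with m hm
    exact Ideal.pow_le_pow_right hm (Ideal.pow_mem_pow hb m)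
  refine ⟨PowerSeries.eval₂Hom hf hb', fun a => ?_, ?_⟩
  · rw [PowerSeries.coe_eval₂Hom, PowerSeries.eval₂_C]
  · rw [PowerSeries.coe_eval₂Hom, PowerSeries.eval₂_X]

theorem PowerSeries.exists_eq_trunc_add {A : Type*} [CommRing A] (f : A⟦X⟧) (n : ℕ) :
    ∃ g : A⟦X⟧, f = ((f.trunc n : Polynomial A) : A⟦X⟧) + PowerSeries.X ^ n * g := by
  have : (PowerSeries.X : A⟦X⟧) ^ n ∣ f - ((f.trunc n : Polynomial A) : A⟦X⟧) := by
    rw [PowerSeries.X_pow_dvd_iff]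
    intro m hm
    simp [PowerSeries.coeff_trunc, hm]
  obtain ⟨g, hg⟩ := this
  exact ⟨g, by rw [← hg]; ring⟩

/-- The two maps agree on polynomials, and both send the tail X ^ n * g into I ^ n; since B is
Hausdorff, nothing else is left. -/
theorem PowerSeries.ringHom_ext_of_mem {A B : Type*} [CommRing A] [CommRing B] (I : Ideal B)
    [IsHausdorff I B] {F F' : A⟦X⟧ →+* B} (hC : ∀ a, F (PowerSeries.C a) = F' (PowerSeries.C a))
    (hX : F PowerSeries.X = F' PowerSeries.X) (hI : F PowerSeries.X ∈ I) : F = F' := by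
  have hpoly : ∀ q : Polynomial A, F (q : A⟦X⟧) = F' (q : A⟦X⟧) := by
    intro q
    have : F.comp (Polynomial.coeToPowerSeries.ringHom) =
        F'.comp (Polynomial.coeToPowerSeries.ringHom) := by
      apply Polynomial.ringHom_ext
      · intro a
        simpa using hC a
      · simpa using hX
    simpa using congrArg (fun g : Polynomial A →+* B => g q) this
  ext f
  rw [IsHausdorff.eq_iff_smodEq (I := I)]
  intro n
  obtain ⟨g, hg⟩ := PowerSeries.exists_eq_trunc_add f n
  rw [SModEq.sub_mem, hg, map_add, map_add, hpoly, map_mul, map_mul, map_pow, map_pow, ← hX,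
    add_sub_add_left_eq_sub, ← mul_sub, smul_eq_mul, Ideal.mul_top]
  exact Ideal.mul_mem_right _ _ (Ideal.pow_mem_pow hI n)

/-- The kernels of the iterates of f stabilise, say at n. An element of ker f is f ^ n applied to
some y, and y then lies in ker f ^ (n + 1) = ker f ^ n. -/
theorem RingHom.injective_of_surjective_of_isNoetherianRing {R : Type*} [CommRing R]
    [IsNoetherianRing R] (f : R →+* R) (hf : Function.Surjective f) : Function.Injective f := by
  have hpow : ∀ n, (f ^ (n + 1) : R →+* R) = f.comp (f ^ n) := fun n => pow_succ' f n
  have hpow' : ∀ n, (f ^ (n + 1) : R →+* R) = (f ^ n : R →+* R).comp f := fun n => pow_succ f n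
  let K : ℕ →o Ideal R := ⟨fun n => RingHom.ker (f ^ n : R →+* R), monotone_nat_of_le_succ fun n x hx => by
    rw [RingHom.mem_ker] at hx ⊢
    rw [hpow, RingHom.comp_apply, hx, map_zero]⟩
  obtain ⟨n, hn⟩ := monotone_stabilizes_iff_noetherian.mpr (inferInstance : IsNoetherian R R) K
  have hsurj : ∀ n, Function.Surjective (f ^ n : R →+* R) := by
    intro n
    induction n with
    | zero => exact Function.surjective_id
    | succ n ih => rw [hpow]; exact hf.comp ih
  rw [injective_iff_map_eq_zero]
  intro x hx
  obtain ⟨y, rfl⟩ := hsurj n x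
  have : y ∈ K (n + 1) := by
    change (f ^ (n + 1) : R →+* R) y = 0
    rw [hpow, RingHom.comp_apply, hx]
  rw [← hn (n + 1) (Nat.le_succ n)] at this
  exact this

variable {A : Type*} [CommRing A]

theorem PowerSeries.mem_maximalIdeal_iff_coeff_zero [IsLocalRing A] (f : A⟦X⟧) :
    f ∈ IsLocalRing.maximalIdeal A⟦X⟧ ↔
      PowerSeries.coeff 0 f ∈ IsLocalRing.maximalIdeal A := by
  rw [IsLocalRing.mem_maximalIdeal, IsLocalRing.mem_maximalIdeal, mem_nonunits_iff,
    mem_nonunits_iff, PowerSeries.isUnit_iff_constantCoeff, PowerSeries.coeff_zero_eq_constantCoeff]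

/-- The maximal ideal is generated by that of A and X, so its powers are controlled coefficient by
coefficient. This reduces adic completeness of A⟦X⟧ to that of A. -/
theorem PowerSeries.mem_maximalIdeal_pow_iff [IsLocalRing A] (n : ℕ) (f : A⟦X⟧) :
    f ∈ IsLocalRing.maximalIdeal A⟦X⟧ ^ n ↔
      ∀ i, PowerSeries.coeff i f ∈ IsLocalRing.maximalIdeal A ^ (n - i) := by
  constructor
  · intro hf
    induction n generalizing f with
    | zero => intro i; simp
    | succ n ih =>
      rw [pow_succ] at hf
      induction hf using Submodule.mul_induction_on' with
      | mem_mul_mem g hg h hh =>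
        intro i
        rw [PowerSeries.coeff_mul]
        refine Ideal.sum_mem _ fun x hx => ?_
        rw [Finset.HasAntidiagonal.mem_antidiagonal] at hx
        rcases Nat.eq_zero_or_pos x.2 with h0 | h0
        · have h1 := (PowerSeries.mem_maximalIdeal_iff_coeff_zero h).mp hh
          rw [h0]
          refine Ideal.pow_le_pow_right ?_ (pow_succ (IsLocalRing.maximalIdeal A) _ ▸
            Ideal.mul_mem_mul (ih g hg x.1) h1)
          omega
        · refine Ideal.pow_le_pow_right ?_ (Ideal.mul_mem_right _ _ (ih g hg x.1))
          omega
      | add x _ y _ hx hy =>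
        intro i
        rw [map_add]
        exact Ideal.add_mem _ (hx i) (hy i)
  · intro hf
    have hX : (PowerSeries.X : A⟦X⟧) ∈ IsLocalRing.maximalIdeal A⟦X⟧ := by
      rw [PowerSeries.mem_maximalIdeal_iff_coeff_zero]; simp
    have hC : (IsLocalRing.maximalIdeal A).map PowerSeries.C ≤ IsLocalRing.maximalIdeal A⟦X⟧ := by
      rw [Ideal.map_le_iff_le_comap]
      intro a ha
      rw [Ideal.mem_comap, PowerSeries.mem_maximalIdeal_iff_coeff_zero]
      simpa using ha
    obtain ⟨g, hg⟩ := PowerSeries.exists_eq_trunc_add f n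
    rw [hg]
    refine Ideal.add_mem _ ?_ (Ideal.mul_mem_right _ _ (Ideal.pow_mem_pow hX n))
    rw [(f.trunc n).as_sum_support, ← Polynomial.coeToPowerSeries.ringHom_apply, map_sum]
    refine Ideal.sum_mem _ fun i _ => ?_
    rw [Polynomial.coeToPowerSeries.ringHom_apply, Polynomial.coe_monomial,
      PowerSeries.monomial_eq_C_mul_X_pow, PowerSeries.coeff_trunc]
    split_ifs with hi'
    swap
    · simp
    have : (n - i) + i = n := by omega
    rw [← this, pow_add]
    refine Ideal.mul_mem_mul ?_ (Ideal.pow_mem_pow hX i)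
    have h2 := Ideal.mem_map_of_mem (PowerSeries.C (R := A)) (hf i)
    rw [Ideal.map_pow] at h2
    exact Ideal.pow_right_mono hC _ h2

instance PowerSeries.isAdicComplete_maximalIdeal [IsLocalRing A]
    [IsAdicComplete (IsLocalRing.maximalIdeal A) A] :
    IsAdicComplete (IsLocalRing.maximalIdeal A⟦X⟧) A⟦X⟧ where
  haus' f hf := by
    ext i
    refine IsHausdorff.haus (I := IsLocalRing.maximalIdeal A) inferInstance _ fun n => ?_
    have := hf (n + i)
    rw [SModEq.zero, smul_eq_mul, Ideal.mul_top] at this ⊢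
    simpa using (PowerSeries.mem_maximalIdeal_pow_iff _ _).mp this i
  prec' f hf := by
    -- The shift by i is needed because a congruence modulo the power n + i controls the i-th
    -- coefficient only modulo the power n.
    have key : ∀ i, ∃ L : A, ∀ n, PowerSeries.coeff i (f (n + i)) - L ∈
        IsLocalRing.maximalIdeal A ^ n := by
      intro i
      obtain ⟨L, hL⟩ := IsPrecomplete.prec (I := IsLocalRing.maximalIdeal A)
        (M := A) inferInstance (f := fun n => PowerSeries.coeff i (f (n + i))) (fun {m n} hmn => by
          have := hf (Nat.add_le_add_right hmn i)
          rw [SModEq.sub_mem, smul_eq_mul, Ideal.mul_top] at this ⊢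
          simpa using (PowerSeries.mem_maximalIdeal_pow_iff _ _).mp this i)
      refine ⟨L, fun n => ?_⟩
      have := hL n
      rwa [SModEq.sub_mem, smul_eq_mul, Ideal.mul_top] at this
    choose L hL using key
    refine ⟨PowerSeries.mk L, fun n => ?_⟩
    rw [SModEq.sub_mem, smul_eq_mul, Ideal.mul_top, PowerSeries.mem_maximalIdeal_pow_iff]
    intro i
    rw [map_sub, PowerSeries.coeff_mk]
    rcases le_total i n with hin | hin
    · have := hL i (n - i)
      rwa [Nat.sub_add_cancel hin] at this
    · rw [Nat.sub_eq_zero_of_le hin]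
      simp

end AdicRings

/-! ### Vanishing of the first cohomology of the maximal ideal of k⟦X⟧ -/

section CohomologyVanishing

variable {k : Type u} [Field k]

theorem PowerSeries.eq_zero_of_forall_X_pow_dvd {A : Type*} [CommRing A] {f : A⟦X⟧}
    (h : ∀ n, (PowerSeries.X : A⟦X⟧) ^ n ∣ f) : f = 0 := by
  ext n
  exact PowerSeries.X_pow_dvd_iff.mp (h (n + 1)) n (Nat.lt_succ_self n)

theorem PowerSeries.exists_algHom_X {k : Type u} [Field k] (z : k⟦X⟧)
    (hz : PowerSeries.constantCoeff z = 0) :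
    ∃ φ : k⟦X⟧ →ₐ[k] k⟦X⟧, φ PowerSeries.X = z := by
  obtain ⟨F, hF, hX⟩ := PowerSeries.exists_ringHom_of_mem (IsLocalRing.maximalIdeal k⟦X⟧)
    (PowerSeries.C (R := k)) (b := z) (by
      rw [PowerSeries.mem_maximalIdeal_iff_coeff_zero]; simpa using hz)
  exact ⟨{ F with commutes' := hF }, hX⟩

theorem PowerSeries.algHom_X_pow_dvd {φ : k⟦X⟧ →ₐ[k] k⟦X⟧}
    (h : PowerSeries.X ∣ φ PowerSeries.X) {n : ℕ} {f : k⟦X⟧} (hf : PowerSeries.X ^ n ∣ f) :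
    PowerSeries.X ^ n ∣ φ f := by
  obtain ⟨g, rfl⟩ := hf
  rw [map_mul, map_pow]
  exact Dvd.dvd.mul_right (pow_dvd_pow_of_dvd h n) _

theorem PowerSeries.algHom_C (φ : k⟦X⟧ →ₐ[k] k⟦X⟧) (a : k) :
    φ (PowerSeries.C a) = PowerSeries.C a := φ.commutes a

theorem PowerSeries.constantCoeff_algHom {φ : k⟦X⟧ →ₐ[k] k⟦X⟧}
    (h : PowerSeries.X ∣ φ PowerSeries.X) (f : k⟦X⟧) :
    PowerSeries.constantCoeff (φ f) = PowerSeries.constantCoeff f := by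
  have h1 : PowerSeries.X ^ 1 ∣ f - PowerSeries.C (PowerSeries.constantCoeff f) := by
    rw [pow_one, PowerSeries.X_dvd_iff]; simp
  have h2 := PowerSeries.algHom_X_pow_dvd h h1
  rw [pow_one, PowerSeries.X_dvd_iff, map_sub, PowerSeries.algHom_C] at h2
  simpa [sub_eq_zero] using h2

theorem PowerSeries.algHom_ext {φ ψ : k⟦X⟧ →ₐ[k] k⟦X⟧} (h : φ PowerSeries.X = ψ PowerSeries.X)
    (h0 : PowerSeries.X ∣ φ PowerSeries.X) : φ = ψ := by
  apply AlgHom.coe_ringHom_injective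
  refine PowerSeries.ringHom_ext_of_mem (Ideal.span {(PowerSeries.X : k⟦X⟧)})
    (fun a => ?_) h (Ideal.mem_span_singleton.mpr h0)
  exact (φ.commutes a).trans (ψ.commutes a).symm

theorem PowerSeries.exists_eq_C_add_X_mul {A : Type*} [CommRing A] (f : A⟦X⟧) :
    ∃ g, f = PowerSeries.C (PowerSeries.constantCoeff f) + PowerSeries.X * g := by
  have : PowerSeries.X ∣ f - PowerSeries.C (PowerSeries.constantCoeff f) := by
    rw [PowerSeries.X_dvd_iff]; simp
  obtain ⟨g, hg⟩ := this
  exact ⟨g, by rw [← hg]; ring⟩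

/-- `k⟦X⟧` is generated by `1` and `X` over the image of the substitution `X ↦ z`, for `z` of
order two. -/
theorem PowerSeries.exists_eq_add_X_mul {φ : k⟦X⟧ →ₐ[k] k⟦X⟧} {e : k⟦X⟧} (he : IsUnit e)
    (hφ : φ PowerSeries.X = PowerSeries.X ^ 2 * e) (f : k⟦X⟧) :
    ∃ p q, f = φ p + PowerSeries.X * φ q := by
  have step : ∀ f : k⟦X⟧, ∃ (a b : k) (g : k⟦X⟧),
      f = PowerSeries.C a + PowerSeries.C b * PowerSeries.X + PowerSeries.X ^ 2 * e * g := by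
    intro f
    obtain ⟨g, hg⟩ := PowerSeries.exists_eq_C_add_X_mul f
    obtain ⟨h, hh⟩ := PowerSeries.exists_eq_C_add_X_mul g
    obtain ⟨e', he'⟩ := he.exists_right_inv
    refine ⟨PowerSeries.constantCoeff f, PowerSeries.constantCoeff g, e' * h, ?_⟩
    linear_combination hg + PowerSeries.X * hh - PowerSeries.X ^ 2 * h * he'
  choose a b g hg using step
  -- Repeated division by φ X = X² e, with remainders a + b X: the quotients are F n, and the
  -- remainders are the coefficients of the series p and q.
  let F : ℕ → k⟦X⟧ := fun n => g^[n] f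
  have hF : ∀ n, F n = PowerSeries.C (a (F n)) + PowerSeries.C (b (F n)) * PowerSeries.X +
      PowerSeries.X ^ 2 * e * F (n + 1) := by
    intro n
    have : F (n + 1) = g (F n) := Function.iterate_succ_apply' g n f
    rw [this]
    exact hg (F n)
  let P : (k⟦X⟧ → k) → ℕ → k⟦X⟧ := fun a n => PowerSeries.mk fun i => a (F (n + i))
  have hP : ∀ a n, P a n = PowerSeries.C (a (F n)) + PowerSeries.X * P a (n + 1) := by
    intro a n
    ext i
    rcases i with _ | i
    · simp [P]
    · simp only [P, PowerSeries.coeff_mk, map_add, PowerSeries.coeff_succ_X_mul,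
        PowerSeries.coeff_C, if_neg (Nat.succ_ne_zero i), zero_add]
      congr 2
      omega
  have hdvd : ∀ m n, PowerSeries.X ^ m ∣ F n - φ (P a n) - PowerSeries.X * φ (P b n) := by
    intro m
    induction m with
    | zero => simp
    | succ m ih =>
      intro n
      obtain ⟨w, hw⟩ := ih (n + 1)
      refine ⟨PowerSeries.X * e * w, ?_⟩
      have h1 := congrArg φ (hP a n)
      have h2 := congrArg φ (hP b n)
      rw [map_add, map_mul, hφ, PowerSeries.algHom_C] at h1 h2
      linear_combination hF n - h1 - PowerSeries.X * h2 + PowerSeries.X ^ 2 * e * hw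
  refine ⟨P a 0, P b 0, ?_⟩
  have : f - φ (P a 0) - PowerSeries.X * φ (P b 0) = 0 :=
    PowerSeries.eq_zero_of_forall_X_pow_dvd (fun m => hdvd m 0)
  linear_combination this

/-- An element of the kernel has zero constant term, and its quotient by X is again in the kernel,
so it is divisible by every power of X. -/
theorem PowerSeries.algHom_injective_of_order_two {φ : k⟦X⟧ →ₐ[k] k⟦X⟧} {e : k⟦X⟧}
    (he : IsUnit e) (hφ : φ PowerSeries.X = PowerSeries.X ^ 2 * e) : Function.Injective φ := by
  rw [injective_iff_map_eq_zero]
  intro f hf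
  have hX : PowerSeries.X ∣ φ PowerSeries.X := by
    rw [hφ, pow_two, mul_assoc]; exact Dvd.intro _ rfl
  have : ∀ n, ∀ f : k⟦X⟧, φ f = 0 → PowerSeries.X ^ n ∣ f := by
    intro n
    induction n with
    | zero => simp
    | succ n ih =>
      intro f hf
      obtain ⟨g, hg⟩ := PowerSeries.exists_eq_C_add_X_mul f
      have h0 : PowerSeries.constantCoeff f = 0 := by
        rw [← PowerSeries.constantCoeff_algHom hX f, hf, map_zero]
      rw [h0, map_zero, zero_add] at hg
      rw [hg, map_mul, hφ] at hf
      have hg0 : φ g = 0 := by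
        rcases mul_eq_zero.mp hf with h | h
        · exact absurd h (mul_ne_zero (pow_ne_zero 2 PowerSeries.X_ne_zero) he.ne_zero)
        · exact h
      rw [hg, pow_succ']
      exact mul_dvd_mul_left _ (ih g hg0)
  exact PowerSeries.eq_zero_of_forall_X_pow_dvd fun n => this n f hf

/-- The substitution `X ↦ X + u X² + ⋯`. -/
def IsWildWith (σ : k⟦X⟧ →ₐ[k] k⟦X⟧) (u : k) : Prop :=
  ∃ r, σ PowerSeries.X = PowerSeries.X + PowerSeries.C u * PowerSeries.X ^ 2 +
    PowerSeries.X ^ 3 * r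

theorem IsWildWith.X_dvd {σ : k⟦X⟧ →ₐ[k] k⟦X⟧} {u : k} (h : IsWildWith σ u) :
    PowerSeries.X ∣ σ PowerSeries.X := by
  obtain ⟨r, hr⟩ := h
  exact ⟨1 + PowerSeries.C u * PowerSeries.X + PowerSeries.X ^ 2 * r, by rw [hr]; ring⟩

theorem isUnit_one_add_X_mul {A : Type*} [CommRing A] (f : A⟦X⟧) :
    IsUnit (1 + PowerSeries.X * f) := by
  rw [PowerSeries.isUnit_iff_constantCoeff]; simp

variable [CharP k 2]

theorem PowerSeries.two_eq_zero : (2 : k⟦X⟧) = 0 := by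
  have : (2 : k) = 0 := CharTwo.two_eq_zero
  rw [← map_ofNat (PowerSeries.C (R := k)) 2, this, map_zero]

/-- The norm form `X ↦ X σ(X)` of a wild involution with conductor one, whose image is the
ring of invariants. -/
theorem exists_norm_algHom {σ : k⟦X⟧ →ₐ[k] k⟦X⟧} {u : k} (h : IsWildWith σ u) (hu : u ≠ 0)
    (hσ : ∀ f, σ (σ f) = f) :
    ∃ φ : k⟦X⟧ →ₐ[k] k⟦X⟧, φ PowerSeries.X = PowerSeries.X * σ PowerSeries.X ∧
      Function.Injective φ ∧ (∀ f, σ (φ f) = φ f) ∧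
      (∀ f, σ f = f → ∃ g, f = φ g) ∧
      ∀ v, σ v = v → PowerSeries.constantCoeff v = 0 →
        ∃ b, PowerSeries.constantCoeff b = 0 ∧ σ b + b = v := by
  have h2 := PowerSeries.two_eq_zero (k := k)
  have hX := h.X_dvd
  obtain ⟨r, hr⟩ := h
  obtain ⟨φ, hφ⟩ := PowerSeries.exists_algHom_X (PowerSeries.X * σ PowerSeries.X) (by simp)
  let e : k⟦X⟧ := 1 + PowerSeries.X * (PowerSeries.C u + PowerSeries.X * r)
  have he : IsUnit e := isUnit_one_add_X_mul _
  have hφe : φ PowerSeries.X = PowerSeries.X ^ 2 * e := by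
    rw [hφ, hr]; ring
  have hinj := PowerSeries.algHom_injective_of_order_two he hφe
  have hφX : PowerSeries.X ∣ φ PowerSeries.X := by rw [hφ]; exact Dvd.intro _ rfl
  have hinv : ∀ f, σ (φ f) = φ f := by
    intro f
    have : σ.comp φ = φ := by
      apply PowerSeries.algHom_ext
      · rw [AlgHom.comp_apply, hφ, map_mul, hσ, mul_comm]
      · rw [AlgHom.comp_apply, hφ, map_mul, hσ]; exact Dvd.intro_left _ rfl
    exact congrArg (fun g : k⟦X⟧ →ₐ[k] k⟦X⟧ => g f) this
  have hT : PowerSeries.X + σ PowerSeries.X ≠ 0 := by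
    intro h0
    have := congrArg (PowerSeries.coeff 2) h0
    rw [hr] at this
    simp only [map_add, PowerSeries.coeff_C_mul, PowerSeries.coeff_X_pow, PowerSeries.coeff_X,
      PowerSeries.coeff_X_pow_mul'] at this
    norm_num at this
    exact hu this
  have hrange : ∀ f, σ f = f → ∃ g, f = φ g := by
    intro f hf
    obtain ⟨p, q, hpq⟩ := PowerSeries.exists_eq_add_X_mul he hφe f
    -- Applying σ to f = φ p + X φ q and subtracting leaves the trace of X times φ q.
    have h1 : (PowerSeries.X + σ PowerSeries.X) * φ q = 0 := by
      have h3 := congrArg σ hpq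
      rw [hf, map_add, map_mul, hinv, hinv] at h3
      linear_combination h3 - hpq + σ PowerSeries.X * φ q * h2
    rcases mul_eq_zero.mp h1 with h1 | h1
    · exact absurd h1 hT
    · exact ⟨p, by rw [hpq, h1, mul_zero, add_zero]⟩
  refine ⟨φ, hφ, hinj, hinv, hrange, fun v hv hv0 => ?_⟩
  obtain ⟨p, rfl⟩ := hrange v hv
  -- The trace of X is invariant of exact order 2, hence φ of X times a unit, and so it divides
  -- every invariant v without constant term. With b = X φ(w), the sum σ b + b is the trace of X
  -- times φ(w), so w is the quotient.
  obtain ⟨τ, hτ⟩ := hrange (PowerSeries.X + σ PowerSeries.X) (by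
    rw [map_add, hσ, add_comm])
  rw [PowerSeries.constantCoeff_algHom hφX] at hv0
  obtain ⟨p', hp'⟩ := PowerSeries.exists_eq_C_add_X_mul p
  obtain ⟨τ', hτ'⟩ := PowerSeries.exists_eq_C_add_X_mul τ
  have hτ0 : PowerSeries.constantCoeff τ = 0 := by
    rw [← PowerSeries.constantCoeff_algHom hφX, ← hτ, hr]; simp
  rw [hv0, map_zero, zero_add] at hp'
  rw [hτ0, map_zero, zero_add] at hτ'
  have hunit : IsUnit τ' := by
    rw [PowerSeries.isUnit_iff_constantCoeff, isUnit_iff_ne_zero]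
    intro h0
    have h3 : PowerSeries.X ^ 3 ∣ φ τ := by
      obtain ⟨τ'', hτ''⟩ := PowerSeries.exists_eq_C_add_X_mul τ'
      rw [h0, map_zero, zero_add] at hτ''
      rw [hτ', hτ'', map_mul, map_mul, hφe]
      exact ⟨PowerSeries.X * e ^ 2 * φ τ'', by ring⟩
    rw [← hτ, hr] at h3
    have := PowerSeries.X_pow_dvd_iff.mp h3 2 (by norm_num)
    simp only [map_add, PowerSeries.coeff_C_mul, PowerSeries.coeff_X_pow, PowerSeries.coeff_X,
      PowerSeries.coeff_X_pow_mul'] at this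
    norm_num at this
    exact hu this
  obtain ⟨τi, hτi⟩ := hunit.exists_right_inv
  refine ⟨PowerSeries.X * φ (τi * p'), by simp, ?_⟩
  rw [map_mul, hinv]
  have h4 : φ p = φ τ * φ (τi * p') := by
    rw [← map_mul, hp', hτ']
    congr 1
    linear_combination (-PowerSeries.X * p') * hτi
  rw [h4, ← hτ]
  ring

/-- The action induced on the invariants of a wild involution. -/
theorem exists_induced_algHom {σ τ φ : k⟦X⟧ →ₐ[k] k⟦X⟧} {u v : k} (h : IsWildWith σ u)
    (h' : IsWildWith τ v) (hσ : ∀ f, σ (σ f) = f) (hcomm : ∀ f, σ (τ f) = τ (σ f))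
    (hφ : φ PowerSeries.X = PowerSeries.X * σ PowerSeries.X)
    (hrange : ∀ f, σ f = f → ∃ g, f = φ g) :
    ∃ τ' : k⟦X⟧ →ₐ[k] k⟦X⟧, IsWildWith τ' (v ^ 2 + v * u) ∧ ∀ f, φ (τ' f) = τ (φ f) := by
  have h2 := PowerSeries.two_eq_zero (k := k)
  have hφX : PowerSeries.X ∣ φ PowerSeries.X := by rw [hφ]; exact Dvd.intro _ rfl
  have hτX := h'.X_dvd
  obtain ⟨s, hs⟩ := hrange (τ (φ PowerSeries.X)) (by
    rw [hφ, map_mul, map_mul, hcomm, hcomm, hσ, mul_comm])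
  have hs0 : PowerSeries.constantCoeff s = 0 := by
    rw [← PowerSeries.constantCoeff_algHom hφX, ← hs, PowerSeries.constantCoeff_algHom hτX, hφ]
    simp
  obtain ⟨τ', hτ'⟩ := PowerSeries.exists_algHom_X s hs0
  refine ⟨τ', ?_, ?_⟩
  · obtain ⟨r, hr⟩ := h
    obtain ⟨ρ, hρ⟩ := h'
    obtain ⟨r1, hr1⟩ := PowerSeries.exists_eq_C_add_X_mul r
    set c := PowerSeries.constantCoeff r
    set x : k⟦X⟧ := PowerSeries.X
    obtain ⟨s1, hs1⟩ := PowerSeries.exists_eq_C_add_X_mul s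
    obtain ⟨s2, hs2⟩ := PowerSeries.exists_eq_C_add_X_mul s1
    obtain ⟨s3, hs3⟩ := PowerSeries.exists_eq_C_add_X_mul s2
    set a1 := PowerSeries.constantCoeff s1
    set a2 := PowerSeries.constantCoeff s2
    rw [hs0, map_zero, zero_add] at hs1
    set m : k⟦X⟧ := PowerSeries.C u + PowerSeries.C c * x + x ^ 2 * r1 with hm
    set a : k⟦X⟧ := PowerSeries.C v + x * ρ with ha
    have hz : φ x = x ^ 2 * (1 + x * m) := by
      rw [hφ, hr, hr1]; ring
    have hτx : τ x = x * (1 + x * a) := by rw [hρ]; ring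
    -- With z = φ x = x² + u x³ + c x⁴ + ⋯, the difference τ z - z starts with (v² + 3uv) x⁴, and 3
    -- = 1 in k. As z has order 2, this is the quadratic term of the induced action.
    have hτz : τ (φ x) = x ^ 2 * (1 + x * m) +
        PowerSeries.C (v ^ 2 + v * u) * x ^ 4 + x ^ 5 * (x * ρ ^ 2 - r1 +
          PowerSeries.C u * (3 * ρ + 3 * a ^ 2 + x * a ^ 3) +
          PowerSeries.C c * (a * (4 + 6 * x * a + 4 * x ^ 2 * a ^ 2 + x ^ 3 * a ^ 3)) +
          (1 + x * a) ^ 5 * τ r1) := by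
      have : φ x = x ^ 2 + PowerSeries.C u * x ^ 3 + PowerSeries.C c * x ^ 4 + x ^ 5 * r1 := by
        rw [hz, hm]; ring
      rw [this]
      simp only [map_add, map_mul, map_pow, PowerSeries.algHom_C, hτx]
      rw [hm, ha]
      linear_combination (x ^ 3 * PowerSeries.C v + x ^ 4 * ρ + x ^ 5 * PowerSeries.C v * ρ +
        x ^ 4 * PowerSeries.C v * PowerSeries.C u) * h2
    have hφs : φ s = PowerSeries.C a1 * (x ^ 2 * (1 + x * m)) +
        PowerSeries.C a2 * (x ^ 2 * (1 + x * m)) ^ 2 + (x ^ 2 * (1 + x * m)) ^ 3 * φ s3 := by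
      have hz' : φ PowerSeries.X = x ^ 2 * (1 + x * m) := hz
      rw [hs1, hs2, hs3]
      simp only [map_add, map_mul, PowerSeries.algHom_C, hz']
      ring
    have key : PowerSeries.C (a1 - 1) * x ^ 2 + PowerSeries.C (u * (a1 - 1)) * x ^ 3 +
        PowerSeries.C (c * (a1 - 1) + a2 - (v ^ 2 + v * u)) * x ^ 4 =
        x ^ 5 * ((x * ρ ^ 2 - r1 +
          PowerSeries.C u * (3 * ρ + 3 * a ^ 2 + x * a ^ 3) +
          PowerSeries.C c * (a * (4 + 6 * x * a + 4 * x ^ 2 * a ^ 2 + x ^ 3 * a ^ 3)) +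
          (1 + x * a) ^ 5 * τ r1) - PowerSeries.C (a1 - 1) * r1 -
          PowerSeries.C a2 * (2 * m + x * m ^ 2) - x * (1 + x * m) ^ 3 * φ s3) := by
      have := hφs.symm.trans (hs.symm.trans hτz)
      simp only [map_sub, map_one, map_mul, map_add, map_pow] at this ⊢
      linear_combination this + (1 - PowerSeries.C a1) * x ^ 3 * hm
    have hcoef : ∀ i, i < 5 → PowerSeries.coeff i (PowerSeries.C (a1 - 1) * x ^ 2 +
        PowerSeries.C (u * (a1 - 1)) * x ^ 3 +
        PowerSeries.C (c * (a1 - 1) + a2 - (v ^ 2 + v * u)) * x ^ 4) = 0 := by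
      intro i hi
      exact PowerSeries.X_pow_dvd_iff.mp (Dvd.intro _ key.symm) i hi
    have h3 := hcoef 2 (by norm_num)
    have h4 := hcoef 4 (by norm_num)
    simp only [map_add, PowerSeries.coeff_C_mul, x, PowerSeries.coeff_X_pow] at h3 h4
    norm_num at h3 h4
    have ha1 : a1 = 1 := sub_eq_zero.mp h3
    have ha2 : a2 = v ^ 2 + v * u := by
      rw [h3, mul_zero, zero_add] at h4
      exact sub_eq_zero.mp h4
    refine ⟨s3, ?_⟩
    rw [hτ', hs1, hs2, hs3, ha1, ha2, map_one]
    ring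
  · intro f
    have : φ.comp τ' = τ.comp φ := by
      apply PowerSeries.algHom_ext
      · rw [AlgHom.comp_apply, AlgHom.comp_apply, hτ', hs]
      · rw [AlgHom.comp_apply, hτ', ← hs]
        simpa using PowerSeries.algHom_X_pow_dvd hτX (n := 1) (by simpa using hφX)
    exact congrArg (fun g : k⟦X⟧ →ₐ[k] k⟦X⟧ => g f) this

/-- Vanishing of the first cohomology of the maximal ideal of `k⟦X⟧` for an elementary abelian
`2`-group of automorphisms with conductor one. -/
theorem exists_coboundary (t : ℕ) (σ : Fin t → k⟦X⟧ →ₐ[k] k⟦X⟧) (u : Fin t → k)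
    (hw : ∀ i, IsWildWith (σ i) (u i)) (hinv : ∀ i f, σ i (σ i f) = f)
    (hcomm : ∀ i j f, σ i (σ j f) = σ j (σ i f))
    (hu : ∀ S : Finset (Fin t), S.Nonempty → ∑ i ∈ S, u i ≠ 0)
    (v : Fin t → k⟦X⟧) (hv0 : ∀ i, PowerSeries.constantCoeff (v i) = 0)
    (hv1 : ∀ i, v i + σ i (v i) = 0) (hv2 : ∀ i j, v i + σ i (v j) = v j + σ j (v i)) :
    ∃ b, PowerSeries.constantCoeff b = 0 ∧ ∀ i, σ i b + b = v i := by
  have h2 := PowerSeries.two_eq_zero (k := k)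
  induction t with
  | zero => exact ⟨0, by simp, fun i => i.elim0⟩
  | succ t ih =>
    have hu0 : u 0 ≠ 0 := by simpa using hu {0} (by simp)
    obtain ⟨φ, hφ, hinj, hφinv, hrange, hcob⟩ := exists_norm_algHom (hw 0) hu0 (hinv 0)
    have hφX : PowerSeries.X ∣ φ PowerSeries.X := by rw [hφ]; exact Dvd.intro _ rfl
    choose τ hτw hτ using fun i : Fin t =>
      exists_induced_algHom (hw 0) (hw i.succ) (hinv 0) (hcomm 0 i.succ) hφ hrange
    -- Inflation-restriction: on the first generator the cocycle is a coboundary, and subtracting it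
    -- makes the other values invariant under that generator, so they descend through φ.
    obtain ⟨b0, hb0, hb0v⟩ := hcob (v 0) (by linear_combination hv1 0 - v 0 * h2) (hv0 0)
    have hfix : ∀ i, ∃ w, v i + σ i b0 + b0 = φ w := by
      intro i
      apply hrange
      rw [map_add, map_add, hcomm 0 i b0]
      have h3 := hv2 0 i
      have h4 := congrArg (σ i) hb0v
      rw [map_add] at h4
      linear_combination h3 + hb0v + h4 + (σ i (v 0) - σ i b0 - b0) * h2
    choose w hw' using hfix
    obtain ⟨b1, hb1, hb1v⟩ := ih τ (fun i => u i.succ ^ 2 + u i.succ * u 0) hτw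
      (fun i f => hinj (by rw [hτ, hτ, hinv]))
      (fun i j f => hinj (by rw [hτ, hτ, hτ, hτ, hcomm]))
      (fun S hS => by
        -- By additivity of squaring, the induced sum factors into two sums of the original
        -- parameters, over S and over S together with the first index, so conductor one survives
        -- the descent.
        have hc : ∑ i ∈ S, (u i.succ ^ 2 + u i.succ * u 0) =
            (∑ i ∈ S, u i.succ) * (∑ i ∈ S, u i.succ + u 0) := by
          rw [Finset.sum_add_distrib, ← Finset.sum_mul, ← CharTwo.sum_sq]
          ring
        rw [hc]
        have h3 := hu (S.map (Fin.succEmb t)) (by simpa using hS)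
        have h4 := hu (insert 0 (S.map (Fin.succEmb t))) (by simp)
        rw [Finset.sum_insert (by simp [Fin.succ_ne_zero]), add_comm] at h4
        rw [Finset.sum_map] at h3 h4
        exact mul_ne_zero h3 h4)
      (fun i => w i.succ)
      (fun i => by
        rw [← PowerSeries.constantCoeff_algHom hφX, ← hw', map_add, map_add,
          PowerSeries.constantCoeff_algHom (hw i.succ).X_dvd, hv0, hb0]
        simp)
      (fun i => hinj (by
        rw [map_add, hτ, map_zero, ← hw', map_add, map_add, hinv]
        linear_combination hv1 i.succ + (σ i.succ b0 + b0) * h2))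
      (fun i j => hinj (by
        rw [map_add, map_add, hτ, hτ, ← hw', ← hw', map_add, map_add, map_add, map_add,
          hcomm i.succ j.succ b0]
        linear_combination hv2 i.succ j.succ + (σ i.succ b0 - σ j.succ b0) * h2))
    refine ⟨b0 + φ b1, by rw [map_add, PowerSeries.constantCoeff_algHom hφX, hb0, hb1, add_zero],
      fun i => ?_⟩
    refine Fin.cases ?_ (fun j => ?_) i
    · rw [map_add, hφinv]
      linear_combination hb0v + φ b1 * h2
    · have h3 := congrArg φ (hb1v j)
      rw [map_add, hτ, ← hw'] at h3
      rw [map_add]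
      linear_combination h3 + (σ j.succ b0 + b0) * h2

end CohomologyVanishing

/-! ### Coefficient rings and automorphisms of their power series rings -/

namespace CoeffRing

variable {p : ℕ} [Fact p.Prime] {k : Type u} [Field k]

theorem residue_surjective (A : CoeffRing p k) : Function.Surjective A.residue := by
  intro x
  refine ⟨algebraMap (WittVector p k) A (WittVector.teichmuller p x), ?_⟩
  rw [A.residue_algebraMap]
  exact WittVector.teichmuller_coeff_zero p x

theorem ker_residue (A : CoeffRing p k) :
    RingHom.ker A.residue = IsLocalRing.maximalIdeal A :=
  IsLocalRing.ker_eq_maximalIdeal _ A.residue_surjective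

theorem mem_maximalIdeal_iff (A : CoeffRing p k) (a : A) :
    a ∈ IsLocalRing.maximalIdeal A ↔ A.residue a = 0 := by
  rw [← A.ker_residue, RingHom.mem_ker]

theorem isUnit_iff (A : CoeffRing p k) (a : A) : IsUnit a ↔ A.residue a ≠ 0 := by
  rw [Ne, ← A.mem_maximalIdeal_iff, IsLocalRing.mem_maximalIdeal, mem_nonunits_iff, not_not]

/-- Since A is the image of W(k) plus its maximal ideal, it suffices that both residue maps agree on
W(k) and kill the maximal ideal. -/
theorem residue_map {A B : CoeffRing p k} (f : A →ₐ[WittVector p k] B) (a : A) :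
    B.residue (f a) = A.residue a := by
  have hker : RingHom.ker (B.residue.comp (f : A →+* B)) = IsLocalRing.maximalIdeal A := by
    apply IsLocalRing.ker_eq_maximalIdeal
    intro x
    obtain ⟨w, hw⟩ := WittVector.constantCoeff_surjective (p := p) x
    refine ⟨algebraMap _ A w, ?_⟩
    rw [RingHom.comp_apply, RingHom.coe_coe, AlgHom.commutes, B.residue_algebraMap, hw]
  obtain ⟨w, hw⟩ := WittVector.constantCoeff_surjective (p := p) (A.residue a)
  have h1 : a - algebraMap _ A w ∈ RingHom.ker (B.residue.comp (f : A →+* B)) := by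
    rw [hker, mem_maximalIdeal_iff, map_sub, residue_algebraMap, hw, sub_self]
  rw [RingHom.mem_ker, map_sub, sub_eq_zero, RingHom.comp_apply, RingHom.comp_apply,
    RingHom.coe_coe, AlgHom.commutes, B.residue_algebraMap, hw] at h1
  exact h1

/-- The power series ring over a coefficient ring. -/
noncomputable def powerSeries (A : CoeffRing p k) : CoeffRing p k where
  carrier := A⟦X⟧
  residue := A.residue.comp PowerSeries.constantCoeff
  residue_algebraMap w := by
    rw [RingHom.comp_apply, PowerSeries.algebraMap_apply, PowerSeries.constantCoeff_C,
      A.residue_algebraMap]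

/-- The quotient of a coefficient ring by a proper ideal with artinian quotient. -/
noncomputable def quotient (A : CoeffRing p k) (I : Ideal A) (hI : I ≠ ⊤)
    (h : IsArtinianRing (A ⧸ I)) : CoeffRing p k :=
  haveI : Nontrivial (A ⧸ I) := Ideal.Quotient.nontrivial_iff.mpr hI
  haveI : IsLocalRing (A ⧸ I) :=
    IsLocalRing.of_surjective' (Ideal.Quotient.mk I) Ideal.Quotient.mk_surjective
  { carrier := A ⧸ I
    residue := Ideal.Quotient.lift I A.residue fun a ha => by
      rw [← mem_maximalIdeal_iff]
      exact IsLocalRing.le_maximalIdeal hI ha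
    residue_algebraMap := fun w => by
      rw [← Ideal.Quotient.mk_algebraMap, Ideal.Quotient.lift_mk]
      exact A.residue_algebraMap w }

theorem exists_quotient (A : CoeffRing p k) (I : Ideal A) (hI : I ≠ ⊤)
    (h : IsArtinianRing (A ⧸ I)) :
    ∃ (B : CoeffRing p k) (π : A →ₐ[WittVector p k] B), IsArtinianRing B ∧
      Function.Surjective π ∧ ∀ a, π a = 0 ↔ a ∈ I :=
  ⟨A.quotient I hI h, Ideal.Quotient.mkₐ (WittVector p k) I, h, Ideal.Quotient.mk_surjective,
    fun _ => Ideal.Quotient.eq_zero_iff_mem⟩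

theorem isArtinianRing_quotient_pow (A : CoeffRing p k) {n : ℕ} :
    IsArtinianRing (A ⧸ IsLocalRing.maximalIdeal A ^ n) := by
  rcases Nat.eq_zero_or_pos n with rfl | hn
  · rw [pow_zero, Ideal.one_eq_top]
    infer_instance
  have hne : IsLocalRing.maximalIdeal A ^ n ≠ ⊤ := fun h =>
    Ideal.IsPrime.ne_top inferInstance (top_le_iff.mp (h ▸ Ideal.pow_le_self (by omega)))
  have : Nontrivial (A ⧸ IsLocalRing.maximalIdeal A ^ n) := Ideal.Quotient.nontrivial_iff.mpr hne
  have : IsLocalRing (A ⧸ IsLocalRing.maximalIdeal A ^ n) :=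
    IsLocalRing.of_surjective' (Ideal.Quotient.mk _) Ideal.Quotient.mk_surjective
  rw [isArtinianRing_iff_isNilpotent_maximalIdeal]
  refine ⟨n, ?_⟩
  rw [← IsLocalRing.map_maximalIdeal_of_surjective (Ideal.Quotient.mk _)
    Ideal.Quotient.mk_surjective, ← Ideal.map_pow, Ideal.map_quotient_self, Ideal.zero_eq_bot]

theorem exists_lift_powerSeries (A : CoeffRing p k) (F : k⟦X⟧) :
    ∃ F' : A⟦X⟧, PowerSeries.map A.residue F' = F :=
  PowerSeries.map_surjective _ A.residue_surjective F

theorem mem_maximalIdeal_powerSeries_iff (A : CoeffRing p k) (F : A⟦X⟧) :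
    F ∈ IsLocalRing.maximalIdeal A⟦X⟧ ↔
      PowerSeries.coeff 0 (PowerSeries.map A.residue F) = 0 := by
  rw [PowerSeries.mem_maximalIdeal_iff_coeff_zero, mem_maximalIdeal_iff, PowerSeries.coeff_map]

theorem isUnit_powerSeries_iff (A : CoeffRing p k) (F : A⟦X⟧) :
    IsUnit F ↔ PowerSeries.coeff 0 (PowerSeries.map A.residue F) ≠ 0 := by
  rw [Ne, ← A.mem_maximalIdeal_powerSeries_iff, IsLocalRing.mem_maximalIdeal, mem_nonunits_iff,
    not_not]

/-- A parameter of `A⟦X⟧`. -/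
def IsParam (A : CoeffRing p k) (Y : A⟦X⟧) : Prop :=
  PowerSeries.coeff 0 (PowerSeries.map A.residue Y) = 0 ∧
    PowerSeries.coeff 1 (PowerSeries.map A.residue Y) ≠ 0

/-- The constant term of Y is in the maximal ideal and its linear coefficient is a unit, so the
substitution X ↦ Y carries generators of the maximal ideal to generators. Completeness gives
surjectivity from the residue field, and injectivity follows by noetherianity. -/
theorem IsParam.exists_algEquiv {A : CoeffRing p k} {Y : A⟦X⟧} (hY : A.IsParam Y) :
    ∃ e : A⟦X⟧ ≃ₐ[A] A⟦X⟧, e PowerSeries.X = Y := by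
  obtain ⟨F, hF, hFX⟩ := PowerSeries.exists_ringHom_of_mem (IsLocalRing.maximalIdeal A⟦X⟧)
    (PowerSeries.C (R := A)) ((A.mem_maximalIdeal_powerSeries_iff Y).mpr hY.1)
  have hmap : (IsLocalRing.maximalIdeal A⟦X⟧).map F = IsLocalRing.maximalIdeal A⟦X⟧ := by
    have hC : ∀ a ∈ IsLocalRing.maximalIdeal A, PowerSeries.C a ∈
        (IsLocalRing.maximalIdeal A⟦X⟧).map F := by
      intro a ha
      rw [← hF]
      apply Ideal.mem_map_of_mem
      rw [PowerSeries.mem_maximalIdeal_iff_coeff_zero]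
      simpa using ha
    have hX : PowerSeries.X ∈ (IsLocalRing.maximalIdeal A⟦X⟧).map F := by
      have h1 : Y ∈ (IsLocalRing.maximalIdeal A⟦X⟧).map F := by
        rw [← hFX]
        apply Ideal.mem_map_of_mem
        rw [PowerSeries.mem_maximalIdeal_iff_coeff_zero]
        simp
      obtain ⟨g, hg⟩ := PowerSeries.exists_eq_C_add_X_mul Y
      have hunit : IsUnit g := by
        rw [PowerSeries.isUnit_iff_constantCoeff, isUnit_iff]
        have := hY.2
        rw [PowerSeries.coeff_map, hg, map_add, PowerSeries.coeff_C, if_neg one_ne_zero, zero_add,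
          ← zero_add 1, PowerSeries.coeff_succ_X_mul] at this
        simpa using this
      have h0 : PowerSeries.constantCoeff Y ∈ IsLocalRing.maximalIdeal A := by
        rw [mem_maximalIdeal_iff]
        simpa using hY.1
      have h2 : PowerSeries.X * g ∈ (IsLocalRing.maximalIdeal A⟦X⟧).map F := by
        have : PowerSeries.X * g = Y - PowerSeries.C (PowerSeries.constantCoeff Y) := by
          linear_combination -hg
        rw [this]
        exact Ideal.sub_mem _ h1 (hC _ h0)
      exact (Ideal.mul_unit_mem_iff_mem _ hunit).mp h2
    apply le_antisymm
    · rw [Ideal.map_le_iff_le_comap]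
      intro f hf
      obtain ⟨g, hg⟩ := PowerSeries.exists_eq_C_add_X_mul f
      rw [Ideal.mem_comap, hg, map_add, map_mul, hF, hFX]
      refine Ideal.add_mem _ ?_ (Ideal.mul_mem_right _ _
        ((A.mem_maximalIdeal_powerSeries_iff Y).mpr hY.1))
      rw [PowerSeries.mem_maximalIdeal_iff_coeff_zero] at hf ⊢
      simpa using hf
    · intro f hf
      obtain ⟨g, hg⟩ := PowerSeries.exists_eq_C_add_X_mul f
      rw [hg]
      refine Ideal.add_mem _ (hC _ ?_) (Ideal.mul_mem_right _ _ hX)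
      rw [PowerSeries.mem_maximalIdeal_iff_coeff_zero] at hf
      simpa using hf
  have hsurj : Function.Surjective F := by
    have : IsHausdorff ((IsLocalRing.maximalIdeal A⟦X⟧).map F) A⟦X⟧ := by
      rw [hmap]; infer_instance
    apply surjective_of_mk_map_comp_surjective F (I := IsLocalRing.maximalIdeal A⟦X⟧)
    intro y
    obtain ⟨f, rfl⟩ := Ideal.Quotient.mk_surjective y
    refine ⟨PowerSeries.C (PowerSeries.constantCoeff f), ?_⟩
    rw [RingHom.comp_apply, hF, Ideal.Quotient.eq, hmap, PowerSeries.mem_maximalIdeal_iff_coeff_zero]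
    simp
  let F' : A⟦X⟧ →ₐ[A] A⟦X⟧ := { F with commutes' := hF }
  exact ⟨AlgEquiv.ofBijective F'
    ⟨RingHom.injective_of_surjective_of_isNoetherianRing F hsurj, hsurj⟩, hFX⟩

theorem IsParam.ringHom_ext {A B : CoeffRing p k} {Y : A⟦X⟧} (hY : A.IsParam Y)
    {F F' : A⟦X⟧ →+* B⟦X⟧} (hC : ∀ a, F (PowerSeries.C a) = F' (PowerSeries.C a))
    (h : F Y = F' Y) (h0 : PowerSeries.coeff 0 (PowerSeries.map B.residue (F Y)) = 0) : F = F' := by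
  obtain ⟨e, he⟩ := hY.exists_algEquiv
  have hCe : ∀ a, e (PowerSeries.C a) = PowerSeries.C a := e.commutes
  have : F.comp (e : A⟦X⟧ →+* A⟦X⟧) = F'.comp (e : A⟦X⟧ →+* A⟦X⟧) := by
    apply PowerSeries.ringHom_ext_of_mem (IsLocalRing.maximalIdeal B⟦X⟧)
    · intro a
      simp only [RingHom.comp_apply, RingHom.coe_coe, hCe, hC]
    · simp only [RingHom.comp_apply, RingHom.coe_coe, he, h]
    · simp only [RingHom.comp_apply, RingHom.coe_coe, he]
      rwa [mem_maximalIdeal_powerSeries_iff]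
  ext1 f
  obtain ⟨g, rfl⟩ := e.surjective f
  exact congrArg (fun φ : A⟦X⟧ →+* B⟦X⟧ => φ g) this

theorem IsParam.algEquiv_ext {A : CoeffRing p k} {Y : A⟦X⟧} (hY : A.IsParam Y)
    {φ ψ : A⟦X⟧ ≃ₐ[A] A⟦X⟧} (h : φ Y = ψ Y)
    (h0 : PowerSeries.coeff 0 (PowerSeries.map A.residue (φ Y)) = 0) : φ = ψ := by
  have := hY.ringHom_ext (F := (φ : A⟦X⟧ →+* A⟦X⟧)) (F' := (ψ : A⟦X⟧ →+* A⟦X⟧))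
    (fun a => (φ.commutes a).trans (ψ.commutes a).symm) h h0
  ext1 f
  exact congrArg (fun F : A⟦X⟧ →+* A⟦X⟧ => F f) this

theorem isParam_X (A : CoeffRing p k) : A.IsParam PowerSeries.X := by
  simp [IsParam]

theorem IsParam.map {A B : CoeffRing p k} (f : A →ₐ[WittVector p k] B) {Y : A⟦X⟧} :
    PowerSeries.map B.residue (PowerSeries.map (f : A →+* B) Y) = PowerSeries.map A.residue Y := by
  ext n
  simp [residue_map]

/-- Reduction to the residue field of the automorphism `X ↦ Y`. -/
theorem IsParam.map_residue_eq {A : CoeffRing p k} {Y : A⟦X⟧} (hY : A.IsParam Y)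
    (F : A⟦X⟧ ≃ₐ[A] A⟦X⟧) (g : k⟦X⟧ ≃ₐ[k] k⟦X⟧)
    (h : PowerSeries.map A.residue (F Y) = g (PowerSeries.map A.residue Y))
    (h0 : PowerSeries.coeff 0 (g (PowerSeries.map A.residue Y)) = 0) (f : A⟦X⟧) :
    PowerSeries.map A.residue (F f) = g (PowerSeries.map A.residue f) := by
  obtain ⟨e, he⟩ := hY.exists_algEquiv
  have hCe : ∀ a, e (PowerSeries.C a) = PowerSeries.C a := e.commutes
  have hCF : ∀ a, F (PowerSeries.C a) = PowerSeries.C a := F.commutes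
  have hCg : ∀ a, g (PowerSeries.C a) = PowerSeries.C a := g.commutes
  have : ((PowerSeries.map A.residue).comp (F : A⟦X⟧ →+* A⟦X⟧)).comp (e : A⟦X⟧ →+* A⟦X⟧) =
      ((g : k⟦X⟧ →+* k⟦X⟧).comp (PowerSeries.map A.residue)).comp (e : A⟦X⟧ →+* A⟦X⟧) := by
    apply PowerSeries.ringHom_ext_of_mem (IsLocalRing.maximalIdeal k⟦X⟧)
    · intro a
      simp [hCe, hCF, hCg]
    · simp only [RingHom.comp_apply, RingHom.coe_coe, he, h]
    · simp only [RingHom.comp_apply, RingHom.coe_coe, he, h]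
      rw [PowerSeries.mem_maximalIdeal_iff_coeff_zero, h0]
      exact Ideal.zero_mem _
  obtain ⟨f', rfl⟩ := e.surjective f
  exact congrArg (fun φ : A⟦X⟧ →+* k⟦X⟧ => φ f') this

end CoeffRing

/-! ### Generators and relations of elementary abelian 2-groups -/

section ElementaryAbelian

/-- The hom out of `ℤ/2` given by an involution. -/
def involutionHom {M : Type*} [Monoid M] (m : M) (hm : m * m = 1) :
    Multiplicative (ZMod 2) →* M where
  toFun x := if x = 1 then 1 else m
  map_one' := if_pos rfl
  map_mul' x y := by
    have hx : ∀ x : Multiplicative (ZMod 2), x = 1 ∨ x = Multiplicative.ofAdd 1 := by decide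
    have h1 : (Multiplicative.ofAdd 1 : Multiplicative (ZMod 2)) ≠ 1 := by decide
    have h2 : (Multiplicative.ofAdd 1 * Multiplicative.ofAdd 1 : Multiplicative (ZMod 2)) = 1 := by
      decide
    rcases hx x with rfl | rfl <;> rcases hx y with rfl | rfl <;> simp [h1, h2, hm]

variable {t : ℕ} {Γ : Type*} [Group Γ]

/-- The generators of an elementary abelian `2`-group. -/
def elemGen (e : Γ ≃* Multiplicative (Fin t → ZMod 2)) (i : Fin t) : Γ :=
  e.symm (Multiplicative.ofAdd (Pi.single i 1))

theorem elemGen_mul_self (e : Γ ≃* Multiplicative (Fin t → ZMod 2)) (i : Fin t) :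
    elemGen e i * elemGen e i = 1 := by
  rw [elemGen, ← map_mul, ← ofAdd_add, ← Pi.single_add]
  have : (1 + 1 : ZMod 2) = 0 := by decide
  rw [this, Pi.single_zero, ofAdd_zero, map_one]

theorem elemGen_mul_comm (e : Γ ≃* Multiplicative (Fin t → ZMod 2)) (g h : Γ) :
    g * h = h * g := by
  apply e.injective
  rw [map_mul, map_mul, mul_comm]

theorem elemGen_induction (e : Γ ≃* Multiplicative (Fin t → ZMod 2)) {P : Γ → Prop}
    (h1 : P 1) (hmul : ∀ g h, P g → P h → P (g * h)) (hgen : ∀ i, P (elemGen e i)) (g : Γ) :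
    P g := by
  have key : ∀ S : Finset (Fin t), ∀ x : Fin t → ZMod 2,
      P (e.symm (Multiplicative.ofAdd (∑ i ∈ S, Pi.single i (x i)))) := by
    intro S x
    induction S using Finset.induction_on with
    | empty => simpa using h1
    | insert i S hi ih =>
      rw [Finset.sum_insert hi, ofAdd_add, map_mul]
      refine hmul _ _ ?_ ih
      have hx : ∀ a : ZMod 2, a = 0 ∨ a = 1 := by decide
      rcases hx (x i) with h | h
      · rw [h, Pi.single_zero, ofAdd_zero, map_one]; exact h1
      · rw [h]; exact hgen i
  have := key Finset.univ (Multiplicative.toAdd (e g))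
  rw [Finset.univ_sum_single] at this
  simpa using this

theorem elemGen_exists_hom (e : Γ ≃* Multiplicative (Fin t → ZMod 2)) {M : Type*} [Monoid M]
    (m : Fin t → M) (hm : ∀ i, m i * m i = 1) (hc : ∀ i j, m i * m j = m j * m i) :
    ∃ F : Γ →* M, ∀ i, F (elemGen e i) = m i := by
  let F0 : (∀ _ : Fin t, Multiplicative (ZMod 2)) →* M :=
    MonoidHom.noncommPiCoprod (fun i => involutionHom (m i) (hm i)) (by
      intro i j _ x y
      simp only [involutionHom, MonoidHom.coe_mk, OneHom.coe_mk]
      split_ifs <;> simp [Commute, SemiconjBy, hc])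
  let c : Multiplicative (Fin t → ZMod 2) →* (∀ _ : Fin t, Multiplicative (ZMod 2)) :=
    { toFun := fun x i => Multiplicative.ofAdd (Multiplicative.toAdd x i)
      map_one' := rfl
      map_mul' := fun _ _ => rfl }
  refine ⟨(F0.comp c).comp e.toMonoidHom, fun i => ?_⟩
  have h1 : c (e (elemGen e i)) = Pi.mulSingle i (Multiplicative.ofAdd 1) := by
    rw [elemGen, MulEquiv.apply_symm_apply]
    funext j
    rcases eq_or_ne j i with rfl | hj
    · simp [c]
    · simp [c, hj]
  change F0 (c (e (elemGen e i))) = m i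
  rw [h1]
  have h2 : (Multiplicative.ofAdd 1 : Multiplicative (ZMod 2)) ≠ 1 := by decide
  simp [F0, involutionHom, h2]

theorem elemGen_hom_ext (e : Γ ≃* Multiplicative (Fin t → ZMod 2)) {M : Type*} [Monoid M]
    {F F' : Γ →* M} (h : ∀ i, F (elemGen e i) = F' (elemGen e i)) : F = F' := by
  ext g
  refine elemGen_induction e (P := fun g => F g = F' g) ?_ ?_ h g
  · rw [map_one, map_one]
  · intro g h hg hh
    rw [map_mul, map_mul, hg, hh]

end ElementaryAbelian

/-! ### Base change and equivalence of lifts -/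

section Lifts

variable {p : ℕ} [Fact p.Prime] {k : Type u} [Field k] {G : Subgroup (k⟦X⟧ ≃ₐ[k] k⟦X⟧)}

/-- All elements of `G` are tangent to the identity. -/
def IsTangentToOne (G : Subgroup (k⟦X⟧ ≃ₐ[k] k⟦X⟧)) : Prop :=
  ∀ g : G, PowerSeries.coeff 0 ((g : k⟦X⟧ ≃ₐ[k] k⟦X⟧) PowerSeries.X) = 0 ∧
    PowerSeries.coeff 1 ((g : k⟦X⟧ ≃ₐ[k] k⟦X⟧) PowerSeries.X) = 1

theorem IsTangentToOne.coeff_zero (hG : IsTangentToOne G) (g : G) (f : k⟦X⟧) :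
    PowerSeries.coeff 0 ((g : k⟦X⟧ ≃ₐ[k] k⟦X⟧) f) = PowerSeries.coeff 0 f := by
  have h : PowerSeries.X ∣ ((g : k⟦X⟧ ≃ₐ[k] k⟦X⟧) : k⟦X⟧ →ₐ[k] k⟦X⟧) PowerSeries.X := by
    rw [PowerSeries.X_dvd_iff]
    simpa using (hG g).1
  simpa using PowerSeries.constantCoeff_algHom h f

namespace Lift

variable {A B C : CoeffRing p k}

theorem map_residue_X (ρ : Lift G A) (g : G) :
    PowerSeries.map A.residue (ρ.toHom g PowerSeries.X) =
      (g : k⟦X⟧ ≃ₐ[k] k⟦X⟧) PowerSeries.X := by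
  rw [ρ.reduces, PowerSeries.map_X]

theorem toHom_C (ρ : Lift G A) (g : G) (a : A) :
    ρ.toHom g (PowerSeries.C a) = PowerSeries.C a := (ρ.toHom g).commutes a

/-- The pushed-forward image of X has the same residue, so it is a parameter and defines an
automorphism. Multiplicativity is checked on X, which determines an automorphism. -/
theorem exists_isBaseChange (hG : IsTangentToOne G) (f : A →ₐ[WittVector p k] B) (ρ : Lift G A) :
    ∃ ρ' : Lift G B, ρ.IsBaseChange f ρ' := by
  have hres : ∀ g, PowerSeries.map B.residue (PowerSeries.map (f : A →+* B)
      (ρ.toHom g PowerSeries.X)) = (g : k⟦X⟧ ≃ₐ[k] k⟦X⟧) PowerSeries.X := fun g => by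
    rw [CoeffRing.IsParam.map, ρ.map_residue_X]
  have hparam : ∀ g, B.IsParam (PowerSeries.map (f : A →+* B) (ρ.toHom g PowerSeries.X)) := by
    intro g
    rw [CoeffRing.IsParam, hres]
    exact ⟨(hG g).1, by rw [(hG g).2]; exact one_ne_zero⟩
  choose E hE using fun g => (hparam g).exists_algEquiv
  have hEC : ∀ g a, E g (PowerSeries.C a) = PowerSeries.C a := fun g a => (E g).commutes a
  have key : ∀ g F, PowerSeries.map (f : A →+* B) (ρ.toHom g F) =
      E g (PowerSeries.map (f : A →+* B) F) := by
    intro g F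
    have := A.isParam_X.ringHom_ext (B := B)
      (F := (PowerSeries.map (f : A →+* B)).comp (ρ.toHom g : A⟦X⟧ →+* A⟦X⟧))
      (F' := (E g : B⟦X⟧ →+* B⟦X⟧).comp (PowerSeries.map (f : A →+* B)))
      (fun a => by simp [toHom_C, hEC]) (by simp [hE]) (by
        simp only [RingHom.comp_apply, RingHom.coe_coe]
        rw [hres]
        exact (hG g).1)
    exact congrArg (fun φ : A⟦X⟧ →+* B⟦X⟧ => φ F) this
  have hmul : ∀ g h, E (g * h) = E g * E h := by
    intro g h
    apply B.isParam_X.algEquiv_ext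
    · rw [hE, AlgEquiv.mul_apply, hE, ← key, map_mul, AlgEquiv.mul_apply]
    · rw [hE, hres]
      exact (hG _).1
  refine ⟨⟨MonoidHom.mk' E hmul, fun g F => ?_⟩, key⟩
  refine B.isParam_X.map_residue_eq _ _ ?_ ?_ F
  · change PowerSeries.map B.residue (E g _) = _
    rw [hE, hres, PowerSeries.map_X]
  · rw [PowerSeries.map_X]
    exact (hG g).1

theorem IsBaseChange.unique (hG : IsTangentToOne G) {f : A →ₐ[WittVector p k] B} {ρ : Lift G A}
    {ρ' ρ'' : Lift G B} (h' : ρ.IsBaseChange f ρ') (h'' : ρ.IsBaseChange f ρ'') : ρ' = ρ'' := by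
  have : ρ'.toHom = ρ''.toHom := by
    ext1 g
    apply B.isParam_X.algEquiv_ext
    · rw [← PowerSeries.map_X (f : A →+* B), ← h', ← h'']
    · rw [ρ'.map_residue_X]
      exact (hG g).1
  cases ρ'; cases ρ''; congr

theorem IsBaseChange.comp {f : A →ₐ[WittVector p k] B} {g : B →ₐ[WittVector p k] C}
    {ρ : Lift G A} {ρ' : Lift G B} {ρ'' : Lift G C} (h : ρ.IsBaseChange f ρ')
    (h' : ρ'.IsBaseChange g ρ'') : ρ.IsBaseChange (g.comp f) ρ'' := by
  intro x F
  have hc : ∀ F : A⟦X⟧, PowerSeries.map ((g.comp f : A →ₐ[WittVector p k] C) : A →+* C) F =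
      PowerSeries.map (g : B →+* C) (PowerSeries.map (f : A →+* B) F) := by
    intro F
    ext n
    simp
  rw [hc, h, h', hc]

theorem isBaseChange_id (ρ : Lift G A) : ρ.IsBaseChange (AlgHom.id _ _) ρ := by
  intro x F
  have hc : ∀ F : A⟦X⟧, PowerSeries.map ((AlgHom.id (WittVector p k) A : A →ₐ[WittVector p k] A) :
      A →+* A) F = F := by
    intro F
    ext n
    simp
  rw [hc, hc]

theorem Equivalent.refl (ρ : Lift G A) : ρ.Equivalent ρ :=
  ⟨1, fun _ => rfl, fun g => by group⟩

theorem Equivalent.symm {ρ ρ' : Lift G A} (h : ρ.Equivalent ρ') : ρ'.Equivalent ρ := by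
  obtain ⟨γ, hγ, h⟩ := h
  refine ⟨γ⁻¹, fun F => ?_, fun g => by rw [h]; group⟩
  rw [← hγ (γ⁻¹ F), ← AlgEquiv.mul_apply, mul_inv_cancel, AlgEquiv.one_apply]

theorem Equivalent.trans {ρ ρ' ρ'' : Lift G A} (h : ρ.Equivalent ρ') (h' : ρ'.Equivalent ρ'') :
    ρ.Equivalent ρ'' := by
  obtain ⟨γ, hγ, h⟩ := h
  obtain ⟨γ', hγ', h'⟩ := h'
  refine ⟨γ' * γ, fun F => ?_, fun g => by rw [h', h]; group⟩
  rw [AlgEquiv.mul_apply, hγ', hγ]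

theorem Equivalent.baseChange (hG : IsTangentToOne G) {f : A →ₐ[WittVector p k] B}
    {ρ ρ' : Lift G A} (h : ρ.Equivalent ρ') {σ σ' : Lift G B} (hσ : ρ.IsBaseChange f σ)
    (hσ' : ρ'.IsBaseChange f σ') : σ.Equivalent σ' := by
  obtain ⟨γ, hγ, h⟩ := h
  have hγC : ∀ a, γ (PowerSeries.C a) = PowerSeries.C a := γ.commutes
  have hres : PowerSeries.map B.residue (PowerSeries.map (f : A →+* B) (γ PowerSeries.X)) =
      PowerSeries.X := by
    rw [CoeffRing.IsParam.map, hγ, PowerSeries.map_X]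
  have hparam : B.IsParam (PowerSeries.map (f : A →+* B) (γ PowerSeries.X)) := by
    rw [CoeffRing.IsParam, hres]
    simp
  obtain ⟨δ, hδ⟩ := hparam.exists_algEquiv
  have hδC : ∀ a, δ (PowerSeries.C a) = PowerSeries.C a := δ.commutes
  have key : ∀ F, PowerSeries.map (f : A →+* B) (γ F) = δ (PowerSeries.map (f : A →+* B) F) := by
    intro F
    have := A.isParam_X.ringHom_ext (B := B)
      (F := (PowerSeries.map (f : A →+* B)).comp (γ : A⟦X⟧ →+* A⟦X⟧))
      (F' := (δ : B⟦X⟧ →+* B⟦X⟧).comp (PowerSeries.map (f : A →+* B)))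
      (fun a => by simp [hγC, hδC]) (by simp [hδ]) (by
        simp only [RingHom.comp_apply, RingHom.coe_coe]
        rw [hres]
        simp)
    exact congrArg (fun φ : A⟦X⟧ →+* B⟦X⟧ => φ F) this
  refine ⟨δ, fun F => ?_, fun g => ?_⟩
  · refine B.isParam_X.map_residue_eq δ 1 ?_ ?_ F
    · rw [hδ, hres, PowerSeries.map_X]; rfl
    · rw [PowerSeries.map_X]; simp
  · rw [eq_mul_inv_iff_mul_eq]
    apply B.isParam_X.algEquiv_ext
    · rw [AlgEquiv.mul_apply, AlgEquiv.mul_apply, ← PowerSeries.map_X (f : A →+* B), ← key,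
        ← hσ', ← hσ, ← key, h, AlgEquiv.mul_apply, AlgEquiv.mul_apply, ← AlgEquiv.mul_apply γ⁻¹,
        inv_mul_cancel, AlgEquiv.one_apply]
    · rw [AlgEquiv.mul_apply, hδ, σ'.reduces, hres]
      exact (hG g).1

theorem Induces.comp (hG : IsTangentToOne G) {f : A →ₐ[WittVector p k] B}
    {g : B →ₐ[WittVector p k] C} {ρ : Lift G A} {ρ' : Lift G B} {ρ'' : Lift G C}
    (h : ρ.Induces f ρ') (h' : ρ'.Induces g ρ'') : ρ.Induces (g.comp f) ρ'' := by
  obtain ⟨σ, hσ, hσ'⟩ := h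
  obtain ⟨τ, hτ, hτ'⟩ := h'
  obtain ⟨ω, hω⟩ := σ.exists_isBaseChange hG g
  exact ⟨ω, hσ.comp hω, (hσ'.baseChange hG hω hτ).trans hτ'⟩

end Lift

end Lifts

/-! ### Möbius parameters over the residue field -/

section Frames

variable {k : Type u} [Field k]

/-- Generators of an elementary abelian `2`-group of automorphisms of `k⟦X⟧` with conductor one,
together with a parameter `y` in which they are the Möbius transformations `y ↦ y / (1 + uᵢ y)`. -/
structure MobiusFrame (G : Subgroup (k⟦X⟧ ≃ₐ[k] k⟦X⟧)) (t : ℕ) where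
  equiv : G ≃* Multiplicative (Fin t → ZMod 2)
  u : Fin t → k
  y : k⟦X⟧
  tangent : IsTangentToOne G
  coeff_zero_y : PowerSeries.coeff 0 y = 0
  coeff_one_y : PowerSeries.coeff 1 y = 1
  sum_ne_zero : ∀ S : Finset (Fin t), S.Nonempty → ∑ i ∈ S, u i ≠ 0
  isWild : ∀ i, IsWildWith (((elemGen equiv i : G) : k⟦X⟧ ≃ₐ[k] k⟦X⟧) : k⟦X⟧ →ₐ[k] k⟦X⟧) (u i)
  rel : ∀ i, y + ((elemGen equiv i : G) : k⟦X⟧ ≃ₐ[k] k⟦X⟧) y +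
    PowerSeries.C (u i) * y * ((elemGen equiv i : G) : k⟦X⟧ ≃ₐ[k] k⟦X⟧) y = 0

variable {G : Subgroup (k⟦X⟧ ≃ₐ[k] k⟦X⟧)}

theorem HasConductorOne.coeff_eq (hG : HasConductorOne G) (g : G) {i : ℕ} (hi : i < 2) :
    PowerSeries.coeff i ((g : k⟦X⟧ ≃ₐ[k] k⟦X⟧) PowerSeries.X) =
      PowerSeries.coeff i PowerSeries.X := by
  have h1 : (g : k⟦X⟧ ≃ₐ[k] k⟦X⟧) ∈ ramificationGroup G 1 := by rw [hG.1]; exact g.2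
  have h2 : ((i : ℕ) : ℕ∞) < ((g : k⟦X⟧ ≃ₐ[k] k⟦X⟧) PowerSeries.X - PowerSeries.X).order :=
    lt_of_le_of_lt (by exact_mod_cast Nat.lt_succ_iff.mp hi) h1.2
  have := PowerSeries.coeff_of_lt_order i h2
  rwa [map_sub, sub_eq_zero] at this

theorem HasConductorOne.isTangentToOne (hG : HasConductorOne G) : IsTangentToOne G := by
  intro g
  rw [hG.coeff_eq g (by norm_num), hG.coeff_eq g (by norm_num)]
  simp

theorem HasConductorOne.isWildWith (hG : HasConductorOne G) (g : G) :
    IsWildWith ((g : k⟦X⟧ ≃ₐ[k] k⟦X⟧) : k⟦X⟧ →ₐ[k] k⟦X⟧)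
      (PowerSeries.coeff 2 ((g : k⟦X⟧ ≃ₐ[k] k⟦X⟧) PowerSeries.X)) := by
  set f := (g : k⟦X⟧ ≃ₐ[k] k⟦X⟧) PowerSeries.X with hf
  have h : PowerSeries.X ^ 3 ∣ f - PowerSeries.X -
      PowerSeries.C (PowerSeries.coeff 2 f) * PowerSeries.X ^ 2 := by
    rw [PowerSeries.X_pow_dvd_iff]
    intro m hm
    have h0 := hG.coeff_eq g (i := 0) (by norm_num)
    have h1 := hG.coeff_eq g (i := 1) (by norm_num)
    rw [← hf] at h0 h1
    interval_cases m
    · rw [map_sub, map_sub, h0]; simp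
    · rw [map_sub, map_sub, h1]; simp [PowerSeries.coeff_X_pow]
    · simp [PowerSeries.coeff_X, PowerSeries.coeff_X_pow]
  obtain ⟨r, hr⟩ := h
  exact ⟨r, by rw [← hr, AlgEquiv.coe_toAlgHom]; ring⟩

theorem IsWildWith.coeff_two {σ : k⟦X⟧ →ₐ[k] k⟦X⟧} {u : k} (h : IsWildWith σ u) :
    PowerSeries.coeff 2 (σ PowerSeries.X) = u := by
  obtain ⟨r, hr⟩ := h
  rw [hr]
  simp [PowerSeries.coeff_X, PowerSeries.coeff_X_pow, PowerSeries.coeff_X_pow_mul']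

theorem IsWildWith.comp {σ τ : k⟦X⟧ →ₐ[k] k⟦X⟧} {u v : k} (h : IsWildWith σ u)
    (h' : IsWildWith τ v) : IsWildWith (σ.comp τ) (u + v) := by
  obtain ⟨r, hr⟩ := h
  obtain ⟨s, hs⟩ := h'
  have hr' : σ PowerSeries.X = PowerSeries.X * (1 + PowerSeries.X *
    (PowerSeries.C u + PowerSeries.X * r)) := by rw [hr]; ring
  refine ⟨r + PowerSeries.C v * (2 * (PowerSeries.C u + PowerSeries.X * r) +
    PowerSeries.X * (PowerSeries.C u + PowerSeries.X * r) ^ 2) +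
    (1 + PowerSeries.X * (PowerSeries.C u + PowerSeries.X * r)) ^ 3 * σ s, ?_⟩
  rw [AlgHom.comp_apply, hs]
  simp only [map_add, map_mul, map_pow, PowerSeries.algHom_C, hr']
  ring

theorem HasConductorOne.eq_one (hG : HasConductorOne G) (g : G)
    (h : PowerSeries.coeff 2 ((g : k⟦X⟧ ≃ₐ[k] k⟦X⟧) PowerSeries.X) = 0) : g = 1 := by
  have h2 : (g : k⟦X⟧ ≃ₐ[k] k⟦X⟧) ∈ ramificationGroup G 2 := by
    refine ⟨g.2, ?_⟩
    refine lt_of_lt_of_le (b := ((3 : ℕ) : ℕ∞)) (by norm_num) (PowerSeries.nat_le_order _ _ ?_)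
    intro i hi
    rw [map_sub, sub_eq_zero]
    interval_cases i
    · exact hG.coeff_eq g (by norm_num)
    · exact hG.coeff_eq g (by norm_num)
    · rw [h, PowerSeries.coeff_X]; simp
  rw [hG.2, Set.mem_singleton_iff] at h2
  exact Subtype.ext h2

/-- The quadratic coefficient is a homomorphism from G to the additive group of k, with trivial
kernel because G₂ = 1; the sum is its value on a nontrivial product of generators. -/
theorem HasConductorOne.sum_ne_zero {t : ℕ} (hG : HasConductorOne G)
    (e : G ≃* Multiplicative (Fin t → ZMod 2)) (S : Finset (Fin t)) (hS : S.Nonempty) :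
    ∑ i ∈ S, PowerSeries.coeff 2 (((elemGen e i : G) : k⟦X⟧ ≃ₐ[k] k⟦X⟧) PowerSeries.X) ≠ 0 := by
  have hmul : ∀ g h : G, PowerSeries.coeff 2 (((g * h : G) : k⟦X⟧ ≃ₐ[k] k⟦X⟧) PowerSeries.X) =
      PowerSeries.coeff 2 ((g : k⟦X⟧ ≃ₐ[k] k⟦X⟧) PowerSeries.X) +
      PowerSeries.coeff 2 ((h : k⟦X⟧ ≃ₐ[k] k⟦X⟧) PowerSeries.X) := fun g h =>
    ((hG.isWildWith g).comp (hG.isWildWith h)).coeff_two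
  have hsum : ∀ S : Finset (Fin t), ∑ i ∈ S, PowerSeries.coeff 2
      (((elemGen e i : G) : k⟦X⟧ ≃ₐ[k] k⟦X⟧) PowerSeries.X) = PowerSeries.coeff 2
      ((e.symm (Multiplicative.ofAdd (∑ i ∈ S, Pi.single i 1)) : k⟦X⟧ ≃ₐ[k] k⟦X⟧)
        PowerSeries.X) := by
    intro S
    induction S using Finset.induction_on with
    | empty => simp [PowerSeries.coeff_X]
    | insert i S hi ih =>
      rw [Finset.sum_insert hi, Finset.sum_insert hi, ofAdd_add, map_mul, hmul, ih]
      rfl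
  rw [hsum]
  intro h0
  have h1 := hG.eq_one _ h0
  rw [MulEquiv.map_eq_one_iff, ofAdd_eq_one] at h1
  obtain ⟨i, hi⟩ := hS
  have h2 := congrFun h1 i
  rw [Finset.sum_apply, Finset.sum_eq_single i] at h2
  · simp at h2
  · intro j _ hj
    simp [hj.symm]
  · exact fun h => absurd hi h

variable [CharP k 2]

/-- The elements v i = 1/X + 1/g_i(X) - u_i form a cocycle in the maximal ideal. If b trivialises
it, then 1/y = 1/X + b is translated by exactly u_i. -/
theorem HasConductorOne.exists_mobiusFrame {t : ℕ} (hG : HasConductorOne G)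
    (e : G ≃* Multiplicative (Fin t → ZMod 2)) : Nonempty (MobiusFrame G t) := by
  have h2 := PowerSeries.two_eq_zero (k := k)
  let g : Fin t → k⟦X⟧ →ₐ[k] k⟦X⟧ := fun i =>
    (((elemGen e i : G) : k⟦X⟧ ≃ₐ[k] k⟦X⟧) : k⟦X⟧ →ₐ[k] k⟦X⟧)
  let u : Fin t → k := fun i => PowerSeries.coeff 2 (g i PowerSeries.X)
  have hw : ∀ i, IsWildWith (g i) (u i) := fun i => hG.isWildWith _
  have hinv : ∀ i f, g i (g i f) = f := by
    intro i f
    have : ((elemGen e i : G) : k⟦X⟧ ≃ₐ[k] k⟦X⟧) * ((elemGen e i : G) : k⟦X⟧ ≃ₐ[k] k⟦X⟧) = 1 := by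
      exact_mod_cast congrArg Subtype.val (elemGen_mul_self e i)
    exact congrArg (fun φ : k⟦X⟧ ≃ₐ[k] k⟦X⟧ => φ f) this
  have hcomm : ∀ i j f, g i (g j f) = g j (g i f) := by
    intro i j f
    have := congrArg Subtype.val (elemGen_mul_comm e (elemGen e i) (elemGen e j))
    exact congrArg (fun φ : k⟦X⟧ ≃ₐ[k] k⟦X⟧ => φ f) this
  -- The defining equation of v i is multiplied by X g_i(X), which keeps it inside k⟦X⟧.
  have hv : ∀ i, ∃ v, PowerSeries.constantCoeff v = 0 ∧
      (v + PowerSeries.C (u i)) * (PowerSeries.X * g i PowerSeries.X) =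
        g i PowerSeries.X + PowerSeries.X := by
    intro i
    obtain ⟨r, hr⟩ := hw i
    obtain ⟨w, hw⟩ := (isUnit_one_add_X_mul
      (PowerSeries.C (u i) + PowerSeries.X * r)).exists_right_inv
    have hw1 : PowerSeries.constantCoeff w = 1 := by
      simpa using congrArg PowerSeries.constantCoeff hw
    refine ⟨(PowerSeries.C (u i) + PowerSeries.X * r) * w - PowerSeries.C (u i),
      by simp [hw1], ?_⟩
    rw [hr]
    linear_combination (PowerSeries.C (u i) + PowerSeries.X * r) * PowerSeries.X ^ 2 * hw -
      PowerSeries.X * h2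
  choose v hv0 hv using hv
  have hX : (PowerSeries.X : k⟦X⟧) ≠ 0 := PowerSeries.X_ne_zero
  have hgX : ∀ i {f}, f ≠ 0 → g i f ≠ 0 := fun i f hf h => hf (by rw [← hinv i f, h, map_zero])
  have hgv : ∀ i j, (g j (v i) + PowerSeries.C (u i)) *
      (g j PowerSeries.X * g j (g i PowerSeries.X)) =
        g j (g i PowerSeries.X) + g j PowerSeries.X := by
    intro i j
    have := congrArg (g j) (hv i)
    simpa only [map_mul, map_add, PowerSeries.algHom_C] using this
  obtain ⟨b, hb0, hb⟩ := exists_coboundary t g u hw hinv hcomm (hG.sum_ne_zero e) v hv0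
    (fun i => by
      have h3 := hgv i i
      rw [hinv] at h3
      refine (mul_eq_zero.mp (?_ : (PowerSeries.X * g i PowerSeries.X) *
        (v i + g i (v i)) = 0)).resolve_left (mul_ne_zero hX (hgX i hX))
      linear_combination hv i + h3 + (g i PowerSeries.X + PowerSeries.X -
        PowerSeries.C (u i) * PowerSeries.X * g i PowerSeries.X) * h2)
    (fun i j => by
      have h3 := hgv i j
      have h4 := hgv j i
      rw [hcomm i j] at h4
      refine mul_left_cancel₀ (mul_ne_zero (mul_ne_zero hX (hgX i hX))
        (mul_ne_zero (hgX j hX) (hgX j (hgX i hX)))) ?_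
      linear_combination (g j PowerSeries.X * g j (g i PowerSeries.X)) * hv i +
        (PowerSeries.X * g j PowerSeries.X) * h4 -
        (g i PowerSeries.X * g j (g i PowerSeries.X)) * hv j -
        (PowerSeries.X * g i PowerSeries.X) * h3 +
        (PowerSeries.X * g j PowerSeries.X * g j (g i PowerSeries.X) -
          PowerSeries.X * g i PowerSeries.X * g j (g i PowerSeries.X)) * h2)
  -- Here X * w = X / (1 + X b) is the inverse of 1/X + b.
  obtain ⟨w, hw'⟩ := (isUnit_one_add_X_mul b).exists_right_inv
  have hw1 : PowerSeries.constantCoeff w = 1 := by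
    simpa using congrArg PowerSeries.constantCoeff hw'
  refine ⟨⟨e, u, PowerSeries.X * w, hG.isTangentToOne, by simp, ?_, hG.sum_ne_zero e, hw, ?_⟩⟩
  · rw [← zero_add 1, PowerSeries.coeff_succ_X_mul]
    simpa using hw1
  · intro i
    change PowerSeries.X * w + g i (PowerSeries.X * w) +
      PowerSeries.C (u i) * (PowerSeries.X * w) * g i (PowerSeries.X * w) = 0
    have h3 := congrArg (g i) hw'
    simp only [map_mul, map_add, map_one] at h3 ⊢
    have hune : (1 + PowerSeries.X * b) * (1 + g i PowerSeries.X * g i b) ≠ 0 := by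
      apply mul_ne_zero (left_ne_zero_of_mul_eq_one hw') (left_ne_zero_of_mul_eq_one h3)
    refine (mul_eq_zero.mp (?_ : (1 + PowerSeries.X * b) * (1 + g i PowerSeries.X * g i b) *
      _ = 0)).resolve_left hune
    linear_combination (PowerSeries.X * (1 + g i PowerSeries.X * g i b) +
      PowerSeries.C (u i) * PowerSeries.X * g i PowerSeries.X * (1 + g i PowerSeries.X * g i b) *
        g i w) * hw' + (g i PowerSeries.X * (1 + PowerSeries.X * b) +
      PowerSeries.C (u i) * PowerSeries.X * g i PowerSeries.X) * h3 +
      hv i + PowerSeries.X * g i PowerSeries.X * hb i + (PowerSeries.X + g i PowerSeries.X) * h2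

end Frames

/-! ### Lifts by commuting Möbius involutions -/

section NormalForms

variable {k : Type u} [Field k] {G : Subgroup (k⟦X⟧ ≃ₐ[k] k⟦X⟧)} {t : ℕ}

namespace MobiusFrame

/-- The chosen generators. -/
noncomputable def gen (𝓕 : MobiusFrame G t) (i : Fin t) : G := elemGen 𝓕.equiv i

theorem gen_rel (𝓕 : MobiusFrame G t) (i : Fin t) :
    𝓕.y + (𝓕.gen i : k⟦X⟧ ≃ₐ[k] k⟦X⟧) 𝓕.y +
      PowerSeries.C (𝓕.u i) * 𝓕.y * (𝓕.gen i : k⟦X⟧ ≃ₐ[k] k⟦X⟧) 𝓕.y = 0 := 𝓕.rel i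

theorem coeff_zero_apply_y (𝓕 : MobiusFrame G t) (g : G) :
    PowerSeries.coeff 0 ((g : k⟦X⟧ ≃ₐ[k] k⟦X⟧) 𝓕.y) = 0 := by
  rw [𝓕.tangent.coeff_zero, 𝓕.coeff_zero_y]

theorem exists_y_eq (𝓕 : MobiusFrame G t) :
    ∃ r, 𝓕.y = PowerSeries.X * (1 + PowerSeries.X * r) := by
  obtain ⟨r, hr⟩ := PowerSeries.exists_eq_C_add_X_mul 𝓕.y
  obtain ⟨s, hs⟩ := PowerSeries.exists_eq_C_add_X_mul r
  have h0 : PowerSeries.constantCoeff 𝓕.y = 0 := by simpa using 𝓕.coeff_zero_y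
  have h1 : PowerSeries.constantCoeff r = 1 := by
    have := 𝓕.coeff_one_y
    rw [hr, h0, map_zero, zero_add, ← zero_add 1, PowerSeries.coeff_succ_X_mul] at this
    simpa using this
  refine ⟨s, ?_⟩
  rw [hr, h0, hs, h1]
  simp

variable [CharP k 2]

theorem isUnit_coeff_one_gen_y (𝓕 : MobiusFrame G t) (i : Fin t) :
    PowerSeries.coeff 1 ((𝓕.gen i : k⟦X⟧ ≃ₐ[k] k⟦X⟧) 𝓕.y) ≠ 0 := by
  have h := congrArg (PowerSeries.coeff 1) (𝓕.gen_rel i)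
  have h0 := 𝓕.coeff_zero_apply_y (𝓕.gen i)
  obtain ⟨r, hr⟩ := 𝓕.exists_y_eq
  obtain ⟨s, hs⟩ := PowerSeries.exists_eq_C_add_X_mul ((𝓕.gen i : k⟦X⟧ ≃ₐ[k] k⟦X⟧) 𝓕.y)
  rw [PowerSeries.coeff_zero_eq_constantCoeff_apply] at h0
  rw [h0, map_zero, zero_add] at hs
  have h3 : PowerSeries.coeff 1 (PowerSeries.C (𝓕.u i) * 𝓕.y *
      (𝓕.gen i : k⟦X⟧ ≃ₐ[k] k⟦X⟧) 𝓕.y) = 0 := by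
    have : PowerSeries.X ^ 2 ∣ PowerSeries.C (𝓕.u i) * 𝓕.y *
        (𝓕.gen i : k⟦X⟧ ≃ₐ[k] k⟦X⟧) 𝓕.y := by
      rw [hs, hr]
      exact ⟨PowerSeries.C (𝓕.u i) * (1 + PowerSeries.X * r) * s, by ring⟩
    exact PowerSeries.X_pow_dvd_iff.mp this 1 (by norm_num)
  rw [map_add, map_add, h3, 𝓕.coeff_one_y, add_zero, map_zero] at h
  intro h4
  rw [h4, add_zero] at h
  exact one_ne_zero h

theorem u_ne_zero (𝓕 : MobiusFrame G t) (i : Fin t) : 𝓕.u i ≠ 0 := by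
  simpa using 𝓕.sum_ne_zero {i} (by simp)

theorem u_sub_ne_zero (𝓕 : MobiusFrame G t) {i j : Fin t} (hij : i ≠ j) :
    𝓕.u i - 𝓕.u j ≠ 0 := by
  have := 𝓕.sum_ne_zero {i, j} (by simp)
  rwa [Finset.sum_pair hij, ← CharTwo.sub_eq_add] at this

theorem u_sub_sub_ne_zero (𝓕 : MobiusFrame G t) {i j l : Fin t} (hij : i ≠ j) (hil : i ≠ l)
    (hjl : j ≠ l) : 𝓕.u i - 𝓕.u j - 𝓕.u l ≠ 0 := by
  have := 𝓕.sum_ne_zero {i, j, l} (by simp)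
  rw [Finset.sum_insert (by simp [hij, hil]), Finset.sum_pair hjl, ← add_assoc] at this
  rwa [CharTwo.sub_eq_add, CharTwo.sub_eq_add]

end MobiusFrame

variable [CharP k 2] {A B : CoeffRing 2 k} {𝓕 : MobiusFrame G t}

/-- The lift `ρ` acts by Möbius transformations in the parameter `Y`, which lifts `y`. -/
structure Lift.NormalForm (𝓕 : MobiusFrame G t) (ρ : Lift G A) (Y : A⟦X⟧) (b c : Fin t → A) :
    Prop where
  map_residue : PowerSeries.map A.residue Y = 𝓕.y
  rel : ∀ i, Y + ρ.toHom (𝓕.gen i) Y + PowerSeries.C (c i) * Y * ρ.toHom (𝓕.gen i) Y =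
    PowerSeries.C (b i)

theorem MobiusFrame.isParam_of_map_residue {Y : A⟦X⟧}
    (h : PowerSeries.map A.residue Y = 𝓕.y) : A.IsParam Y := by
  rw [CoeffRing.IsParam, h, 𝓕.coeff_zero_y, 𝓕.coeff_one_y]
  exact ⟨rfl, one_ne_zero⟩

theorem PowerSeries.coeff_eq_zero_of_X_pow_dvd {R : Type*} [CommRing R] {a b c : R}
    (h : PowerSeries.X ^ 3 ∣ PowerSeries.C a + PowerSeries.C b * PowerSeries.X +
      PowerSeries.C c * PowerSeries.X ^ 2) : a = 0 ∧ b = 0 ∧ c = 0 := by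
  rw [PowerSeries.X_pow_dvd_iff] at h
  have h0 := h 0 (by norm_num)
  have h1 := h 1 (by norm_num)
  have h2 := h 2 (by norm_num)
  simp only [_root_.map_add, PowerSeries.coeff_C_mul, PowerSeries.coeff_X_pow,
    PowerSeries.coeff_C, PowerSeries.coeff_X] at h0 h1 h2
  norm_num at h0 h1 h2
  exact ⟨h0, h1, h2⟩

/-- As the linear coefficient of Y is a unit, 1, Y and Y² are independent modulo X³. Identities
between Möbius transformations thus become identities of their entries, even up to an error of order
three. -/
theorem CoeffRing.IsParam.coeff_eq_zero {Y h : A⟦X⟧} (hY : A.IsParam Y) {κ₀ κ₁ κ₂ : A}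
    (hκ : PowerSeries.C κ₀ + PowerSeries.C κ₁ * Y + PowerSeries.C κ₂ * Y ^ 2 =
      PowerSeries.X ^ 3 * h) : κ₀ = 0 ∧ κ₁ = 0 ∧ κ₂ = 0 := by
  obtain ⟨s, hs⟩ := PowerSeries.exists_eq_C_add_X_mul Y
  obtain ⟨s', hs'⟩ := PowerSeries.exists_eq_C_add_X_mul s
  obtain ⟨s'', hs''⟩ := PowerSeries.exists_eq_C_add_X_mul s'
  set y0 := PowerSeries.constantCoeff Y
  set y1 := PowerSeries.constantCoeff s
  set y2 := PowerSeries.constantCoeff s'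
  have hy1 : IsUnit y1 := by
    rw [A.isUnit_iff]
    have := hY.2
    rw [PowerSeries.coeff_map, hs, map_add, PowerSeries.coeff_C, if_neg one_ne_zero, zero_add,
      ← zero_add 1, PowerSeries.coeff_succ_X_mul] at this
    simpa using this
  have key : PowerSeries.C (κ₀ + κ₁ * y0 + κ₂ * y0 ^ 2) +
      PowerSeries.C (κ₁ * y1 + 2 * κ₂ * y0 * y1) * PowerSeries.X +
      PowerSeries.C (κ₁ * y2 + κ₂ * (y1 ^ 2 + 2 * y0 * y2)) * PowerSeries.X ^ 2 =
      PowerSeries.X ^ 3 * (h - PowerSeries.C κ₁ * s'' - PowerSeries.C κ₂ *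
        (2 * PowerSeries.C y0 * s'' + 2 * PowerSeries.C y1 * (PowerSeries.C y2 + PowerSeries.X * s'')
          + PowerSeries.X * (PowerSeries.C y2 + PowerSeries.X * s'') ^ 2)) := by
    rw [hs, hs', hs''] at hκ
    simp only [map_add, map_mul, map_pow, map_ofNat]
    linear_combination hκ
  obtain ⟨h0, h1, h2⟩ := PowerSeries.coeff_eq_zero_of_X_pow_dvd (Dvd.intro _ key.symm)
  have hκ2 : κ₂ = 0 := by
    have : κ₂ * (y1 ^ 3) = 0 := by linear_combination y1 * h2 - y2 * h1
    exact (hy1.pow 3).mul_left_eq_zero.mp this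
  have hκ1 : κ₁ = 0 := by
    rw [hκ2] at h1
    have : κ₁ * y1 = 0 := by linear_combination h1
    exact hy1.mul_left_eq_zero.mp this
  refine ⟨?_, hκ1, hκ2⟩
  rw [hκ1, hκ2] at h0
  linear_combination h0

/-- Commuting Möbius involutions are orthogonal for the trace form. -/
theorem CoeffRing.IsParam.trace_eq_zero {Y Y₁ Y₂ Z : A⟦X⟧} (hY : A.IsParam Y)
    {b₁ b₂ c₁ c₂ : A} (h₁ : Y + Y₁ + PowerSeries.C c₁ * Y * Y₁ = PowerSeries.C b₁)
    (h₂ : Y + Y₂ + PowerSeries.C c₂ * Y * Y₂ = PowerSeries.C b₂)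
    (h₁₂ : Y₂ + Z + PowerSeries.C c₁ * Y₂ * Z = PowerSeries.C b₁)
    (h₂₁ : Y₁ + Z + PowerSeries.C c₂ * Y₁ * Z = PowerSeries.C b₂)
    (hc : A.residue (c₁ - c₂) ≠ 0) : 2 + b₁ * c₂ + b₂ * c₁ = 0 := by
  -- The two orders of composition write Z as two fractions in Y. Cross-multiplying gives a
  -- quadratic identity in Y whose leading coefficient is the unit c₁ - c₂ times the trace.
  have e1 : Z * (PowerSeries.C (1 + b₂ * c₁) + PowerSeries.C (c₂ - c₁) * Y) =
      PowerSeries.C (b₁ - b₂) + PowerSeries.C (1 + b₁ * c₂) * Y := by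
    simp only [map_add, map_sub, map_mul, map_one]
    linear_combination (1 + PowerSeries.C c₂ * Y) * h₁₂ - (1 + PowerSeries.C c₁ * Z) * h₂
  have e2 : Z * (PowerSeries.C (1 + b₁ * c₂) + PowerSeries.C (c₁ - c₂) * Y) =
      PowerSeries.C (b₂ - b₁) + PowerSeries.C (1 + b₂ * c₁) * Y := by
    simp only [map_add, map_sub, map_mul, map_one]
    linear_combination (1 + PowerSeries.C c₁ * Y) * h₂₁ - (1 + PowerSeries.C c₂ * Z) * h₁
  have := (hY.coeff_eq_zero (h := 0) (κ₀ := (b₁ - b₂) * (2 + b₁ * c₂ + b₂ * c₁))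
    (κ₁ := (1 + b₁ * c₂) ^ 2 - (1 + b₂ * c₁) ^ 2)
    (κ₂ := (c₁ - c₂) * (2 + b₁ * c₂ + b₂ * c₁)) (by
      simp only [map_add, map_sub, map_mul, map_one, map_pow, map_ofNat] at e1 e2 ⊢
      linear_combination (1 + PowerSeries.C b₂ * PowerSeries.C c₁ +
        (PowerSeries.C c₂ - PowerSeries.C c₁) * Y) * e2 -
        (1 + PowerSeries.C b₁ * PowerSeries.C c₂ +
        (PowerSeries.C c₁ - PowerSeries.C c₂) * Y) * e1)).2.2
  exact (((A.isUnit_iff _).mpr hc).mul_right_eq_zero).mp this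

namespace Lift.NormalForm

variable {ρ : Lift G A} {Y : A⟦X⟧} {b c : Fin t → A}

theorem isParam (h : ρ.NormalForm 𝓕 Y b c) : A.IsParam Y :=
  MobiusFrame.isParam_of_map_residue h.map_residue

theorem residue_eq (h : ρ.NormalForm 𝓕 Y b c) (i : Fin t) :
    A.residue (b i) = 0 ∧ A.residue (c i) = 𝓕.u i := by
  have h1 := congrArg (PowerSeries.map A.residue) (h.rel i)
  simp only [map_add, map_mul, PowerSeries.map_C, ρ.reduces, h.map_residue] at h1
  have h2 := 𝓕.gen_rel i
  have h3 : PowerSeries.C (A.residue (c i) - 𝓕.u i) *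
      (𝓕.y * (𝓕.gen i : k⟦X⟧ ≃ₐ[k] k⟦X⟧) 𝓕.y) = PowerSeries.C (A.residue (b i)) := by
    rw [map_sub]
    linear_combination h1 - h2
  have hb : A.residue (b i) = 0 := by
    have := congrArg (PowerSeries.coeff 0) h3
    have hy := 𝓕.coeff_zero_y
    rw [PowerSeries.coeff_zero_eq_constantCoeff_apply] at this hy
    rw [map_mul, map_mul, hy] at this
    simpa using this.symm
  refine ⟨hb, ?_⟩
  have hy : 𝓕.y ≠ 0 := fun h0 => by
    have := 𝓕.coeff_one_y
    rw [h0] at this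
    simp at this
  rw [hb, map_zero] at h3
  rcases mul_eq_zero.mp h3 with h4 | h4
  · have := congrArg PowerSeries.constantCoeff h4
    simpa [sub_eq_zero] using this
  · exact absurd h4 (mul_ne_zero hy fun h0 =>
      hy ((𝓕.gen i : k⟦X⟧ ≃ₐ[k] k⟦X⟧).injective (by rw [h0, map_zero])))

theorem apply_rel (h : ρ.NormalForm 𝓕 Y b c) (g : G) (i : Fin t) :
    ρ.toHom g Y + ρ.toHom (g * 𝓕.gen i) Y + PowerSeries.C (c i) * ρ.toHom g Y *
      ρ.toHom (g * 𝓕.gen i) Y = PowerSeries.C (b i) := by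
  have := congrArg (ρ.toHom g) (h.rel i)
  simpa only [map_add, map_mul, toHom_C, AlgEquiv.mul_apply] using this

theorem trace_eq_zero (h : ρ.NormalForm 𝓕 Y b c) {i j : Fin t} (hij : i ≠ j) :
    2 + b i * c j + b j * c i = 0 := by
  refine h.isParam.trace_eq_zero (h.rel i) (h.rel j) (h.apply_rel (𝓕.gen j) i) ?_ ?_
  · rw [elemGen_mul_comm 𝓕.equiv]
    exact h.apply_rel (𝓕.gen i) j
  · rw [map_sub, (h.residue_eq i).2, (h.residue_eq j).2]
    exact 𝓕.u_sub_ne_zero hij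

/-- Three independent commuting Möbius involutions only exist in characteristic two. -/
theorem two_eq_zero (h : ρ.NormalForm 𝓕 Y b c) {i j l : Fin t} (hij : i ≠ j) (hil : i ≠ l)
    (hjl : j ≠ l) : (2 : A) = 0 := by
  have hq : IsUnit (1 + b i * c j) := by
    rw [A.isUnit_iff]
    simp [(h.residue_eq i).1]
  obtain ⟨q', hq'⟩ := hq.exists_right_inv
  have hres : A.residue q' = 1 := by
    have := congrArg A.residue hq'
    simpa [(h.residue_eq i).1] using this
  have hij' := h.trace_eq_zero hij
  have hil' := h.trace_eq_zero hil
  have hjl' := h.trace_eq_zero hjl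
  have hCq := congrArg (PowerSeries.C (R := A)) hq'
  have hCij := congrArg (PowerSeries.C (R := A)) hij'
  -- By the trace relation the product of the i-th and j-th involutions has trace zero; rescaling
  -- its matrix by q' = 1 / (1 + b i * c j) puts it in the same normal form.
  have hij₀ : ∀ g : G, ρ.toHom g Y + ρ.toHom (g * 𝓕.gen j * 𝓕.gen i) Y +
      PowerSeries.C ((c i - c j) * q') * ρ.toHom g Y * ρ.toHom (g * 𝓕.gen j * 𝓕.gen i) Y =
      PowerSeries.C ((b j - b i) * q') := by
    intro g
    have h1 := h.apply_rel g j
    have h2 := h.apply_rel (g * 𝓕.gen j) i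
    generalize ρ.toHom g Y = U at *
    generalize ρ.toHom (g * 𝓕.gen j) Y = V at *
    generalize ρ.toHom (g * 𝓕.gen j * 𝓕.gen i) Y = W at *
    simp only [map_add, map_sub, map_mul, map_one, map_ofNat, map_zero] at h1 h2 hCq hCij ⊢
    linear_combination (-(PowerSeries.C q') * (1 + PowerSeries.C (c j) * U)) * h2 +
      (PowerSeries.C q') * (1 + PowerSeries.C (c i) * W) * h1 -
      (U + W) * hCq + PowerSeries.C q' * W * hCij
  -- Orthogonality of the product to the l-th involution, combined with the pairwise relations,
  -- becomes 2 times the unit `hu`.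
  have h3 := h.isParam.trace_eq_zero (by simpa using hij₀ 1) (h.rel l) (hij₀ (𝓕.gen l)) (by
      rw [mul_assoc, elemGen_mul_comm 𝓕.equiv (𝓕.gen l)]
      have := h.apply_rel (𝓕.gen j * 𝓕.gen i) l
      simpa using this) (by
      rw [map_sub, map_mul, map_sub, (h.residue_eq i).2, (h.residue_eq j).2, (h.residue_eq l).2,
        hres, mul_one]
      exact 𝓕.u_sub_sub_ne_zero hij hil hjl)
  have hu : IsUnit (1 + b i * c j + b j * c l - b i * c l) := by
    rw [A.isUnit_iff]
    simp [(h.residue_eq i).1, (h.residue_eq j).1]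
  refine hu.mul_left_eq_zero.mp ?_
  linear_combination (1 + b i * c j) * h3 - 2 * hq' * 0 + hjl' - hil' -
    ((b j - b i) * c l + b l * (c i - c j)) * hq'

end Lift.NormalForm

/-- A tuple of Möbius involutions defines a lift of the action. -/
theorem MobiusFrame.exists_lift (𝓕 : MobiusFrame G t) {Y : A⟦X⟧}
    (hY : PowerSeries.map A.residue Y = 𝓕.y) {b c : Fin t → A}
    (hb : ∀ i, A.residue (b i) = 0) (hc : ∀ i, A.residue (c i) = 𝓕.u i)
    (hbc : ∀ i j, i ≠ j → 2 + b i * c j + b j * c i = 0) :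
    ∃ ρ : Lift G A, ρ.NormalForm 𝓕 Y b c := by
  have h2 := PowerSeries.two_eq_zero (k := k)
  have hYp : A.IsParam Y := isParam_of_map_residue hY
  obtain ⟨e, he⟩ := hYp.exists_algEquiv
  have hunit : ∀ i (Z : A⟦X⟧), PowerSeries.coeff 0 (PowerSeries.map A.residue Z) = 0 →
      IsUnit (1 + PowerSeries.C (c i) * Z) := by
    intro i Z hZ
    rw [A.isUnit_powerSeries_iff]
    rw [PowerSeries.coeff_zero_eq_constantCoeff_apply] at hZ ⊢
    simp only [map_add, map_one, map_mul, hZ]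
    simp
  have hY0 : PowerSeries.coeff 0 (PowerSeries.map A.residue Y) = 0 := hYp.1
  have hZ : ∀ i, ∃ Z, Y + Z + PowerSeries.C (c i) * Y * Z = PowerSeries.C (b i) ∧
      PowerSeries.map A.residue Z = (𝓕.gen i : k⟦X⟧ ≃ₐ[k] k⟦X⟧) 𝓕.y := by
    intro i
    obtain ⟨v, hv⟩ := (hunit i Y hY0).exists_right_inv
    refine ⟨(PowerSeries.C (b i) - Y) * v, by linear_combination (PowerSeries.C (b i) - Y) * hv, ?_⟩
    have hv' := congrArg (PowerSeries.map A.residue) hv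
    simp only [map_add, map_mul, map_sub, PowerSeries.map_C, hY, hb, hc, map_one, map_zero] at hv' ⊢
    linear_combination (-PowerSeries.map A.residue v) * 𝓕.gen_rel i +
      (𝓕.gen i : k⟦X⟧ ≃ₐ[k] k⟦X⟧) 𝓕.y * hv'
  choose Z hZ hZres using hZ
  have hZp : ∀ i, A.IsParam (Z i) := by
    intro i
    rw [CoeffRing.IsParam, hZres]
    exact ⟨𝓕.coeff_zero_apply_y _, 𝓕.isUnit_coeff_one_gen_y i⟩
  choose E hE using fun i => (hZp i).exists_algEquiv
  have heY : e⁻¹ Y = PowerSeries.X := by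
    rw [← he, ← AlgEquiv.mul_apply, inv_mul_cancel, AlgEquiv.one_apply]
  -- The substitutions X ↦ Z i are precomposed with the inverse of X ↦ Y, so that they act by Möbius
  -- transformations on Y rather than on X.
  obtain ⟨m, hm⟩ : ∃ m : Fin t → A⟦X⟧ ≃ₐ[A] A⟦X⟧, ∀ i, m i Y = Z i :=
    ⟨fun i => E i * e⁻¹, fun i => by rw [AlgEquiv.mul_apply, heY, hE]⟩
  have hmC : ∀ i a, m i (PowerSeries.C a) = PowerSeries.C a := fun i a => (m i).commutes a
  have hmrel : ∀ i j, m j Y + m j (Z i) + PowerSeries.C (c i) * m j Y * m j (Z i) =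
      PowerSeries.C (b i) := by
    intro i j
    have := congrArg (m j) (hZ i)
    simpa only [map_add, map_mul, hmC] using this
  have hred : ∀ i F, PowerSeries.map A.residue (m i F) =
      (𝓕.gen i : k⟦X⟧ ≃ₐ[k] k⟦X⟧) (PowerSeries.map A.residue F) := by
    intro i F
    refine hYp.map_residue_eq _ _ ?_ ?_ F
    · rw [hm, hZres, hY]
    · rw [hY]; exact 𝓕.coeff_zero_apply_y _
  obtain ⟨H, hH⟩ := elemGen_exists_hom 𝓕.equiv m (by
      intro i
      apply hYp.algEquiv_ext
      · rw [AlgEquiv.mul_apply, hm, AlgEquiv.one_apply]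
        have h3 := hmrel i i
        rw [hm] at h3
        refine (hunit i _ (hZp i).1).mul_left_cancel ?_
        linear_combination h3 - hZ i
      · rw [AlgEquiv.mul_apply, hred, 𝓕.tangent.coeff_zero, hm]
        exact (hZp i).1)
    (by
      intro i j
      rcases eq_or_ne i j with rfl | hij
      · rfl
      apply hYp.algEquiv_ext
      · rw [AlgEquiv.mul_apply, AlgEquiv.mul_apply, hm, hm]
        have h3 := hmrel i j
        have h4 := hmrel j i
        rw [hm] at h3 h4
        have h5 := congrArg (PowerSeries.C (R := A)) (hbc i j hij)
        simp only [map_add, map_mul, map_ofNat, map_zero] at h5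
        -- The trace relation makes the two composites fractions with proportional numerators and
        -- denominators; `hu` is the common denominator to be cancelled.
        have hu : IsUnit (1 + PowerSeries.C (b i) * PowerSeries.C (c j) +
            (PowerSeries.C (c i) - PowerSeries.C (c j)) * Y) := by
          rw [A.isUnit_powerSeries_iff]
          rw [PowerSeries.coeff_zero_eq_constantCoeff_apply] at hY0 ⊢
          simp only [map_add, map_one, map_mul, hY0, PowerSeries.map_C, hb]
          simp
        refine hu.mul_left_cancel ?_
        linear_combination (1 + PowerSeries.C (c i) * Y) * h4 -
          (1 + PowerSeries.C (c j) * m i (Z j)) * hZ i +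
          (1 + PowerSeries.C (c j) * Y) * h3 -
          (1 + PowerSeries.C (c i) * m j (Z i)) * hZ j + (Y - m j (Z i)) * h5
      · rw [AlgEquiv.mul_apply, hred, 𝓕.tangent.coeff_zero, hm]
        exact (hZp _).1)
  refine ⟨⟨H, fun g => ?_⟩, ⟨hY, fun i => ?_⟩⟩
  · refine elemGen_induction 𝓕.equiv (P := fun g => ∀ F, PowerSeries.map A.residue (H g F) =
      (g : k⟦X⟧ ≃ₐ[k] k⟦X⟧) (PowerSeries.map A.residue F)) ?_ ?_ ?_ g
    · intro F
      simp
    · intro g h hg hh F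
      rw [map_mul, AlgEquiv.mul_apply, hg, hh, Subgroup.coe_mul, AlgEquiv.mul_apply]
    · intro i F
      rw [hH]
      exact hred i F
  · change Y + H (elemGen 𝓕.equiv i) Y + _ * H (elemGen 𝓕.equiv i) Y = _
    rw [hH, hm]
    exact hZ i

/-- Lifts with the same Möbius data are equivalent. -/
theorem Lift.NormalForm.equivalent {ρ ρ' : Lift G A} {Y Y' : A⟦X⟧} {b c : Fin t → A}
    (h : ρ.NormalForm 𝓕 Y b c) (h' : ρ'.NormalForm 𝓕 Y' b c) : ρ.Equivalent ρ' := by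
  obtain ⟨e, he⟩ := h.isParam.exists_algEquiv
  obtain ⟨e', he'⟩ := h'.isParam.exists_algEquiv
  have heY : e⁻¹ Y = PowerSeries.X := by
    rw [← he, ← AlgEquiv.mul_apply, inv_mul_cancel, AlgEquiv.one_apply]
  obtain ⟨γ, hγ⟩ : ∃ γ : A⟦X⟧ ≃ₐ[A] A⟦X⟧, γ Y = Y' :=
    ⟨e' * e⁻¹, by rw [AlgEquiv.mul_apply, heY, he']⟩
  have hγC : ∀ a, γ (PowerSeries.C a) = PowerSeries.C a := γ.commutes
  have hγres : ∀ F, PowerSeries.map A.residue (γ F) = PowerSeries.map A.residue F := by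
    intro F
    refine h.isParam.map_residue_eq γ 1 ?_ ?_ F
    · rw [hγ, h.map_residue, h'.map_residue]; rfl
    · exact h.isParam.1
  refine ⟨γ, hγres, ?_⟩
  have : ρ'.toHom = (MulAut.conj γ).toMonoidHom.comp ρ.toHom := by
    apply elemGen_hom_ext 𝓕.equiv
    intro i
    change ρ'.toHom (𝓕.gen i) = γ * ρ.toHom (𝓕.gen i) * γ⁻¹
    rw [eq_mul_inv_iff_mul_eq]
    apply h.isParam.algEquiv_ext
    · rw [AlgEquiv.mul_apply, AlgEquiv.mul_apply, hγ]
      have h1 := congrArg γ (h.rel i)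
      simp only [map_add, map_mul, hγC, hγ] at h1
      have h2 := h'.rel i
      have hu : IsUnit (1 + PowerSeries.C (c i) * Y') := by
        rw [A.isUnit_powerSeries_iff]
        have := h'.isParam.1
        rw [PowerSeries.coeff_zero_eq_constantCoeff_apply] at this ⊢
        simp only [map_add, map_one, map_mul, this]
        simp
      refine hu.mul_left_cancel ?_
      linear_combination h2 - h1
    · rw [AlgEquiv.mul_apply, hγ, ρ'.reduces, 𝓕.tangent.coeff_zero]
      exact h'.isParam.1
  intro g
  rw [this]
  rfl

theorem Lift.Equivalent.normalForm {ρ ρ' : Lift G A} {Y : A⟦X⟧} {b c : Fin t → A}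
    (hρ : ρ.Equivalent ρ') (h : ρ.NormalForm 𝓕 Y b c) : ∃ Y', ρ'.NormalForm 𝓕 Y' b c := by
  obtain ⟨γ, hγ, h'⟩ := hρ
  have hγC : ∀ a, γ (PowerSeries.C a) = PowerSeries.C a := γ.commutes
  refine ⟨γ Y, by rw [hγ, h.map_residue], fun i => ?_⟩
  rw [h', AlgEquiv.mul_apply, AlgEquiv.mul_apply, ← AlgEquiv.mul_apply γ⁻¹, inv_mul_cancel,
    AlgEquiv.one_apply]
  have h1 := congrArg γ (h.rel i)
  simpa only [map_add, map_mul, hγC] using h1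

theorem Lift.NormalForm.baseChange {f : A →ₐ[WittVector 2 k] B} {ρ : Lift G A} {ρ' : Lift G B}
    {Y : A⟦X⟧} {b c : Fin t → A} (h : ρ.NormalForm 𝓕 Y b c) (hf : ρ.IsBaseChange f ρ') :
    ρ'.NormalForm 𝓕 (PowerSeries.map (f : A →+* B) Y) (fun i => f (b i)) (fun i => f (c i)) := by
  refine ⟨by rw [CoeffRing.IsParam.map, h.map_residue], fun i => ?_⟩
  have h1 := congrArg (PowerSeries.map (f : A →+* B)) (h.rel i)
  rw [← hf]
  simpa only [map_add, map_mul, PowerSeries.map_C, RingHom.coe_coe] using h1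

/-- Change of the Möbius parameter by an affine transformation. -/
theorem Lift.NormalForm.affine {ρ : Lift G A} {Y : A⟦X⟧} {b c : Fin t → A}
    (h : ρ.NormalForm 𝓕 Y b c) {s l l' : A} (hs : A.residue s = 0) (hl : A.residue l = 1)
    (hl' : l * l' = 1) {v : Fin t → A} (hv : ∀ i, v i * (1 + c i * s) = 1) :
    ρ.NormalForm 𝓕 (PowerSeries.C l * (Y - PowerSeries.C s))
      (fun i => l * (b i - 2 * s - c i * s ^ 2) * v i) (fun i => c i * l' * v i) := by
  refine ⟨by simp [h.map_residue, hs, hl], fun i => ?_⟩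
  have h1 := h.rel i
  have h2 := congrArg (PowerSeries.C (R := A)) hl'
  have h3 := congrArg (PowerSeries.C (R := A)) (hv i)
  simp only [map_add, map_mul, map_sub, map_one, map_pow, map_ofNat, Lift.toHom_C] at h1 h2 h3 ⊢
  linear_combination PowerSeries.C l * PowerSeries.C (v i) * h1 +
    PowerSeries.C l * PowerSeries.C (c i) * PowerSeries.C (v i) * (Y - PowerSeries.C s) *
      (ρ.toHom (𝓕.gen i) Y - PowerSeries.C s) * h2 -
    PowerSeries.C l * (Y + ρ.toHom (𝓕.gen i) Y - 2 * PowerSeries.C s) * h3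

end NormalForms

/-! ### Small extensions and the cocycle of first-order defects -/

section RelativeNormalForms

theorem AlgHom.exists_comp_eq_of_surjective {R A B C : Type*} [CommRing R] [CommRing A]
    [CommRing B] [CommRing C] [Algebra R A] [Algebra R B] [Algebra R C] {π : A →ₐ[R] B}
    (hπ : Function.Surjective π) (ψ : A →ₐ[R] C) (h : ∀ a, π a = 0 → ψ a = 0) :
    ∃ ψ' : B →ₐ[R] C, ψ'.comp π = ψ := by
  let q := Ideal.quotientKerAlgEquivOfSurjective hπ
  refine ⟨(Ideal.Quotient.liftₐ (RingHom.ker π) ψ h).comp q.symm.toAlgHom, ?_⟩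
  ext a
  have : q.symm (π a) = Ideal.Quotient.mk _ a := by
    rw [AlgEquiv.symm_apply_eq]
    rfl
  change Ideal.Quotient.liftₐ (RingHom.ker π) ψ h (q.symm (π a)) = ψ a
  rw [this]
  rfl

namespace CoeffRing

variable {p : ℕ} [Fact p.Prime] {k : Type u} [Field k] {A B : CoeffRing p k}

/-- A nonzero element of I is multiplied by elements of the maximal ideal as long as the product
stays nonzero; nilpotency ends the process in the socle. -/
theorem exists_socle (hA : IsArtinianRing A) {I : Ideal A} (hI : I ≠ ⊥) :
    ∃ ϖ ∈ I, ϖ ≠ 0 ∧ ∀ a, A.residue a = 0 → ϖ * a = 0 := by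
  obtain ⟨n, hn⟩ := (isArtinianRing_iff_isNilpotent_maximalIdeal A).mp hA
  have key : ∀ m, (∀ ϖ ∈ I, (∀ x ∈ IsLocalRing.maximalIdeal A ^ m, ϖ * x = 0) →
      ϖ ≠ 0 → ∃ ϖ ∈ I, ϖ ≠ 0 ∧ ∀ a, A.residue a = 0 → ϖ * a = 0) := by
    intro m
    induction m with
    | zero =>
      intro ϖ _ h h0
      exact absurd (by simpa using h 1 (by simp)) h0
    | succ m ih =>
      intro ϖ hϖ h h0
      by_cases hx : ∀ a, A.residue a = 0 → ϖ * a = 0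
      · exact ⟨ϖ, hϖ, h0, hx⟩
      push Not at hx
      obtain ⟨a, ha, hne⟩ := hx
      refine ih (ϖ * a) (I.mul_mem_right a hϖ) (fun x hx => ?_) hne
      rw [mul_assoc]
      refine h _ ?_
      rw [pow_succ']
      exact Ideal.mul_mem_mul ((A.mem_maximalIdeal_iff a).mpr ha) hx
  obtain ⟨ϖ, hϖ, hϖ0⟩ := (Submodule.ne_bot_iff _).mp hI
  refine key n ϖ hϖ (fun x hx => ?_) hϖ0
  rw [hn] at hx
  rw [(Submodule.mem_bot A).mp hx, mul_zero]

/-- The residue field as a coefficient ring. -/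
noncomputable def residueField (p : ℕ) [Fact p.Prime] (k : Type u) [Field k] : CoeffRing p k :=
  letI : Algebra (WittVector p k) k := (WittVector.constantCoeff (p := p)).toAlgebra
  { carrier := k
    residue := RingHom.id k
    residue_algebraMap := fun _ => rfl }

instance isArtinianRing_residueField : IsArtinianRing (residueField p k) :=
  inferInstanceAs (IsArtinianRing k)

/-- The residue map as a morphism. -/
noncomputable def residueHom (A : CoeffRing p k) : A →ₐ[WittVector p k] residueField p k :=
  letI : Algebra (WittVector p k) k := (WittVector.constantCoeff (p := p)).toAlgebra
  { A.residue with commutes' := A.residue_algebraMap }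

theorem residueHom_surjective (A : CoeffRing p k) : Function.Surjective A.residueHom :=
  A.residue_surjective

/-- Multiplication by a socle element ϖ identifies k⟦X⟧ with ϖ A⟦X⟧, so first-order defects become
power series over k. -/
theorem C_mul_eq_zero_iff {ϖ : A} (hϖ : ϖ ≠ 0) (hm : ∀ a, A.residue a = 0 → ϖ * a = 0) (F : A⟦X⟧) :
    PowerSeries.C ϖ * F = 0 ↔ PowerSeries.map A.residue F = 0 := by
  rw [PowerSeries.ext_iff, PowerSeries.ext_iff]
  refine forall_congr' fun n => ?_
  rw [PowerSeries.coeff_C_mul, PowerSeries.coeff_map, map_zero, map_zero]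
  refine ⟨fun h => ?_, hm _⟩
  by_contra h0
  exact hϖ ((((A.isUnit_iff _).mpr h0).mul_left_eq_zero).mp h)

theorem exists_eq_C_mul {π : A →ₐ[WittVector p k] B} {ϖ : A}
    (hker : ∀ a, π a = 0 → ∃ x, a = ϖ * x) {F : A⟦X⟧}
    (hF : PowerSeries.map (π : A →+* B) F = 0) : ∃ E, F = PowerSeries.C ϖ * E := by
  have : ∀ n, ∃ x, PowerSeries.coeff n F = ϖ * x := by
    intro n
    apply hker
    have := congrArg (PowerSeries.coeff n) hF
    simpa using this
  choose x hx using this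
  refine ⟨PowerSeries.mk x, ?_⟩
  ext n
  rw [hx, PowerSeries.coeff_C_mul, PowerSeries.coeff_mk]

end CoeffRing

variable {k : Type u} [Field k] {G : Subgroup (k⟦X⟧ ≃ₐ[k] k⟦X⟧)} {t : ℕ}

/-- A power series invariant under a generator is, up to third order, a linear polynomial in the
norm of the parameter. -/
theorem MobiusFrame.exists_eq_of_invariant (𝓕 : MobiusFrame G t) [CharP k 2] (i : Fin t) {f : k⟦X⟧}
    (hf : (𝓕.gen i : k⟦X⟧ ≃ₐ[k] k⟦X⟧) f = f) :
    ∃ (a c : k) (v : k⟦X⟧), PowerSeries.constantCoeff v = 0 ∧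
      f = PowerSeries.C a + PowerSeries.C c * (𝓕.y * (𝓕.gen i : k⟦X⟧ ≃ₐ[k] k⟦X⟧) 𝓕.y) +
        𝓕.y * (𝓕.gen i : k⟦X⟧ ≃ₐ[k] k⟦X⟧) 𝓕.y * v := by
  obtain ⟨r, hr⟩ := 𝓕.exists_y_eq
  obtain ⟨s, hs⟩ := PowerSeries.exists_eq_C_add_X_mul ((𝓕.gen i : k⟦X⟧ ≃ₐ[k] k⟦X⟧) 𝓕.y)
  have h0 := 𝓕.coeff_zero_apply_y (𝓕.gen i)
  rw [PowerSeries.coeff_zero_eq_constantCoeff_apply] at h0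
  rw [h0, map_zero, zero_add] at hs
  have hsu : IsUnit s := by
    have := 𝓕.isUnit_coeff_one_gen_y i
    rw [hs, ← zero_add 1, PowerSeries.coeff_succ_X_mul] at this
    rw [PowerSeries.isUnit_iff_constantCoeff, isUnit_iff_ne_zero]
    simpa using this
  obtain ⟨n', hn'⟩ := ((isUnit_one_add_X_mul r).mul hsu).exists_right_inv
  obtain ⟨w₁, hw₁⟩ := PowerSeries.exists_eq_C_add_X_mul f
  obtain ⟨w, hw⟩ := PowerSeries.exists_eq_C_add_X_mul w₁
  set a := PowerSeries.constantCoeff f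
  set a₁ := PowerSeries.constantCoeff w₁
  obtain ⟨ρ, hρ⟩ := 𝓕.isWild i
  change (𝓕.gen i : k⟦X⟧ ≃ₐ[k] k⟦X⟧) PowerSeries.X = _ at hρ
  -- The coefficient of X² in g f - f is a₁ times u i, so invariance excludes a linear term.
  have ha₁ : a₁ = 0 := by
    have hgw := 𝓕.tangent.coeff_zero (𝓕.gen i) w
    obtain ⟨w', hw'⟩ : PowerSeries.X ∣ (𝓕.gen i : k⟦X⟧ ≃ₐ[k] k⟦X⟧) w - w := by
      rw [PowerSeries.X_dvd_iff, map_sub, sub_eq_zero]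
      simpa using hgw
    have hgC : ∀ x, (𝓕.gen i : k⟦X⟧ ≃ₐ[k] k⟦X⟧) (PowerSeries.C x) = PowerSeries.C x :=
      (𝓕.gen i : k⟦X⟧ ≃ₐ[k] k⟦X⟧).commutes
    rw [hw₁, hw] at hf
    simp only [map_add, map_mul, hgC, hρ] at hf
    have key : PowerSeries.X ^ 3 ∣ PowerSeries.C (0 : k) + PowerSeries.C 0 * PowerSeries.X +
        PowerSeries.C (a₁ * 𝓕.u i) * PowerSeries.X ^ 2 := by
      refine ⟨-(PowerSeries.C a₁ * ρ + (2 * (PowerSeries.C (𝓕.u i) + PowerSeries.X * ρ) +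
        PowerSeries.X * (PowerSeries.C (𝓕.u i) + PowerSeries.X * ρ) ^ 2) *
        (𝓕.gen i : k⟦X⟧ ≃ₐ[k] k⟦X⟧) w + w'), ?_⟩
      simp only [map_zero, map_mul]
      linear_combination hf - PowerSeries.X ^ 2 * hw'
    have := (PowerSeries.coeff_eq_zero_of_X_pow_dvd key).2.2
    exact (mul_eq_zero.mp this).resolve_right (𝓕.u_ne_zero i)
  rw [ha₁, map_zero, zero_add] at hw
  obtain ⟨v, hv⟩ := PowerSeries.exists_eq_C_add_X_mul (n' * w)
  refine ⟨a, PowerSeries.constantCoeff (n' * w), PowerSeries.X * v, by simp, ?_⟩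
  set q := PowerSeries.constantCoeff (n' * w)
  rw [hs, hr]
  linear_combination hw₁ + PowerSeries.X * hw - PowerSeries.X ^ 2 * w * hn' +
    PowerSeries.X ^ 2 * (1 + PowerSeries.X * r) * s * hv

variable [CharP k 2] {A B : CoeffRing 2 k} {𝓕 : MobiusFrame G t}

theorem MobiusFrame.y_ne_zero (𝓕 : MobiusFrame G t) : 𝓕.y ≠ 0 := fun h0 => by
  have := 𝓕.coeff_one_y
  rw [h0] at this
  simp at this

theorem MobiusFrame.apply_apply (𝓕 : MobiusFrame G t) (i : Fin t) (f : k⟦X⟧) :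
    (𝓕.gen i : k⟦X⟧ ≃ₐ[k] k⟦X⟧) ((𝓕.gen i : k⟦X⟧ ≃ₐ[k] k⟦X⟧) f) = f := by
  have := congrArg Subtype.val (elemGen_mul_self 𝓕.equiv i)
  exact congrArg (fun φ : k⟦X⟧ ≃ₐ[k] k⟦X⟧ => φ f) this

theorem MobiusFrame.apply_comm (𝓕 : MobiusFrame G t) (i j : Fin t) (f : k⟦X⟧) :
    (𝓕.gen i : k⟦X⟧ ≃ₐ[k] k⟦X⟧) ((𝓕.gen j : k⟦X⟧ ≃ₐ[k] k⟦X⟧) f) =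
      (𝓕.gen j : k⟦X⟧ ≃ₐ[k] k⟦X⟧) ((𝓕.gen i : k⟦X⟧ ≃ₐ[k] k⟦X⟧) f) := by
  have := congrArg Subtype.val (elemGen_mul_comm 𝓕.equiv (𝓕.gen i) (𝓕.gen j))
  exact congrArg (fun φ : k⟦X⟧ ≃ₐ[k] k⟦X⟧ => φ f) this

theorem Lift.toHom_apply_apply (𝓕 : MobiusFrame G t) (ρ : Lift G A) (i : Fin t) (f : A⟦X⟧) :
    ρ.toHom (𝓕.gen i) (ρ.toHom (𝓕.gen i) f) = f := by
  rw [← AlgEquiv.mul_apply, ← map_mul]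
  change ρ.toHom (elemGen 𝓕.equiv i * elemGen 𝓕.equiv i) f = f
  rw [elemGen_mul_self, map_one, AlgEquiv.one_apply]

theorem Lift.toHom_apply_comm (𝓕 : MobiusFrame G t) (ρ : Lift G A) (i j : Fin t) (f : A⟦X⟧) :
    ρ.toHom (𝓕.gen i) (ρ.toHom (𝓕.gen j) f) = ρ.toHom (𝓕.gen j) (ρ.toHom (𝓕.gen i) f) := by
  rw [← AlgEquiv.mul_apply, ← map_mul, elemGen_mul_comm 𝓕.equiv, map_mul, AlgEquiv.mul_apply]

/-- The defects of an approximate normal form satisfy the cocycle condition. -/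
theorem MobiusFrame.cocycle_of_defect (𝓕 : MobiusFrame G t) {ϖ : A} (hϖ : ϖ ≠ 0)
    (hm : ∀ a, A.residue a = 0 → ϖ * a = 0) {ρ : Lift G A} {Y : A⟦X⟧}
    (hY : PowerSeries.map A.residue Y = 𝓕.y) {i j : Fin t} (hij : i ≠ j) {b₁ b₂ c₁ c₂ : A}
    (hc₁ : A.residue c₁ = 𝓕.u i) (hc₂ : A.residue c₂ = 𝓕.u j) {E₁ E₂ : A⟦X⟧} {v₁ v₂ : k⟦X⟧}
    (h₁ : Y + ρ.toHom (𝓕.gen i) Y + PowerSeries.C c₁ * Y * ρ.toHom (𝓕.gen i) Y =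
      PowerSeries.C b₁ + PowerSeries.C ϖ * E₁)
    (h₂ : Y + ρ.toHom (𝓕.gen j) Y + PowerSeries.C c₂ * Y * ρ.toHom (𝓕.gen j) Y =
      PowerSeries.C b₂ + PowerSeries.C ϖ * E₂)
    (hE₁ : PowerSeries.map A.residue E₁ = 𝓕.y * (𝓕.gen i : k⟦X⟧ ≃ₐ[k] k⟦X⟧) 𝓕.y * v₁)
    (hE₂ : PowerSeries.map A.residue E₂ = 𝓕.y * (𝓕.gen j : k⟦X⟧ ≃ₐ[k] k⟦X⟧) 𝓕.y * v₂)
    (hv₁ : PowerSeries.constantCoeff v₁ = 0) (hv₂ : PowerSeries.constantCoeff v₂ = 0) :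
    v₁ + (𝓕.gen i : k⟦X⟧ ≃ₐ[k] k⟦X⟧) v₂ = v₂ + (𝓕.gen j : k⟦X⟧ ≃ₐ[k] k⟦X⟧) v₁ := by
  have h2 := PowerSeries.two_eq_zero (k := k)
  have hYp : A.IsParam Y := isParam_of_map_residue hY
  have hX3 : ∀ (i : Fin t) (v : k⟦X⟧), PowerSeries.constantCoeff v = 0 →
      PowerSeries.X ^ 3 ∣ 𝓕.y * (𝓕.gen i : k⟦X⟧ ≃ₐ[k] k⟦X⟧) 𝓕.y * v := by
    intro i v hv
    have hd : ∀ f : k⟦X⟧, PowerSeries.coeff 0 f = 0 → PowerSeries.X ∣ f := fun f hf =>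
      PowerSeries.X_dvd_iff.mpr (by simpa using hf)
    rw [pow_succ, pow_two]
    exact mul_dvd_mul (mul_dvd_mul (hd _ 𝓕.coeff_zero_y) (hd _ (𝓕.coeff_zero_apply_y _)))
      (hd _ (by simpa using hv))
  have hgX3 : ∀ (i : Fin t) (f : k⟦X⟧), PowerSeries.X ^ 3 ∣ f →
      PowerSeries.X ^ 3 ∣ (𝓕.gen i : k⟦X⟧ ≃ₐ[k] k⟦X⟧) f := fun i f hf =>
    PowerSeries.algHom_X_pow_dvd (φ := ((𝓕.gen i : k⟦X⟧ ≃ₐ[k] k⟦X⟧) : k⟦X⟧ →ₐ[k] k⟦X⟧))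
      (𝓕.isWild i).X_dvd hf
  have h₁₂ := congrArg (ρ.toHom (𝓕.gen j)) h₁
  have h₂₁ := congrArg (ρ.toHom (𝓕.gen i)) h₂
  rw [map_add, map_add, map_mul, map_mul, map_add, map_mul] at h₁₂ h₂₁
  rw [ρ.toHom_apply_comm 𝓕] at h₂₁
  simp only [Lift.toHom_C] at h₁₂ h₂₁
  have hA₁ : PowerSeries.map A.residue ((1 + PowerSeries.C c₂ * Y) * ρ.toHom (𝓕.gen j) E₁ -
      (1 + PowerSeries.C c₁ * ρ.toHom (𝓕.gen j) (ρ.toHom (𝓕.gen i) Y)) * E₂) =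
      (1 + PowerSeries.C (𝓕.u j) * 𝓕.y) * (𝓕.gen j : k⟦X⟧ ≃ₐ[k] k⟦X⟧)
        (𝓕.y * (𝓕.gen i : k⟦X⟧ ≃ₐ[k] k⟦X⟧) 𝓕.y * v₁) -
      (1 + PowerSeries.C (𝓕.u i) * (𝓕.gen j : k⟦X⟧ ≃ₐ[k] k⟦X⟧)
        ((𝓕.gen i : k⟦X⟧ ≃ₐ[k] k⟦X⟧) 𝓕.y)) * (𝓕.y * (𝓕.gen j : k⟦X⟧ ≃ₐ[k] k⟦X⟧) 𝓕.y * v₂) := by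
    rw [← hE₁, ← hE₂, ← hY]
    simp only [map_sub, map_mul, map_add, map_one, PowerSeries.map_C, hc₁, hc₂, ρ.reduces]
  have hA₂ : PowerSeries.map A.residue ((1 + PowerSeries.C c₁ * Y) * ρ.toHom (𝓕.gen i) E₂ -
      (1 + PowerSeries.C c₂ * ρ.toHom (𝓕.gen j) (ρ.toHom (𝓕.gen i) Y)) * E₁) =
      (1 + PowerSeries.C (𝓕.u i) * 𝓕.y) * (𝓕.gen i : k⟦X⟧ ≃ₐ[k] k⟦X⟧)
        (𝓕.y * (𝓕.gen j : k⟦X⟧ ≃ₐ[k] k⟦X⟧) 𝓕.y * v₂) -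
      (1 + PowerSeries.C (𝓕.u j) * (𝓕.gen j : k⟦X⟧ ≃ₐ[k] k⟦X⟧)
        ((𝓕.gen i : k⟦X⟧ ≃ₐ[k] k⟦X⟧) 𝓕.y)) * (𝓕.y * (𝓕.gen i : k⟦X⟧ ≃ₐ[k] k⟦X⟧) 𝓕.y * v₁) := by
    rw [← hE₁, ← hE₂, ← hY]
    simp only [map_sub, map_mul, map_add, map_one, PowerSeries.map_C, hc₁, hc₂, ρ.reduces]
  -- Each defect is y g(y) times a series without constant term, hence of order at least 3 and
  -- invisible to the comparison of the coefficients of 1, Y and Y².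
  have hd₁ := dvd_sub
    (Dvd.dvd.mul_left (hgX3 j _ (hX3 i v₁ hv₁)) (1 + PowerSeries.C (𝓕.u j) * 𝓕.y))
    (Dvd.dvd.mul_left (hX3 j v₂ hv₂) (1 + PowerSeries.C (𝓕.u i) *
      (𝓕.gen j : k⟦X⟧ ≃ₐ[k] k⟦X⟧) ((𝓕.gen i : k⟦X⟧ ≃ₐ[k] k⟦X⟧) 𝓕.y)))
  have hd₂ := dvd_sub
    (Dvd.dvd.mul_left (hgX3 i _ (hX3 j v₂ hv₂)) (1 + PowerSeries.C (𝓕.u i) * 𝓕.y))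
    (Dvd.dvd.mul_left (hX3 i v₁ hv₁) (1 + PowerSeries.C (𝓕.u j) *
      (𝓕.gen j : k⟦X⟧ ≃ₐ[k] k⟦X⟧) ((𝓕.gen i : k⟦X⟧ ≃ₐ[k] k⟦X⟧) 𝓕.y)))
  rw [← hA₁] at hd₁
  rw [← hA₂] at hd₂
  have hdvd : ∀ F : A⟦X⟧, PowerSeries.X ^ 3 ∣ PowerSeries.map A.residue F →
      ∃ h, PowerSeries.C ϖ * F = PowerSeries.X ^ 3 * h := by
    rintro F ⟨w, hw⟩
    obtain ⟨w', rfl⟩ := A.exists_lift_powerSeries w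
    refine ⟨PowerSeries.C ϖ * w', ?_⟩
    rw [← sub_eq_zero, mul_left_comm, ← mul_sub, CoeffRing.C_mul_eq_zero_iff hϖ hm, map_sub, hw,
      map_mul, map_pow, PowerSeries.map_X, sub_self]
  obtain ⟨k₁, hk₁⟩ := hdvd _ hd₁
  obtain ⟨k₂, hk₂⟩ := hdvd _ hd₂
  set A₁ := (1 + PowerSeries.C c₂ * Y) * ρ.toHom (𝓕.gen j) E₁ -
      (1 + PowerSeries.C c₁ * ρ.toHom (𝓕.gen j) (ρ.toHom (𝓕.gen i) Y)) * E₂ with hA₁'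
  set A₂ := (1 + PowerSeries.C c₁ * Y) * ρ.toHom (𝓕.gen i) E₂ -
      (1 + PowerSeries.C c₂ * ρ.toHom (𝓕.gen j) (ρ.toHom (𝓕.gen i) Y)) * E₁ with hA₂'
  generalize hZ : ρ.toHom (𝓕.gen j) (ρ.toHom (𝓕.gen i) Y) = Z at *
  have e1 : Z * (PowerSeries.C (1 + b₂ * c₁) + PowerSeries.C (c₂ - c₁) * Y) =
      PowerSeries.C (b₁ - b₂) + PowerSeries.C (1 + b₁ * c₂) * Y + PowerSeries.C ϖ * A₁ := by
    rw [hA₁']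
    simp only [map_add, map_sub, map_mul, map_one]
    linear_combination (1 + PowerSeries.C c₂ * Y) * h₁₂ - (1 + PowerSeries.C c₁ * Z) * h₂
  have e2 : Z * (PowerSeries.C (1 + b₁ * c₂) + PowerSeries.C (c₁ - c₂) * Y) =
      PowerSeries.C (b₂ - b₁) + PowerSeries.C (1 + b₂ * c₁) * Y + PowerSeries.C ϖ * A₂ := by
    rw [hA₂']
    simp only [map_add, map_sub, map_mul, map_one]
    linear_combination (1 + PowerSeries.C c₁ * Y) * h₂₁ - (1 + PowerSeries.C c₂ * Z) * h₁
  -- The trace relation therefore holds exactly, although the involutions are Möbius only up to the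
  -- defects.
  have htr : 2 + b₁ * c₂ + b₂ * c₁ = 0 := by
    have := (hYp.coeff_eq_zero (κ₀ := (b₁ - b₂) * (2 + b₁ * c₂ + b₂ * c₁))
      (κ₁ := (1 + b₁ * c₂) ^ 2 - (1 + b₂ * c₁) ^ 2)
      (κ₂ := (c₁ - c₂) * (2 + b₁ * c₂ + b₂ * c₁))
      (h := (PowerSeries.C (1 + b₂ * c₁) + PowerSeries.C (c₂ - c₁) * Y) * k₂ -
        (PowerSeries.C (1 + b₁ * c₂) + PowerSeries.C (c₁ - c₂) * Y) * k₁) (by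
        simp only [map_add, map_sub, map_mul, map_one, map_pow, map_ofNat] at e1 e2 ⊢
        linear_combination (1 + PowerSeries.C b₂ * PowerSeries.C c₁ +
          (PowerSeries.C c₂ - PowerSeries.C c₁) * Y) * (e2 + hk₂) -
          (1 + PowerSeries.C b₁ * PowerSeries.C c₂ +
          (PowerSeries.C c₁ - PowerSeries.C c₂) * Y) * (e1 + hk₁))).2.2
    refine (IsUnit.mul_right_eq_zero ((A.isUnit_iff _).mpr ?_)).mp this
    rw [map_sub, hc₁, hc₂]
    exact 𝓕.u_sub_ne_zero hij
  -- Adding the two expressions for Z multiplies Z - Y by the vanishing trace, so only the defect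
  -- terms remain; over k they become the cocycle identity times y g_j(g_i(y)).
  have hsum : PowerSeries.C ϖ * (A₁ + A₂) = 0 := by
    have h5 := congrArg (PowerSeries.C (R := A)) htr
    simp only [map_add, map_sub, map_mul, map_one, map_ofNat, map_zero] at e1 e2 h5
    linear_combination (Z - Y) * h5 - e1 - e2
  rw [CoeffRing.C_mul_eq_zero_iff hϖ hm, map_add, hA₁, hA₂] at hsum
  have r1 := 𝓕.gen_rel i
  have r2 := 𝓕.gen_rel j
  have hgC : ∀ (i : Fin t) (x : k), (𝓕.gen i : k⟦X⟧ ≃ₐ[k] k⟦X⟧) (PowerSeries.C x) =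
    PowerSeries.C x := fun i => (𝓕.gen i : k⟦X⟧ ≃ₐ[k] k⟦X⟧).commutes
  have r3 := congrArg (𝓕.gen j : k⟦X⟧ ≃ₐ[k] k⟦X⟧) r1
  have r4 := congrArg (𝓕.gen i : k⟦X⟧ ≃ₐ[k] k⟦X⟧) r2
  simp only [map_add, map_mul, map_zero, hgC] at hsum r3 r4
  rw [𝓕.apply_comm i j] at r4 hsum
  have hne : 𝓕.y * (𝓕.gen j : k⟦X⟧ ≃ₐ[k] k⟦X⟧) ((𝓕.gen i : k⟦X⟧ ≃ₐ[k] k⟦X⟧) 𝓕.y) ≠ 0 := by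
    refine mul_ne_zero 𝓕.y_ne_zero ?_
    rw [Ne, map_eq_zero_iff _ (AlgEquiv.injective _), map_eq_zero_iff _ (AlgEquiv.injective _)]
    exact 𝓕.y_ne_zero
  refine mul_left_cancel₀ hne ?_
  generalize (𝓕.gen j : k⟦X⟧ ≃ₐ[k] k⟦X⟧) ((𝓕.gen i : k⟦X⟧ ≃ₐ[k] k⟦X⟧) 𝓕.y) = z at *
  generalize (𝓕.gen i : k⟦X⟧ ≃ₐ[k] k⟦X⟧) 𝓕.y = yi at *
  generalize (𝓕.gen j : k⟦X⟧ ≃ₐ[k] k⟦X⟧) 𝓕.y = yj at *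
  generalize (𝓕.gen i : k⟦X⟧ ≃ₐ[k] k⟦X⟧) v₂ = w₂ at *
  generalize (𝓕.gen j : k⟦X⟧ ≃ₐ[k] k⟦X⟧) v₁ = w₁ at *
  generalize 𝓕.y = y at *
  linear_combination hsum - z * w₁ * r2 + y * v₂ * r3 - z * w₂ * r1 + y * v₁ * r4 +
    (y * z * w₂ - y * z * v₂) * h2

end RelativeNormalForms

/-! ### Existence of normal forms over artinian rings -/

section RelativeExistence

variable {k : Type u} [Field k] [CharP k 2] {G : Subgroup (k⟦X⟧ ≃ₐ[k] k⟦X⟧)} {t : ℕ}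
  {A B : CoeffRing 2 k} {𝓕 : MobiusFrame G t}

/-- Normal forms lift along small extensions. -/
theorem Lift.NormalForm.lift_step {π : A →ₐ[WittVector 2 k] B} (hπ : Function.Surjective π)
    {ϖ : A} (hϖ : ϖ ≠ 0) (hπϖ : π ϖ = 0) (hm : ∀ a, A.residue a = 0 → ϖ * a = 0)
    (hker : ∀ a, π a = 0 → ∃ x, a = ϖ * x) {ρ : Lift G A} {ρ' : Lift G B}
    (hρ : ρ.IsBaseChange π ρ') {Y' : B⟦X⟧} {b' c' : Fin t → B}
    (h : ρ'.NormalForm 𝓕 Y' b' c') :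
    ∃ Y b c, ρ.NormalForm 𝓕 Y b c ∧ (∀ i, π (b i) = b' i) ∧ ∀ i, π (c i) = c' i := by
  have h2 := PowerSeries.two_eq_zero (k := k)
  obtain ⟨Y, hY'⟩ := PowerSeries.map_surjective (π : A →+* B) hπ Y'
  choose b hb using fun i => hπ (b' i)
  choose c hc using fun i => hπ (c' i)
  have hY : PowerSeries.map A.residue Y = 𝓕.y := by
    rw [← CoeffRing.IsParam.map π, hY', h.map_residue]
  have hcres : ∀ i, A.residue (c i) = 𝓕.u i := fun i => by
    rw [← CoeffRing.residue_map π, hc, (h.residue_eq i).2]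
  have hϖres : A.residue ϖ = 0 := by
    rw [← CoeffRing.residue_map π, hπϖ, map_zero]
  have hE : ∀ i, ∃ E, Y + ρ.toHom (𝓕.gen i) Y + PowerSeries.C (c i) * Y * ρ.toHom (𝓕.gen i) Y -
      PowerSeries.C (b i) = PowerSeries.C ϖ * E := by
    intro i
    refine CoeffRing.exists_eq_C_mul hker ?_
    simp only [map_add, map_sub, map_mul, PowerSeries.map_C, hρ _ _, hY', RingHom.coe_coe, hb, hc]
    linear_combination h.rel i
  choose E hE using hE
  -- The relation is symmetric in Y and its image under the involution, so its defect is invariant.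
  have hEinv : ∀ i, (𝓕.gen i : k⟦X⟧ ≃ₐ[k] k⟦X⟧) (PowerSeries.map A.residue (E i)) =
      PowerSeries.map A.residue (E i) := by
    intro i
    have h3 := congrArg (ρ.toHom (𝓕.gen i)) (hE i)
    simp only [map_add, map_sub, map_mul, Lift.toHom_C, ρ.toHom_apply_apply 𝓕] at h3
    rw [← ρ.reduces, ← sub_eq_zero, ← map_sub, ← CoeffRing.C_mul_eq_zero_iff hϖ hm]
    linear_combination hE i - h3
  -- The constant part of the defect is absorbed into b and the multiple of y g(y) into c; what
  -- remains is a cocycle v with values in the maximal ideal.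
  choose a' q' v hv0 hv using fun i => 𝓕.exists_eq_of_invariant i (hEinv i)
  choose a ha using fun i => A.residue_surjective (a' i)
  choose q hq using fun i => A.residue_surjective (q' i)
  obtain ⟨c₁, hc₁⟩ : ∃ c₁ : Fin t → A, ∀ i, c₁ i = c i - ϖ * q i := ⟨_, fun _ => rfl⟩
  obtain ⟨b₁, hb₁⟩ : ∃ b₁ : Fin t → A, ∀ i, b₁ i = b i + ϖ * a i := ⟨_, fun _ => rfl⟩
  have hc₁res : ∀ i, A.residue (c₁ i) = 𝓕.u i := fun i => by
    rw [hc₁, map_sub, map_mul, hϖres, hcres, zero_mul, sub_zero]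
  obtain ⟨E₁, hE₁⟩ : ∃ E₁ : Fin t → A⟦X⟧, ∀ i, E₁ i = E i - PowerSeries.C (a i) -
    PowerSeries.C (q i) * (Y * ρ.toHom (𝓕.gen i) Y) := ⟨_, fun _ => rfl⟩
  have hE₁res : ∀ i, PowerSeries.map A.residue (E₁ i) =
      𝓕.y * (𝓕.gen i : k⟦X⟧ ≃ₐ[k] k⟦X⟧) 𝓕.y * v i := by
    intro i
    rw [hE₁]
    simp only [map_sub, map_mul, PowerSeries.map_C, ρ.reduces, hY, ha, hq]
    linear_combination hv i
  have hE₁rel : ∀ i, Y + ρ.toHom (𝓕.gen i) Y + PowerSeries.C (c₁ i) * Y * ρ.toHom (𝓕.gen i) Y =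
      PowerSeries.C (b₁ i) + PowerSeries.C ϖ * E₁ i := by
    intro i
    rw [hE₁, hc₁, hb₁]
    simp only [map_add, map_sub, map_mul]
    linear_combination hE i
  have hv1 : ∀ i, v i + (𝓕.gen i : k⟦X⟧ ≃ₐ[k] k⟦X⟧) (v i) = 0 := by
    intro i
    have h3 := hEinv i
    rw [hv] at h3
    simp only [map_add, map_mul, 𝓕.apply_apply] at h3
    have hC : ∀ x, (𝓕.gen i : k⟦X⟧ ≃ₐ[k] k⟦X⟧) (PowerSeries.C x) = PowerSeries.C x :=
      (𝓕.gen i : k⟦X⟧ ≃ₐ[k] k⟦X⟧).commutes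
    rw [hC, hC] at h3
    have hne : 𝓕.y * (𝓕.gen i : k⟦X⟧ ≃ₐ[k] k⟦X⟧) 𝓕.y ≠ 0 := by
      refine mul_ne_zero 𝓕.y_ne_zero ?_
      rw [Ne, map_eq_zero_iff _ (AlgEquiv.injective _)]
      exact 𝓕.y_ne_zero
    have : (𝓕.gen i : k⟦X⟧ ≃ₐ[k] k⟦X⟧) (v i) = v i := by
      refine mul_left_cancel₀ hne ?_
      linear_combination h3
    rw [this]
    linear_combination v i * h2
  obtain ⟨D, -, hD⟩ := exists_coboundary t
    (fun i => ((𝓕.gen i : k⟦X⟧ ≃ₐ[k] k⟦X⟧) : k⟦X⟧ →ₐ[k] k⟦X⟧)) 𝓕.u 𝓕.isWild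
    (fun i f => 𝓕.apply_apply i f) (fun i j f => 𝓕.apply_comm i j f) 𝓕.sum_ne_zero v hv0 hv1
    (fun i j => by
      rcases eq_or_ne i j with rfl | hij
      · rfl
      exact 𝓕.cocycle_of_defect hϖ hm hY hij (hc₁res i) (hc₁res j) (hE₁rel i) (hE₁rel j)
        (hE₁res i) (hE₁res j) (hv0 i) (hv0 j))
  -- Replacing Y by Y + ϖ Δ changes the relation by Δ (1 + u g(y)) + g(Δ) (1 + u y). Since g(y) (1 +
  -- u y) = y, the choice Δ = y² D turns this into y g(y) (D + g(D)) = y g(y) v, which cancels the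
  -- defect.
  obtain ⟨Δ, hΔ⟩ := A.exists_lift_powerSeries (𝓕.y ^ 2 * D)
  refine ⟨Y + PowerSeries.C ϖ * Δ, b₁, c₁, ⟨?_, fun i => ?_⟩, fun i => ?_, fun i => ?_⟩
  · rw [map_add, map_mul, PowerSeries.map_C, hϖres, map_zero, zero_mul, add_zero, hY]
  · simp only [map_add, map_mul, Lift.toHom_C]
    rw [← sub_eq_zero]
    have : PowerSeries.C ϖ * (E₁ i + Δ + ρ.toHom (𝓕.gen i) Δ + PowerSeries.C (c₁ i) *
        (Δ * ρ.toHom (𝓕.gen i) Y + Y * ρ.toHom (𝓕.gen i) Δ +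
          PowerSeries.C ϖ * Δ * ρ.toHom (𝓕.gen i) Δ)) = 0 := by
      rw [CoeffRing.C_mul_eq_zero_iff hϖ hm]
      have hDi : (𝓕.gen i : k⟦X⟧ ≃ₐ[k] k⟦X⟧) D + D = v i := hD i
      simp only [map_add, map_mul, map_pow, PowerSeries.map_C, hϖres, hc₁res, hE₁res, ρ.reduces,
        hY, hΔ, map_zero, ← hDi]
      have hr := 𝓕.gen_rel i
      generalize (𝓕.gen i : k⟦X⟧ ≃ₐ[k] k⟦X⟧) D = D' at *
      generalize (𝓕.gen i : k⟦X⟧ ≃ₐ[k] k⟦X⟧) 𝓕.y = z at *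
      linear_combination (𝓕.y * D + z * D') * hr
    linear_combination hE₁rel i + this
  · rw [hb₁, map_add, map_mul, hπϖ, zero_mul, add_zero, hb]
  · rw [hc₁, map_sub, map_mul, hπϖ, zero_mul, sub_zero, hc]

/-- Normal forms lift along surjections of artinian rings. -/
theorem Lift.NormalForm.exists_lift (hA : IsArtinianRing A) {φ : A →ₐ[WittVector 2 k] B}
    (hφ : Function.Surjective φ) {ρ : Lift G A} {ρ' : Lift G B} (hρ : ρ.IsBaseChange φ ρ')
    {Y' : B⟦X⟧} {b' c' : Fin t → B} (h : ρ'.NormalForm 𝓕 Y' b' c') :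
    ∃ Y b c, ρ.NormalForm 𝓕 Y b c ∧ (∀ i, φ (b i) = b' i) ∧ ∀ i, φ (c i) = c' i := by
  -- A → B is factored through quotients C, and the induction runs over the kernel I of A → C.
  -- Killing a socle element in the kernel of C → B enlarges I, and `lift_step` climbs back to C.
  have key : ∀ I : Ideal A, ∀ (C : CoeffRing 2 k) (π : A →ₐ[WittVector 2 k] C)
      (ψ : C →ₐ[WittVector 2 k] B) (σ : Lift G C), IsArtinianRing C → Function.Surjective π →
      (∀ a, π a = 0 ↔ a ∈ I) → ψ.comp π = φ → ρ.IsBaseChange π σ → σ.IsBaseChange ψ ρ' →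
      ∃ Y b c, σ.NormalForm 𝓕 Y b c ∧ (∀ i, ψ (b i) = b' i) ∧ ∀ i, ψ (c i) = c' i := by
    intro I
    induction I using IsNoetherian.induction with
    | hgt I ih =>
    intro C π ψ σ hC hπ hI hψ hσ hσ'
    have hψs : Function.Surjective ψ := fun b => by
      obtain ⟨a, rfl⟩ := hφ b
      exact ⟨π a, by rw [← hψ]; rfl⟩
    by_cases hbot : RingHom.ker ψ = ⊥
    · let e := AlgEquiv.ofBijective ψ ⟨(RingHom.injective_iff_ker_eq_bot ψ).mpr hbot, hψs⟩
      obtain ⟨σ', hσ''⟩ := ρ'.exists_isBaseChange 𝓕.tangent (e.symm : B →ₐ[WittVector 2 k] C)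
      have he : ((e.symm : B →ₐ[WittVector 2 k] C)).comp ψ = AlgHom.id _ _ := by
        ext x
        exact e.symm_apply_apply x
      have := hσ'.comp hσ''
      rw [he] at this
      obtain rfl := this.unique 𝓕.tangent σ.isBaseChange_id
      exact ⟨_, _, _, h.baseChange hσ'', fun i => e.apply_symm_apply _,
        fun i => e.apply_symm_apply _⟩
    obtain ⟨ϖ, hϖψ, hϖ, hm⟩ := CoeffRing.exists_socle hC hbot
    have hle : Ideal.span {ϖ} ≤ RingHom.ker ψ := by
      rw [Ideal.span_singleton_le_iff_mem]
      exact hϖψ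
    obtain ⟨C', π', hC', hπ', hI'⟩ := C.exists_quotient (Ideal.span {ϖ})
      (fun htop => RingHom.ker_ne_top (ψ : C →+* B) (top_le_iff.mp (htop ▸ hle))) inferInstance
    obtain ⟨ψ', hψ'⟩ := AlgHom.exists_comp_eq_of_surjective hπ' ψ fun a ha => hle ((hI' a).mp ha)
    obtain ⟨σ', hσσ'⟩ := σ.exists_isBaseChange 𝓕.tangent π'
    obtain ⟨ρ'', hρ''⟩ := σ'.exists_isBaseChange 𝓕.tangent ψ'
    have h1 := hσσ'.comp hρ''
    rw [hψ'] at h1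
    obtain rfl := h1.unique 𝓕.tangent hσ'
    obtain ⟨Y, b, c, hY, hb, hc⟩ := ih (Ideal.comap π (Ideal.span {ϖ})) (by
        refine lt_of_le_of_ne (fun a ha => ?_) fun heq => ?_
        · rw [Ideal.mem_comap, (hI a).mpr ha]
          exact Ideal.zero_mem _
        · obtain ⟨a, ha⟩ := hπ ϖ
          have : a ∈ I := by
            rw [heq, Ideal.mem_comap, ha]
            exact Ideal.mem_span_singleton_self ϖ
          rw [← hI, ha] at this
          exact hϖ this)
      C' (π'.comp π) ψ' σ' hC' (hπ'.comp hπ) (fun a => by rw [Ideal.mem_comap, ← hI']; rfl)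
      (by rw [← AlgHom.comp_assoc, hψ', hψ]) (hσ.comp hσσ') hρ''
    obtain ⟨Y₁, b₁, c₁, hY₁, hb₁, hc₁⟩ := hY.lift_step hπ' hϖ
      ((hI' ϖ).mpr (Ideal.mem_span_singleton_self ϖ)) hm
      (fun a ha => Ideal.mem_span_singleton'.mp ((hI' a).mp ha) |>.imp fun x hx => by
        rw [← hx, mul_comm]) hσσ'
    refine ⟨Y₁, b₁, c₁, hY₁, fun i => ?_, fun i => ?_⟩
    · rw [← hb, ← hb₁, ← hψ']; rfl
    · rw [← hc, ← hc₁, ← hψ']; rfl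
  exact key ⊥ A (AlgHom.id _ _) φ ρ hA Function.surjective_id (fun a => Iff.rfl)
    (AlgHom.comp_id φ) ρ.isBaseChange_id hρ

/-- Every lift to an artinian ring has a normal form. -/
theorem MobiusFrame.exists_normalForm (𝓕 : MobiusFrame G t) (hA : IsArtinianRing A)
    (ρ : Lift G A) : ∃ Y b c, ρ.NormalForm 𝓕 Y b c := by
  obtain ⟨ρ', hρ'⟩ := ρ.exists_isBaseChange 𝓕.tangent A.residueHom
  have hinj : Function.Injective (PowerSeries.map (CoeffRing.residueField 2 k).residue) :=
    PowerSeries.map_injective _ Function.injective_id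
  obtain ⟨Y', hY'⟩ := (CoeffRing.residueField 2 k).exists_lift_powerSeries 𝓕.y
  choose c' hc' using fun i => (CoeffRing.residueField 2 k).residue_surjective (𝓕.u i)
  -- Over the residue field the frame itself is a normal form, with b = 0.
  have h : ρ'.NormalForm 𝓕 Y' 0 c' := by
    refine ⟨hY', fun i => hinj ?_⟩
    simp only [map_add, map_mul, PowerSeries.map_C, ρ'.reduces, hY', hc', Pi.zero_apply, map_zero]
    exact 𝓕.gen_rel i
  obtain ⟨Y, b, c, hY, -, -⟩ := h.exists_lift hA A.residueHom_surjective hρ'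
  exact ⟨Y, b, c, hY⟩

end RelativeExistence

/-! ### Normalisation by affine changes of parameter and first-order uniqueness -/

section Versality

variable {k : Type u} [Field k] [CharP k 2] {G : Subgroup (k⟦X⟧ ≃ₐ[k] k⟦X⟧)} {t : ℕ}
  {A B : CoeffRing 2 k} {𝓕 : MobiusFrame G t}

/-- The normalised tuples of commuting Möbius involutions over `A`. -/
structure MobiusFrame.IsDatum (𝓕 : MobiusFrame G t) (b c : Fin t → A) : Prop where
  residue_b : ∀ i, A.residue (b i) = 0
  residue_c : ∀ i, A.residue (c i) = 𝓕.u i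
  trace : ∀ i j, i ≠ j → 2 + b i * c j + b j * c i = 0
  normalized : ∀ i : Fin t, (i : ℕ) < 2 →
    c i = algebraMap (WittVector 2 k) A (WittVector.teichmuller 2 (𝓕.u i))

theorem MobiusFrame.IsDatum.map {b c : Fin t → A} (h : 𝓕.IsDatum b c)
    (f : A →ₐ[WittVector 2 k] B) : 𝓕.IsDatum (fun i => f (b i)) (fun i => f (c i)) where
  residue_b i := by rw [CoeffRing.residue_map, h.residue_b]
  residue_c i := by rw [CoeffRing.residue_map, h.residue_c]
  trace i j hij := by
    have := congrArg f (h.trace i j hij)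
    simpa only [map_add, map_mul, map_ofNat, map_zero] using this
  normalized i hi := by rw [h.normalized i hi, AlgHom.commutes]

theorem CoeffRing.residue_teichmuller (A : CoeffRing 2 k) (x : k) :
    A.residue (algebraMap (WittVector 2 k) A (WittVector.teichmuller 2 x)) = x := by
  rw [A.residue_algebraMap]
  exact WittVector.teichmuller_coeff_zero 2 x

/-- The change Y ↦ l (Y - s) acts on reciprocals by 1/c ↦ l (1/c + s), an affine map of the line,
which can carry two prescribed points to two others. If φ already sees the targets, s and l are
trivial under φ. -/
theorem MobiusFrame.exists_affine (𝓕 : MobiusFrame G t) {φ : A →ₐ[WittVector 2 k] B}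
    {c : Fin t → A} (hc : ∀ i, A.residue (c i) = 𝓕.u i)
    (hφ : ∀ i : Fin t, (i : ℕ) < 2 →
      φ (c i) = algebraMap (WittVector 2 k) B (WittVector.teichmuller 2 (𝓕.u i))) :
    ∃ s l l' : A, φ s = 0 ∧ φ l = 1 ∧ l * l' = 1 ∧ ∀ i : Fin t, (i : ℕ) < 2 →
      c i = algebraMap (WittVector 2 k) A (WittVector.teichmuller 2 (𝓕.u i)) * l *
        (1 + c i * s) := by
  obtain ⟨e, he⟩ : ∃ e : Fin t → A, ∀ i, e i =
      algebraMap (WittVector 2 k) A (WittVector.teichmuller 2 (𝓕.u i)) := ⟨_, fun _ => rfl⟩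
  have heres : ∀ i, A.residue (e i) = 𝓕.u i := fun i => by rw [he, A.residue_teichmuller]
  have hφe : ∀ i : Fin t, (i : ℕ) < 2 → φ (e i) = φ (c i) := fun i hi => by
    rw [hφ i hi, he, AlgHom.commutes]
  simp only [← he]
  have hcu : ∀ i, IsUnit (c i) := fun i => (A.isUnit_iff _).mpr (by rw [hc]; exact 𝓕.u_ne_zero i)
  have heu : ∀ i, IsUnit (e i) := fun i =>
    (A.isUnit_iff _).mpr (by rw [heres]; exact 𝓕.u_ne_zero i)
  choose d hd using fun i => (hcu i).exists_right_inv
  choose f hf using fun i => (heu i).exists_right_inv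
  have hφd : ∀ i : Fin t, (i : ℕ) < 2 → φ (f i) = φ (d i) := by
    intro i hi
    have h1 := congrArg φ (hd i)
    have h2 := congrArg φ (hf i)
    rw [map_mul, map_one] at h1 h2
    rw [hφe i hi] at h2
    linear_combination φ (d i) * h2 - φ (f i) * h1
  by_cases ht : 1 < t
  · obtain ⟨i₀, i₁, hij, h₀, h₁, hcases⟩ : ∃ i₀ i₁ : Fin t, i₀ ≠ i₁ ∧ (i₀ : ℕ) < 2 ∧ (i₁ : ℕ) < 2 ∧
        ∀ i : Fin t, (i : ℕ) < 2 → i = i₀ ∨ i = i₁ := by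
      refine ⟨⟨0, by omega⟩, ⟨1, ht⟩, by simp, by simp, by simp, fun i hi => ?_⟩
      rw [Fin.ext_iff, Fin.ext_iff]
      simp only
      omega
    have hφ₀ := hφd i₀ h₀
    have hφ₁ := hφd i₁ h₁
    have hdu : IsUnit (d i₀ - d i₁) := by
      have h3 : IsUnit (c i₁ - c i₀) := by
        rw [A.isUnit_iff, map_sub, hc, hc]
        exact 𝓕.u_sub_ne_zero hij.symm
      have h4 : c i₀ * c i₁ * (d i₀ - d i₁) = c i₁ - c i₀ := by
        linear_combination c i₁ * hd i₀ - c i₀ * hd i₁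
      rw [← h4] at h3
      exact isUnit_of_mul_isUnit_right h3
    have hfu : IsUnit (f i₀ - f i₁) := by
      have h3 : IsUnit (e i₁ - e i₀) := by
        rw [A.isUnit_iff, map_sub, heres, heres]
        exact 𝓕.u_sub_ne_zero hij.symm
      have h4 : e i₀ * e i₁ * (f i₀ - f i₁) = e i₁ - e i₀ := by
        linear_combination e i₁ * hf i₀ - e i₀ * hf i₁
      rw [← h4] at h3
      exact isUnit_of_mul_isUnit_right h3
    obtain ⟨d', hd'⟩ := hdu.exists_right_inv
    obtain ⟨f', hf'⟩ := hfu.exists_right_inv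
    have hφd' := congrArg φ hd'
    have hφf' := congrArg φ hf'
    rw [map_mul, map_sub, map_one] at hφd' hφf'
    rw [hφ₀, hφ₁] at hφf'
    -- The affine map through d i₀ ↦ f i₀ and d i₁ ↦ f i₁ has slope l = (f i₀ - f i₁) / (d i₀ - d
    -- i₁), and s = f i₀ / l - d i₀.
    refine ⟨f i₀ * ((d i₀ - d i₁) * f') - d i₀, (f i₀ - f i₁) * d', (d i₀ - d i₁) * f',
      ?_, ?_, ?_, ?_⟩
    · rw [map_sub, map_mul, map_mul, map_sub, hφ₀, hφf', mul_one, sub_self]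
    · rw [map_mul, map_sub, hφ₀, hφ₁, hφd']
    · linear_combination (d i₀ - d i₁) * d' * hf' + hd'
    · intro i hi
      have hls : (f i₀ - f i₁) * d' * (f i₀ * ((d i₀ - d i₁) * f') - d i₀) =
          f i - d i * ((f i₀ - f i₁) * d') := by
        have hls₀ : (f i₀ - f i₁) * d' * (f i₀ * ((d i₀ - d i₁) * f') - d i₀) =
            f i₀ - d i₀ * ((f i₀ - f i₁) * d') := by
          linear_combination f i₀ * (d i₀ - d i₁) * d' * hf' + f i₀ * hd'
        rcases hcases i hi with h | h
        · rw [h, hls₀]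
        · rw [h, hls₀]
          linear_combination (f i₁ - f i₀) * hd'
      generalize f i₀ * ((d i₀ - d i₁) * f') - d i₀ = s at *
      generalize (f i₀ - f i₁) * d' = l at *
      linear_combination (-(e i) * c i) * hls - c i * hf i + e i * l * hd i
  -- With one generator a scaling suffices, and s = 0.
  · by_cases ht0 : 0 < t
    · refine ⟨0, c ⟨0, ht0⟩ * f ⟨0, ht0⟩, e ⟨0, ht0⟩ * d ⟨0, ht0⟩, map_zero _, ?_, ?_, ?_⟩
      · rw [map_mul, hφd _ (by simp), ← map_mul, hd, map_one]
      · linear_combination e ⟨0, ht0⟩ * f ⟨0, ht0⟩ * hd ⟨0, ht0⟩ + hf ⟨0, ht0⟩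
      · intro i _
        obtain rfl : i = ⟨0, ht0⟩ := by
          rw [Fin.ext_iff]
          simp only
          omega
        linear_combination (-c ⟨0, ht0⟩) * hf ⟨0, ht0⟩
    · exact ⟨0, 1, 1, map_zero _, map_one _, mul_one _, fun i => absurd i.pos ht0⟩

/-- Normalisation of a normal form, relative to a quotient. -/
theorem Lift.NormalForm.exists_normalized {φ : A →ₐ[WittVector 2 k] B} {ρ : Lift G A} {Y : A⟦X⟧}
    {b c : Fin t → A} (h : ρ.NormalForm 𝓕 Y b c) (hφ : ∀ i : Fin t, (i : ℕ) < 2 →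
      φ (c i) = algebraMap (WittVector 2 k) B (WittVector.teichmuller 2 (𝓕.u i))) :
    ∃ Y' b' c', ρ.NormalForm 𝓕 Y' b' c' ∧ 𝓕.IsDatum b' c' ∧ (∀ i, φ (b' i) = φ (b i)) ∧
      ∀ i, φ (c' i) = φ (c i) := by
  obtain ⟨s, l, l', hs, hl, hl', hsl⟩ := 𝓕.exists_affine (fun i => (h.residue_eq i).2) hφ
  have hsres : A.residue s = 0 := by rw [← CoeffRing.residue_map φ, hs, map_zero]
  have hlres : A.residue l = 1 := by rw [← CoeffRing.residue_map φ, hl, map_one]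
  have hu : ∀ i, IsUnit (1 + c i * s) := fun i => by
    rw [A.isUnit_iff]
    simp [hsres]
  choose v hv using fun i => (hu i).exists_left_inv
  have hφv : ∀ i, φ (v i) = 1 := fun i => by
    have := congrArg φ (hv i)
    simpa [hs] using this
  have hφl' : φ l' = 1 := by
    have := congrArg φ hl'
    simpa [hl] using this
  have h' := h.affine hsres hlres hl' hv
  refine ⟨_, _, _, h', ⟨fun i => (h'.residue_eq i).1, fun i => (h'.residue_eq i).2,
    fun i j => h'.trace_eq_zero, fun i hi => ?_⟩, fun i => ?_, fun i => ?_⟩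
  · have := hsl i hi
    generalize algebraMap (WittVector 2 k) A (WittVector.teichmuller 2 (𝓕.u i)) = e at *
    linear_combination l' * v i * this + e * l * l' * hv i + e * hl'
  · simp [hs, hl, hφv]
  · simp [hφl', hφv]

/-- Every lift to an artinian ring has a normalised normal form. -/
theorem MobiusFrame.exists_datum (𝓕 : MobiusFrame G t) (hA : IsArtinianRing A) (ρ : Lift G A) :
    ∃ Y b c, ρ.NormalForm 𝓕 Y b c ∧ 𝓕.IsDatum b c := by
  obtain ⟨Y, b, c, h⟩ := 𝓕.exists_normalForm hA ρ
  obtain ⟨Y', b', c', h', hd, -, -⟩ := h.exists_normalized (φ := A.residueHom) fun i _ =>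
    (h.residue_eq i).2.trans ((CoeffRing.residueField 2 k).residue_teichmuller _).symm
  exact ⟨Y', b', c', h', hd⟩

/-- First order normal forms with normalised data are unique. -/
theorem Lift.NormalForm.eq_of_isDatum {ϖ : A} (hϖ : ϖ ≠ 0) (hϖm : A.residue ϖ = 0)
    (hm : ∀ a, A.residue a = 0 → ϖ * a = 0)
    (hker : ∀ a, A.residue a = 0 → ∃ x, a = ϖ * x) {ρ : Lift G A} {Y Y' : A⟦X⟧}
    {b c b' c' : Fin t → A} (h : ρ.NormalForm 𝓕 Y b c) (hd : 𝓕.IsDatum b c)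
    (h' : ρ.NormalForm 𝓕 Y' b' c') (hd' : 𝓕.IsDatum b' c') : b = b' ∧ c = c' := by
  have h2 := PowerSeries.two_eq_zero (k := k)
  have hϖ0 : ∀ x, ϖ * x = 0 ↔ A.residue x = 0 := fun x => by
    refine ⟨fun h => ?_, hm x⟩
    by_contra h0
    exact hϖ ((((A.isUnit_iff _).mpr h0).mul_left_eq_zero).mp h)
  obtain ⟨Δ, hΔ⟩ : ∃ Δ, Y' - Y = PowerSeries.C ϖ * Δ := by
    have : ∀ n, ∃ x, PowerSeries.coeff n (Y' - Y) = ϖ * x := fun n => hker _ (by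
      rw [← PowerSeries.coeff_map, map_sub, h'.map_residue, h.map_residue, sub_self, map_zero])
    choose x hx using this
    exact ⟨PowerSeries.mk x, by ext n; rw [hx, PowerSeries.coeff_C_mul, PowerSeries.coeff_mk]⟩
  choose β hβ using fun i => hker (b' i - b i) (by
    rw [map_sub, hd.residue_b, hd'.residue_b, sub_self])
  choose γ hγ using fun i => hker (c' i - c i) (by
    rw [map_sub, hd.residue_c, hd'.residue_c, sub_self])
  obtain ⟨Δ₁, hΔ₁⟩ := PowerSeries.exists_eq_C_add_X_mul (PowerSeries.map A.residue Δ)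
  obtain ⟨Δ₂, hΔ₂⟩ := PowerSeries.exists_eq_C_add_X_mul Δ₁
  set d₀ := PowerSeries.constantCoeff (PowerSeries.map A.residue Δ)
  set d₁ := PowerSeries.constantCoeff Δ₁
  -- Write Y' = Y + ϖ Δ with Δ = d₀ + d₁ X + ⋯ over k. The constant coefficient of the difference of
  -- the relations gives β; the X² coefficient gives γ as the effect of an infinitesimal affine
  -- change.
  have key : ∀ i, A.residue (β i) = 0 ∧
      A.residue (γ i) = d₁ * 𝓕.u i + d₀ * 𝓕.u i ^ 2 := by
    intro i
    have e1 := h.rel i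
    have e2 := h'.rel i
    rw [sub_eq_iff_eq_add.mp hΔ, sub_eq_iff_eq_add.mp (hβ i), sub_eq_iff_eq_add.mp (hγ i)] at e2
    simp only [map_add, map_mul, Lift.toHom_C] at e2
    have e3 : PowerSeries.C ϖ * (Δ + ρ.toHom (𝓕.gen i) Δ + PowerSeries.C (c i) *
        (Δ * ρ.toHom (𝓕.gen i) Y + Y * ρ.toHom (𝓕.gen i) Δ +
          PowerSeries.C ϖ * Δ * ρ.toHom (𝓕.gen i) Δ) +
        PowerSeries.C (γ i) * (Y + PowerSeries.C ϖ * Δ) *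
          (ρ.toHom (𝓕.gen i) Y + PowerSeries.C ϖ * ρ.toHom (𝓕.gen i) Δ) -
        PowerSeries.C (β i)) = 0 := by
      linear_combination e2 - e1
    rw [CoeffRing.C_mul_eq_zero_iff hϖ hm] at e3
    simp only [map_add, map_sub, map_mul, PowerSeries.map_C, hϖm, hd.residue_c, ρ.reduces,
      h.map_residue, map_zero, zero_mul, add_zero] at e3
    obtain ⟨r, hr⟩ := 𝓕.exists_y_eq
    obtain ⟨w, hw⟩ := 𝓕.isWild i
    change (𝓕.gen i : k⟦X⟧ ≃ₐ[k] k⟦X⟧) PowerSeries.X = _ at hw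
    have hC : ∀ x, (𝓕.gen i : k⟦X⟧ ≃ₐ[k] k⟦X⟧) (PowerSeries.C x) = PowerSeries.C x :=
      (𝓕.gen i : k⟦X⟧ ≃ₐ[k] k⟦X⟧).commutes
    obtain ⟨w', hw'⟩ : PowerSeries.X ∣ (𝓕.gen i : k⟦X⟧ ≃ₐ[k] k⟦X⟧) Δ₂ - Δ₂ := by
      have := 𝓕.tangent.coeff_zero (𝓕.gen i) Δ₂
      rw [PowerSeries.X_dvd_iff, map_sub, sub_eq_zero]
      simpa using this
    have hgΔ := congrArg (𝓕.gen i : k⟦X⟧ ≃ₐ[k] k⟦X⟧) hΔ₁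
    rw [hΔ₂] at hgΔ hΔ₁
    simp only [map_add, map_mul, hC, hw] at hgΔ
    have hrel := 𝓕.gen_rel i
    have hβ0 : A.residue (β i) = 0 := by
      have h0 := congrArg PowerSeries.constantCoeff e3
      have hy := 𝓕.coeff_zero_y
      have hz := 𝓕.coeff_zero_apply_y (𝓕.gen i)
      have hgd := 𝓕.tangent.coeff_zero (𝓕.gen i) (PowerSeries.map A.residue Δ)
      rw [PowerSeries.coeff_zero_eq_constantCoeff_apply] at hy hz hgd
      rw [PowerSeries.coeff_zero_eq_constantCoeff_apply] at hgd
      simp only [map_add, map_sub, map_mul, hy, hz, hgd, mul_zero, zero_mul,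
        map_zero, PowerSeries.constantCoeff_C, CharTwo.add_self_eq_zero, zero_sub,
        neg_eq_zero] at h0
      exact h0
    refine ⟨hβ0, ?_⟩
    rw [hβ0, map_zero, sub_zero] at e3
    -- Multiplication by 1 + u y and the relation g(y) (1 + u y) = y remove g(y).
    have e4 : PowerSeries.map A.residue Δ + (1 + PowerSeries.C (𝓕.u i) * 𝓕.y) ^ 2 *
        (𝓕.gen i : k⟦X⟧ ≃ₐ[k] k⟦X⟧) (PowerSeries.map A.residue Δ) -
        PowerSeries.C (A.residue (γ i)) * 𝓕.y ^ 2 = 0 := by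
      linear_combination (1 + PowerSeries.C (𝓕.u i) * 𝓕.y) * e3 -
        (PowerSeries.map A.residue Δ * PowerSeries.C (𝓕.u i) +
          PowerSeries.C (A.residue (γ i)) * 𝓕.y) * hrel
    obtain ⟨m₂, hm₂⟩ : ∃ m₂, 𝓕.y ^ 2 = PowerSeries.X ^ 2 + PowerSeries.X ^ 3 * m₂ :=
      ⟨2 * r + PowerSeries.X * r ^ 2, by rw [hr]; ring⟩
    have hgX : ((𝓕.gen i : k⟦X⟧ ≃ₐ[k] k⟦X⟧) PowerSeries.X) ^ 2 = PowerSeries.X ^ 2 +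
        PowerSeries.X ^ 3 * (2 * (PowerSeries.C (𝓕.u i) + PowerSeries.X * w) +
          PowerSeries.X * (PowerSeries.C (𝓕.u i) + PowerSeries.X * w) ^ 2) := by
      rw [hw]; ring
    rw [hw] at hgX
    generalize 2 * (PowerSeries.C (𝓕.u i) + PowerSeries.X * w) +
          PowerSeries.X * (PowerSeries.C (𝓕.u i) + PowerSeries.X * w) ^ 2 = m₃ at hgX
    obtain ⟨m₄, hm₄⟩ : ∃ m₄, (𝓕.gen i : k⟦X⟧ ≃ₐ[k] k⟦X⟧) (PowerSeries.map A.residue Δ) =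
        PowerSeries.C d₀ + PowerSeries.C d₁ * (PowerSeries.X +
          PowerSeries.C (𝓕.u i) * PowerSeries.X ^ 2) + PowerSeries.X ^ 2 * Δ₂ +
          PowerSeries.X ^ 3 * m₄ := by
      refine ⟨PowerSeries.C d₁ * w + w' + m₃ * Δ₂ + PowerSeries.X * m₃ * w', ?_⟩
      rw [hgΔ]
      linear_combination ((𝓕.gen i : k⟦X⟧ ≃ₐ[k] k⟦X⟧) Δ₂) * hgX +
        (PowerSeries.X ^ 2 + PowerSeries.X ^ 3 * m₃) * hw'
    rw [hm₄, hΔ₁] at e4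
    have e5 : PowerSeries.C (0 : k) + PowerSeries.C 0 * PowerSeries.X +
        PowerSeries.C (d₁ * 𝓕.u i + d₀ * 𝓕.u i ^ 2 - A.residue (γ i)) * PowerSeries.X ^ 2 =
        PowerSeries.X ^ 3 * (-(m₄ + PowerSeries.C (𝓕.u i) ^ 2 * (PowerSeries.C d₁ *
          (1 + PowerSeries.C (𝓕.u i) * PowerSeries.X) + PowerSeries.X * Δ₂ +
          PowerSeries.X ^ 2 * m₄) + PowerSeries.C (𝓕.u i) ^ 2 * m₂ *
          (PowerSeries.C d₀ + PowerSeries.C d₁ * (PowerSeries.X +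
          PowerSeries.C (𝓕.u i) * PowerSeries.X ^ 2) + PowerSeries.X ^ 2 * Δ₂ +
          PowerSeries.X ^ 3 * m₄) - PowerSeries.C (A.residue (γ i)) * m₂)) := by
      simp only [map_add, map_sub, map_mul, map_pow, map_zero]
      generalize PowerSeries.C (𝓕.u i) = U at *
      generalize PowerSeries.C d₀ = D₀ at *
      generalize PowerSeries.C d₁ = D₁ at *
      generalize PowerSeries.C (A.residue (γ i)) = Γ at *
      linear_combination e4 - (U ^ 2 * (D₀ + D₁ * (PowerSeries.X + U * PowerSeries.X ^ 2) +
        PowerSeries.X ^ 2 * Δ₂ + PowerSeries.X ^ 3 * m₄) - Γ) * hm₂ -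
        (D₀ + D₁ * PowerSeries.X + PowerSeries.X ^ 2 * Δ₂ + U * 𝓕.y *
        (D₀ + D₁ * (PowerSeries.X + U * PowerSeries.X ^ 2) +
        PowerSeries.X ^ 2 * Δ₂ + PowerSeries.X ^ 3 * m₄)) * h2
    have := (PowerSeries.coeff_eq_zero_of_X_pow_dvd (Dvd.intro _ e5.symm)).2.2
    linear_combination -this
  have hγ0 : ∀ i : Fin t, (i : ℕ) < 2 → d₁ + d₀ * 𝓕.u i = 0 := by
    intro i hi
    have h3 := hγ i
    rw [hd.normalized i hi, hd'.normalized i hi, sub_self] at h3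
    have h4 := (key i).2
    rw [(hϖ0 _).mp h3.symm] at h4
    refine (mul_eq_zero.mp ?_).resolve_left (𝓕.u_ne_zero i)
    linear_combination -h4
  have hγ1 : ∀ i, A.residue (γ i) = 0 := by
    intro i
    rw [(key i).2]
    by_cases hi : (i : ℕ) < 2
    · linear_combination 𝓕.u i * hγ0 i hi
    -- An index i ≥ 2 forces both normalised indices to exist; their distinct u then give d₀ = d₁ =
    -- 0.
    · have hlt := i.isLt
      have h5 := hγ0 ⟨0, by omega⟩ (by simp)
      have h6 := hγ0 ⟨1, by omega⟩ (by simp)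
      have hne : (⟨0, by omega⟩ : Fin t) ≠ ⟨1, by omega⟩ := by simp
      have hd₀ : d₀ = 0 := by
        refine (mul_eq_zero.mp ?_).resolve_right (𝓕.u_sub_ne_zero hne)
        linear_combination h5 - h6
      rw [hd₀] at h5 ⊢
      linear_combination 𝓕.u i * h5
  refine ⟨funext fun i => ?_, funext fun i => ?_⟩
  · have := hβ i
    rw [(hϖ0 _).mpr (key i).1] at this
    exact (sub_eq_zero.mp this).symm
  · have := hγ i
    rw [(hϖ0 _).mpr (hγ1 i)] at this
    exact (sub_eq_zero.mp this).symm

end Versality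

/-! ### Versality of a ring representing normalised data -/

section VersalLift

variable {k : Type u} [Field k] [CharP k 2] {G : Subgroup (k⟦X⟧ ≃ₐ[k] k⟦X⟧)} {t : ℕ}
  {A B : CoeffRing 2 k} {𝓕 : MobiusFrame G t}

theorem CoeffRing.exists_dualNumber_eps (p : ℕ) [Fact p.Prime] (k : Type u) [Field k] :
    ∃ ϖ : dualNumber p k, ϖ ≠ 0 ∧ (dualNumber p k).residue ϖ = 0 ∧
      (∀ a, (dualNumber p k).residue a = 0 → ϖ * a = 0) ∧
      ∀ a, (dualNumber p k).residue a = 0 → ∃ x, a = ϖ * x := by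
  have h1 : ∀ a : k[ε], TrivSqZeroExt.fst a = 0 → DualNumber.eps * a = 0 := fun a ha => by
    ext <;> simp [ha]
  have h2 : ∀ a : k[ε], TrivSqZeroExt.fst a = 0 → ∃ x, a = DualNumber.eps * x := fun a ha =>
    ⟨TrivSqZeroExt.inl (TrivSqZeroExt.snd a), by ext <;> simp [ha]⟩
  exact ⟨(DualNumber.eps : k[ε]), fun h => one_ne_zero (congrArg TrivSqZeroExt.snd h), rfl, h1, h2⟩

instance CoeffRing.isArtinianRing_dualNumber' (p : ℕ) [Fact p.Prime] (k : Type u) [Field k] :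
    IsArtinianRing (dualNumber p k) :=
  inferInstanceAs (IsArtinianRing k[ε])

/-- A ring representing the normalised Möbius data carries a versal lift. -/
theorem MobiusFrame.isVersalRing (𝓕 : MobiusFrame G t) {R : CoeffRing 2 k} {b c : Fin t → R}
    (h : 𝓕.IsDatum b c)
    (huniv : ∀ A : CoeffRing 2 k, IsArtinianRing A → ∀ b' c' : Fin t → A, 𝓕.IsDatum b' c' →
      ∃! f : R →ₐ[WittVector 2 k] A, (∀ i, f (b i) = b' i) ∧ ∀ i, f (c i) = c' i) :
    IsVersalRing G R := by
  obtain ⟨Y, hY⟩ := R.exists_lift_powerSeries 𝓕.y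
  obtain ⟨ξ, hξ⟩ := 𝓕.exists_lift hY h.residue_b h.residue_c h.trace
  have hinduce : ∀ {A : CoeffRing 2 k} {η : Lift G A} {f : R →ₐ[WittVector 2 k] A}
      {Y' : A⟦X⟧} {b' c' : Fin t → A}, η.NormalForm 𝓕 Y' b' c' →
      ((∀ i, f (b i) = b' i) ∧ ∀ i, f (c i) = c' i) → ξ.Induces f η := by
    rintro A η f Y' b' c' hη ⟨hb, hc⟩
    obtain ⟨ρ, hρ⟩ := ξ.exists_isBaseChange 𝓕.tangent f
    refine ⟨ρ, hρ, ?_⟩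
    have h1 := hξ.baseChange hρ
    simp only [hb, hc] at h1
    exact h1.equivalent hη
  have hinduced : ∀ {A : CoeffRing 2 k} {η : Lift G A} {f : R →ₐ[WittVector 2 k] A},
      ξ.Induces f η → ∃ Y', η.NormalForm 𝓕 Y' (fun i => f (b i)) fun i => f (c i) := by
    rintro A η f ⟨ρ, hρ, hρη⟩
    exact hρη.normalForm (hξ.baseChange hρ)
  refine ⟨ξ, ⟨?_, fun η => ?_⟩⟩
  · intro A B hA hB φ hφ f η ηB hη hf
    obtain ⟨Y', hY'⟩ := hinduced hf
    obtain ⟨Y₁, b₁, c₁, h₁, hb₁, hc₁⟩ := hY'.exists_lift hA hφ hη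
    -- The data over B are already normalised, so the normalisation over A can be chosen trivial
    -- over B, and the classifying map lifts f.
    obtain ⟨Y₂, b₂, c₂, h₂, hd₂, hb₂, hc₂⟩ := h₁.exists_normalized (φ := φ) fun i hi => by
      rw [hc₁, h.normalized i hi, AlgHom.commutes]
    obtain ⟨f', hf', -⟩ := huniv A hA b₂ c₂ hd₂
    refine ⟨f', ?_, hinduce h₂ hf'⟩
    refine (huniv B hB _ _ (h.map f)).unique ⟨fun i => ?_, fun i => ?_⟩
      ⟨fun i => rfl, fun i => rfl⟩
    · rw [AlgHom.comp_apply, hf'.1, hb₂, hb₁]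
    · rw [AlgHom.comp_apply, hf'.2, hc₂, hc₁]
  · obtain ⟨Y', b', c', hη, hd⟩ := 𝓕.exists_datum inferInstance η
    obtain ⟨f, hf, hfu⟩ := huniv _ inferInstance b' c' hd
    refine ⟨f, hinduce hη hf, fun f' hf' => hfu f' ?_⟩
    obtain ⟨Y'', hY''⟩ := hinduced hf'
    -- Uniqueness on tangent vectors: two normalised data of the same lift over k[ε] coincide.
    obtain ⟨ϖ, hϖ, hϖm, hm, hker⟩ := CoeffRing.exists_dualNumber_eps 2 k
    obtain ⟨hb, hc⟩ := hY''.eq_of_isDatum hϖ hϖm hm hker (h.map f') hη hd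
    exact ⟨congrFun hb, congrFun hc⟩

end VersalLift

/-! ### Rings representing the normalised data -/

section RepresentingRings

namespace CoeffRing

variable {p : ℕ} [Fact p.Prime] {k : Type u} [Field k] {A B : CoeffRing p k}

/-- The inclusion of the constants into the power series ring. -/
noncomputable def powerSeriesC (A : CoeffRing p k) : A →ₐ[WittVector p k] A.powerSeries :=
  { PowerSeries.C (R := A) with
    commutes' := fun _ => (PowerSeries.algebraMap_apply (R := WittVector p k) (A := A)).symm }

/-- The variable of the power series ring. -/
noncomputable def powerSeriesX (A : CoeffRing p k) : A.powerSeries := (PowerSeries.X : A⟦X⟧)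

theorem residue_powerSeriesX (A : CoeffRing p k) : A.powerSeries.residue A.powerSeriesX = 0 :=
  (congrArg A.residue PowerSeries.constantCoeff_X).trans (map_zero _)

theorem exists_powerSeries_hom (f : A →ₐ[WittVector p k] B) {b : B} (hb : B.residue b = 0) :
    ∃ F : A.powerSeries →ₐ[WittVector p k] B, F.comp A.powerSeriesC = f ∧
      F A.powerSeriesX = b := by
  obtain ⟨F, hF, hX⟩ := PowerSeries.exists_ringHom_of_mem (IsLocalRing.maximalIdeal B)
    (f : A →+* B) ((B.mem_maximalIdeal_iff b).mpr hb)
  refine ⟨{ F with commutes' := fun w => ?_ }, AlgHom.ext hF, hX⟩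
  change F (algebraMap (WittVector p k) A⟦X⟧ w) = _
  rw [PowerSeries.algebraMap_apply, hF]
  exact f.commutes w

theorem powerSeries_hom_ext {F F' : A.powerSeries →ₐ[WittVector p k] B}
    (hC : F.comp A.powerSeriesC = F'.comp A.powerSeriesC)
    (hX : F A.powerSeriesX = F' A.powerSeriesX) : F = F' := by
  have h : B.residue (F A.powerSeriesX) = 0 := by
    rw [residue_map, residue_powerSeriesX]
  have := PowerSeries.ringHom_ext_of_mem (A := A) (IsLocalRing.maximalIdeal B)
    (F := (F : A.powerSeries →+* B)) (F' := (F' : A.powerSeries →+* B)) (AlgHom.congr_fun hC) hX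
    ((B.mem_maximalIdeal_iff _).mpr h)
  exact AlgHom.ext fun x => congrArg (fun φ : A.powerSeries →+* B => φ x) this

/-- The ring of Witt vectors of a perfect field. -/
noncomputable def witt (p : ℕ) [Fact p.Prime] (k : Type u) [Field k] [CharP k p]
    [PerfectRing k p] : CoeffRing p k :=
  haveI : IsAdicComplete (IsLocalRing.maximalIdeal (WittVector p k)) (WittVector p k) := by
    rw [← IsLocalRing.ker_eq_maximalIdeal (WittVector.constantCoeff (p := p) (R := k))
      (WittVector.constantCoeff_surjective p), WittVector.ker_constantCoeff]
    infer_instance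
  { carrier := WittVector p k
    residue := WittVector.constantCoeff
    residue_algebraMap := fun _ => rfl }

/-- As k is perfect, the kernel of W(k) → k is generated by p, so the structure map of A factors
through k. -/
theorem exists_residueField_hom [CharP k p] [PerfectRing k p] (hA : (p : A) = 0) :
    Nonempty (residueField p k →ₐ[WittVector p k] A) := by
  have hker : ∀ w : WittVector p k, WittVector.constantCoeff w = 0 →
      algebraMap (WittVector p k) A w = 0 := by
    intro w hw
    rw [← RingHom.mem_ker, WittVector.ker_constantCoeff] at hw
    obtain ⟨x, rfl⟩ := Ideal.mem_span_singleton'.mp hw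
    rw [map_mul, map_natCast, hA, mul_zero]
  obtain ⟨f, -⟩ := AlgHom.exists_comp_eq_of_surjective (R := WittVector p k)
    (A := WittVector p k) (B := residueField p k) (C := A)
    (π := Algebra.ofId (WittVector p k) (residueField p k))
    (WittVector.constantCoeff_surjective p)
    (Algebra.ofId (WittVector p k) A) hker
  exact ⟨f⟩

theorem residueField_hom_ext (f f' : residueField p k →ₐ[WittVector p k] A) : f = f' := by
  ext x
  obtain ⟨w, rfl⟩ := WittVector.constantCoeff_surjective (p := p) x
  exact (f.commutes w).trans (f'.commutes w).symm

/-- Power series rings over `k`, with their universal property. -/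
theorem exists_universal_of_char [CharP k p] [PerfectRing k p] (n : ℕ) :
    ∃ (R : CoeffRing p k) (x : Fin n → R), (p : R) = 0 ∧ (∀ i, R.residue (x i) = 0) ∧
      ∀ A : CoeffRing p k, (p : A) = 0 → ∀ y : Fin n → A, (∀ i, A.residue (y i) = 0) →
        ∃! f : R →ₐ[WittVector p k] A, ∀ i, f (x i) = y i := by
  induction n with
  | zero =>
    refine ⟨residueField p k, fun i => i.elim0, CharP.cast_eq_zero k p, fun i => i.elim0,
      fun A hA y _ => ?_⟩
    obtain ⟨f⟩ := exists_residueField_hom hA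
    exact ⟨f, fun i => i.elim0, fun f' _ => residueField_hom_ext f' f⟩
  | succ n ih =>
    obtain ⟨R, x, hR, hx, huniv⟩ := ih
    refine ⟨R.powerSeries, Fin.cons R.powerSeriesX fun i => R.powerSeriesC (x i),
      ?_, ?_, fun A hA y hy => ?_⟩
    · rw [← map_natCast R.powerSeriesC, hR, map_zero]
    · refine Fin.cases R.residue_powerSeriesX fun i => ?_
      rw [Fin.cons_succ, residue_map, hx]
    · obtain ⟨f, hf, hfu⟩ := huniv A hA (fun i => y i.succ) fun i => hy i.succ
      obtain ⟨F, hF, hFX⟩ := exists_powerSeries_hom f (hy 0)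
      have hFx : ∀ i, F (R.powerSeriesC (x i)) = y i.succ := fun i => by
        rw [← hf, ← hF]
        rfl
      refine ⟨F, Fin.cases hFX hFx, fun F' hF' => powerSeries_hom_ext ?_ ?_⟩
      · rw [hF]
        exact hfu _ fun i => hF' i.succ
      · exact (hF' 0).trans hFX.symm

end CoeffRing

variable {k : Type u} [Field k] [CharP k 2] [PerfectRing k 2]
  {G : Subgroup (k⟦X⟧ ≃ₐ[k] k⟦X⟧)} {t : ℕ} {A : CoeffRing 2 k}

theorem MobiusFrame.isUnit_teichmuller (𝓕 : MobiusFrame G t) (i : Fin t) :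
    IsUnit (algebraMap (WittVector 2 k) A (WittVector.teichmuller 2 (𝓕.u i))) := by
  rw [A.isUnit_iff, A.residue_teichmuller]
  exact 𝓕.u_ne_zero i

/-- The datum is realised by a lift, to which the argument with three involutions applies. -/
theorem MobiusFrame.IsDatum.two_eq_zero {𝓕 : MobiusFrame G t} {b c : Fin t → A}
    (h : 𝓕.IsDatum b c) (ht : 3 ≤ t) : (2 : A) = 0 := by
  obtain ⟨Y, hY⟩ := A.exists_lift_powerSeries 𝓕.y
  obtain ⟨ρ, hρ⟩ := 𝓕.exists_lift hY h.residue_b h.residue_c h.trace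
  exact hρ.two_eq_zero (i := ⟨0, by omega⟩) (j := ⟨1, by omega⟩) (l := ⟨2, by omega⟩)
    (by simp) (by simp) (by simp)

/-- All c i are pinned to Teichmüller representatives, the first b is the variable, and for t = 2
the trace relation can be solved for the second b because the first c is a unit. -/
theorem MobiusFrame.isVersalRing_witt_powerSeries (𝓕 : MobiusFrame G t) (ht : 1 ≤ t)
    (ht2 : t ≤ 2) : IsVersalRing G (CoeffRing.witt 2 k).powerSeries := by
  set R := (CoeffRing.witt 2 k).powerSeries with hR
  set x : R := (CoeffRing.witt 2 k).powerSeriesX with hx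
  have hxres : R.residue x = 0 := CoeffRing.residue_powerSeriesX _
  have hlift : ∀ (A : CoeffRing 2 k) (a : A), A.residue a = 0 →
      ∃! f : R →ₐ[WittVector 2 k] A, f x = a := by
    intro A a ha
    obtain ⟨f, -, hf⟩ := CoeffRing.exists_powerSeries_hom (A := CoeffRing.witt 2 k)
      (Algebra.ofId (WittVector 2 k) A) ha
    refine ⟨f, hf, fun f' hf' => CoeffRing.powerSeries_hom_ext ?_ (hf'.trans hf.symm)⟩
    exact Subsingleton.elim (α := WittVector 2 k →ₐ[WittVector 2 k] A) _ _
  let c : ∀ A : CoeffRing 2 k, Fin t → A := fun A i =>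
    algebraMap (WittVector 2 k) A (WittVector.teichmuller 2 (𝓕.u i))
  obtain ⟨b, hb0, hb, hbt⟩ : ∃ b : Fin t → R, b ⟨0, ht⟩ = x ∧ (∀ i, R.residue (b i) = 0) ∧
      ∀ i j, i ≠ j → 2 + b i * c R j + b j * c R i = 0 := by
    obtain rfl | rfl : t = 1 ∨ t = 2 := by omega
    · exact ⟨fun _ => x, rfl, fun _ => hxres, fun i j hij => absurd (Subsingleton.elim i j) hij⟩
    · obtain ⟨e, he⟩ := (𝓕.isUnit_teichmuller (A := R) 0).exists_right_inv
      have h2 : R.residue 2 = 0 := by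
        rw [map_ofNat]
        exact CharTwo.two_eq_zero
      have h01 : 2 + x * c R 1 + -((2 + x * c R 1) * e) * c R 0 = 0 := by
        linear_combination (-(2 + x * c R 1)) * he
      refine ⟨![x, -((2 + x * c R 1) * e)], rfl, ?_, ?_⟩
      · intro i
        fin_cases i
        · exact hxres
        · simp [hxres, h2]
      · intro i j hij
        fin_cases i <;> fin_cases j
        · exact absurd rfl hij
        · exact h01
        · change 2 + -((2 + x * c R 1) * e) * c R 0 + x * c R 1 = 0
          linear_combination h01
        · exact absurd rfl hij
  refine 𝓕.isVersalRing (b := b) (c := c R)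
    ⟨hb, fun i => R.residue_teichmuller _, hbt, fun _ _ => rfl⟩ fun A _ b' c' hd => ?_
  obtain ⟨f, hf, hfu⟩ := hlift A (b' ⟨0, ht⟩) (hd.residue_b _)
  have hc : ∀ i, f (c R i) = c' i := fun i => by
    rw [hd.normalized i (by omega)]
    exact f.commutes _
  refine ⟨f, ⟨fun i => ?_, hc⟩, fun f' hf' => hfu f' (by rw [← hb0]; exact hf'.1 _)⟩
  by_cases hi : i = ⟨0, ht⟩
  · rw [hi, hb0, hf]
  · have h1 := congrArg f (hbt i _ hi)
    have h2 := hd.trace i _ hi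
    simp only [map_add, map_mul, map_ofNat, map_zero, hc, hb0, hf] at h1
    have h3 : IsUnit (c' ⟨0, ht⟩) := by
      rw [A.isUnit_iff, hd.residue_c]
      exact 𝓕.u_ne_zero _
    refine h3.mul_right_cancel ?_
    linear_combination h1 - h2

/-- Once 2 = 0, the trace relations say that b is proportional to c. The parameters are the ratio
and the deviations of the c i with i ≥ 2 from the Teichmüller representatives, t - 1 in all. -/
theorem MobiusFrame.exists_isVersalRing_of_three_le (𝓕 : MobiusFrame G t) (ht : 3 ≤ t) :
    ∃ R : CoeffRing 2 k, IsVersalRing G R := by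
  obtain ⟨R, x, hR, hx, huniv⟩ := CoeffRing.exists_universal_of_char (p := 2) (k := k) (t - 1)
  have h0 : 0 < t - 1 := by omega
  let e : ∀ A : CoeffRing 2 k, Fin t → A := fun A i =>
    algebraMap (WittVector 2 k) A (WittVector.teichmuller 2 (𝓕.u i))
  have he : ∀ (A : CoeffRing 2 k) i, A.residue (e A i) = 𝓕.u i := fun A i => A.residue_teichmuller _
  -- The variable of index 0 is kept for the ratio b / c, so c i uses the variable of index i - 1
  -- for i ≥ 2.
  obtain ⟨c, hc⟩ : ∃ c : Fin t → R, c = fun i : Fin t => if (i : ℕ) < 2 then e R i else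
    e R i + x ⟨(i : ℕ) - 1, by omega⟩ := ⟨_, rfl⟩
  have hc1 : ∀ i : Fin t, (i : ℕ) < 2 → c i = e R i := fun i hi => by rw [hc]; simp [hi]
  have hc2 : ∀ i : Fin t, ∀ j : Fin (t - 1), (j : ℕ) + 1 = i → 0 < (j : ℕ) →
      c i = e R i + x j := fun i j hij hj => by
    rw [hc]
    simp only
    rw [if_neg (by omega)]
    congr 3
    omega
  have hcres : ∀ i, R.residue (c i) = 𝓕.u i := fun i => by
    by_cases hi : (i : ℕ) < 2
    · rw [hc1 i hi, he]
    · rw [hc2 i ⟨i - 1, by omega⟩ (by simp only; omega) (by simp only; omega), map_add, he, hx,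
        add_zero]
  have h2 : (2 : R) = 0 := by exact_mod_cast hR
  refine ⟨R, 𝓕.isVersalRing (b := fun i => x ⟨0, h0⟩ * c i) (c := c)
    ⟨fun i => by rw [map_mul, hx, zero_mul], hcres, fun i j _ => ?_, hc1⟩ fun A _ b' c' hd => ?_⟩
  · linear_combination (1 + x ⟨0, h0⟩ * c i * c j) * h2
  -- A test ring carrying a datum has 2 = 0, so a universal property among such rings suffices.
  have hA := hd.two_eq_zero ht
  have hcu : ∀ i, IsUnit (c' i) := fun i => by
    rw [A.isUnit_iff, hd.residue_c]
    exact 𝓕.u_ne_zero _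
  obtain ⟨d, hd'⟩ := (hcu ⟨0, by omega⟩).exists_right_inv
  have hb' : ∀ i, b' i = b' ⟨0, by omega⟩ * d * c' i := by
    intro i
    by_cases hi : i = ⟨0, by omega⟩
    · rw [← hi] at hd' ⊢
      linear_combination (-b' i) * hd'
    · have := hd.trace i _ hi
      linear_combination d * this - b' i * hd' - (d + d * b' ⟨0, by omega⟩ * c' i) * hA
  obtain ⟨y, hy⟩ : ∃ y : Fin (t - 1) → A, y = fun j : Fin (t - 1) => if (j : ℕ) = 0 then b' ⟨0, by omega⟩ * d else
    c' ⟨j + 1, by omega⟩ - e A ⟨j + 1, by omega⟩ := ⟨_, rfl⟩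
  have hy0 : y ⟨0, h0⟩ = b' ⟨0, by omega⟩ * d := by rw [hy]; simp
  have hy1 : ∀ i : Fin t, ∀ j : Fin (t - 1), (j : ℕ) + 1 = i → 0 < (j : ℕ) →
      y j = c' i - e A i := fun i j hij hj => by
    rw [hy]
    simp only
    rw [if_neg (by omega)]
    congr 3
  have hyres : ∀ j, A.residue (y j) = 0 := by
    intro j
    by_cases hj : (j : ℕ) = 0
    · obtain rfl : j = ⟨0, h0⟩ := Fin.ext hj
      rw [hy0, map_mul, hd.residue_b, zero_mul]
    · rw [hy1 ⟨j + 1, by omega⟩ j rfl (by omega), map_sub, hd.residue_c, he, sub_self]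
  have hfe : ∀ (f : R →ₐ[WittVector 2 k] A) i, f (e R i) = e A i := fun f i => f.commutes _
  obtain ⟨f, hf, hfu⟩ := huniv A (by exact_mod_cast hA) y hyres
  have hfc : ∀ i, f (c i) = c' i := by
    intro i
    by_cases hi : (i : ℕ) < 2
    · rw [hc1 i hi, hfe, hd.normalized i hi]
    · rw [hc2 i ⟨i - 1, by omega⟩ (by simp only; omega) (by simp only; omega), map_add, hfe, hf,
        hy1 i _ (by simp only; omega) (by simp only; omega)]
      ring
  refine ⟨f, ⟨fun i => ?_, hfc⟩, fun f' hf' => hfu f' fun j => ?_⟩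
  · rw [map_mul, hf, hy0, hfc, ← hb']
  · by_cases hj : (j : ℕ) = 0
    · obtain rfl : j = ⟨0, h0⟩ := Fin.ext hj
      refine (hcu ⟨0, by omega⟩).mul_right_cancel ?_
      rw [hy0, ← hb', ← hf'.1, map_mul, hf'.2]
    · have h3 := hf'.2 ⟨j + 1, by omega⟩
      rw [hc2 ⟨j + 1, by omega⟩ j rfl (by omega), map_add, hfe] at h3
      rw [hy1 ⟨j + 1, by omega⟩ j rfl (by omega)]
      linear_combination h3

end RepresentingRings

/-! ### Homomorphisms out of a versal ring -/

section Hull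

namespace CoeffRing

variable {p : ℕ} [Fact p.Prime] {k : Type u} [Field k] {A B R R' : CoeffRing p k}

theorem maximalIdeal_pow_ne_top (A : CoeffRing p k) (n : ℕ) :
    IsLocalRing.maximalIdeal A ^ (n + 1) ≠ ⊤ := fun h =>
  Ideal.IsPrime.ne_top (I := IsLocalRing.maximalIdeal A) inferInstance
    (top_le_iff.mp (h ▸ Ideal.pow_le_self n.succ_ne_zero))

/-- The artinian quotient by a power of the maximal ideal. -/
noncomputable def truncation (A : CoeffRing p k) (n : ℕ) : CoeffRing p k :=
  A.quotient (IsLocalRing.maximalIdeal A ^ (n + 1)) (A.maximalIdeal_pow_ne_top n)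
    A.isArtinianRing_quotient_pow

theorem isArtinianRing_truncation (A : CoeffRing p k) (n : ℕ) :
    IsArtinianRing (A.truncation n) := A.isArtinianRing_quotient_pow

/-- The projection to the artinian quotient. -/
noncomputable def toTruncation (A : CoeffRing p k) (n : ℕ) :
    A →ₐ[WittVector p k] A.truncation n :=
  Ideal.Quotient.mkₐ (WittVector p k) (IsLocalRing.maximalIdeal A ^ (n + 1))

/-- The transition maps between the artinian quotients. -/
noncomputable def truncationMap (A : CoeffRing p k) (n : ℕ) :
    A.truncation (n + 1) →ₐ[WittVector p k] A.truncation n :=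
  Ideal.Quotient.factorₐ (WittVector p k) (Ideal.pow_le_pow_right (n + 1).le_succ)

theorem truncationMap_comp (A : CoeffRing p k) (n : ℕ) :
    (A.truncationMap n).comp (A.toTruncation (n + 1)) = A.toTruncation n := rfl

theorem toTruncation_eq_zero_iff (A : CoeffRing p k) (n : ℕ) (a : A) :
    A.toTruncation n a = 0 ↔ a ∈ IsLocalRing.maximalIdeal A ^ (n + 1) :=
  Ideal.Quotient.eq_zero_iff_mem

theorem toTruncation_surjective (A : CoeffRing p k) (n : ℕ) :
    Function.Surjective (A.toTruncation n) := Ideal.Quotient.mk_surjective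

theorem truncationMap_surjective (A : CoeffRing p k) (n : ℕ) :
    Function.Surjective (A.truncationMap n) := fun b => by
  obtain ⟨a, rfl⟩ := A.toTruncation_surjective n b
  exact ⟨A.toTruncation (n + 1) a, rfl⟩

theorem eq_zero_of_toTruncation (A : CoeffRing p k) {a : A} (h : ∀ n, A.toTruncation n a = 0) :
    a = 0 := by
  have : a ∈ (⨅ n, IsLocalRing.maximalIdeal A ^ n : Ideal A) := by
    rw [Ideal.mem_iInf]
    intro n
    exact Ideal.pow_le_pow_right n.le_succ ((A.toTruncation_eq_zero_iff n a).mp (h n))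
  rwa [Ideal.iInf_pow_eq_bot_of_isLocalRing _
    (Ideal.IsPrime.ne_top (I := IsLocalRing.maximalIdeal A) inferInstance), Ideal.mem_bot] at this

theorem exists_hom_of_truncation (f : ∀ n, R →ₐ[WittVector p k] A.truncation n)
    (hf : ∀ n, (A.truncationMap n).comp (f (n + 1)) = f n) :
    ∃ F : R →ₐ[WittVector p k] A, ∀ n, (A.toTruncation n).comp F = f n := by
  have ha : StrictMono (fun n : ℕ => n + 1) := fun _ _ h => Nat.succ_lt_succ h
  let F : R →+* A := IsAdicComplete.StrictMono.liftRingHom (IsLocalRing.maximalIdeal A) ha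
    (fun n => ((f n : R →ₐ[WittVector p k] A.truncation n) : R →+* A.truncation n))
    (fun {m} => by
      have := congrArg (fun φ : R →ₐ[WittVector p k] A.truncation m =>
        (φ : R →+* A.truncation m)) (hf m)
      exact this)
  have hF : ∀ n x, A.toTruncation n (F x) = f n x := fun n x =>
    IsAdicComplete.StrictMono.mk_liftRingHom (IsLocalRing.maximalIdeal A) ha _ _ x
  refine ⟨{ F with commutes' := fun w => ?_ }, fun n => AlgHom.ext (hF n)⟩
  change F (algebraMap _ _ w) = _
  rw [← sub_eq_zero]
  refine A.eq_zero_of_toTruncation fun n => ?_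
  rw [map_sub, hF, AlgHom.commutes, AlgHom.commutes, sub_self]

end CoeffRing

variable {p : ℕ} [Fact p.Prime] {k : Type u} [Field k] {G : Subgroup (k⟦X⟧ ≃ₐ[k] k⟦X⟧)}
  {A B R R' : CoeffRing p k}

theorem Lift.eq_residueField (ρ ρ' : Lift G (CoeffRing.residueField p k)) : ρ = ρ' := by
  have hinj : Function.Injective (PowerSeries.map (CoeffRing.residueField p k).residue) :=
    PowerSeries.map_injective _ Function.injective_id
  have : ρ.toHom = ρ'.toHom := by
    ext1 g
    refine AlgEquiv.ext fun F => hinj ?_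
    rw [ρ.reduces, ρ'.reduces]
  cases ρ
  cases ρ'
  congr

/-- Smoothness is applied to A → k, over which the action has only one lift. -/
theorem Lift.IsVersal.exists_induces {ξ : Lift G R} (hξ : ξ.IsVersal) (hG : IsTangentToOne G)
    (hA : IsArtinianRing A) (η : Lift G A) :
    ∃ f : R →ₐ[WittVector p k] A, ξ.Induces f η := by
  obtain ⟨η₀, hη₀⟩ := η.exists_isBaseChange hG A.residueHom
  obtain ⟨ξ₀, hξ₀⟩ := ξ.exists_isBaseChange hG R.residueHom
  obtain ⟨f, -, hf⟩ := hξ.smooth A _ hA inferInstance A.residueHom A.residueHom_surjective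
    R.residueHom η η₀ hη₀ ⟨ξ₀, hξ₀, by rw [ξ₀.eq_residueField η₀]; exact Lift.Equivalent.refl _⟩
  exact ⟨f, hf⟩

/-- A versal lift induces every lift over a complete ring, up to all finite orders. -/
theorem Lift.IsVersal.exists_hom {ξ : Lift G R} (hξ : ξ.IsVersal) (hG : IsTangentToOne G)
    (η : Lift G A) : ∃ f : R →ₐ[WittVector p k] A, ∀ n, ∀ η' : Lift G (A.truncation n),
      η.IsBaseChange (A.toTruncation n) η' → ξ.Induces ((A.toTruncation n).comp f) η' := by
  choose η' hη' using fun n => η.exists_isBaseChange hG (A.toTruncation n)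
  have hη'' : ∀ n, (η' (n + 1)).IsBaseChange (A.truncationMap n) (η' n) := fun n => by
    obtain ⟨σ, hσ⟩ := (η' (n + 1)).exists_isBaseChange hG (A.truncationMap n)
    have h1 := (hη' (n + 1)).comp hσ
    rw [A.truncationMap_comp] at h1
    obtain rfl := h1.unique hG (hη' n)
    exact hσ
  obtain ⟨f₀, hf₀⟩ := hξ.exists_induces hG (A.isArtinianRing_truncation 0) (η' 0)
  -- Smoothness along A/𝔪^(n+2) → A/𝔪^(n+1) yields a compatible system of maps, which completeness
  -- assembles into one map to A.
  have hstep : ∀ n (f : {f : R →ₐ[WittVector p k] A.truncation n // ξ.Induces f (η' n)}),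
      ∃ f' : {f : R →ₐ[WittVector p k] A.truncation (n + 1) // ξ.Induces f (η' (n + 1))},
        (A.truncationMap n).comp f'.1 = f.1 := fun n f => by
    obtain ⟨f', h, h'⟩ := hξ.smooth _ _ (A.isArtinianRing_truncation _)
      (A.isArtinianRing_truncation _) _ (A.truncationMap_surjective n) f.1 _ _ (hη'' n) f.2
    exact ⟨⟨f', h'⟩, h⟩
  choose next hnext using hstep
  let f : ∀ n, {f : R →ₐ[WittVector p k] A.truncation n // ξ.Induces f (η' n)} := fun n =>
    Nat.rec ⟨f₀, hf₀⟩ next n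
  obtain ⟨F, hF⟩ := CoeffRing.exists_hom_of_truncation (fun n => (f n).1) fun n => hnext n (f n)
  refine ⟨F, fun n σ hσ => ?_⟩
  rw [hF, hσ.unique hG (hη' n)]
  exact (f n).2

/-- The homomorphism from a versal ring to another one is injective on tangent spaces. -/
theorem Lift.IsVersal.exists_hom_tangent {ξ : Lift G R} (hξ : ξ.IsVersal) (hG : IsTangentToOne G)
    {ξ' : Lift G R'} (hξ' : ξ'.IsVersal) : ∃ f : R →ₐ[WittVector p k] R',
      ∀ g g' : R' →ₐ[WittVector p k] CoeffRing.dualNumber p k, g.comp f = g'.comp f → g = g' := by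
  obtain ⟨f, hf⟩ := hξ.exists_hom hG ξ'
  refine ⟨f, fun g g' hgg' => ?_⟩
  have hind : ∀ (g : R' →ₐ[WittVector p k] CoeffRing.dualNumber p k) (η : Lift G _),
      ξ'.IsBaseChange g η → ξ.Induces (g.comp f) η := by
    intro g η hη
    -- A map to k[ε] kills the square of the maximal ideal, so it factors through the truncation of
    -- index 1, where f is known to induce the right deformation.
    obtain ⟨g₂, hg₂⟩ := AlgHom.exists_comp_eq_of_surjective (R'.toTruncation_surjective 1) g
      fun a ha => by
        rw [R'.toTruncation_eq_zero_iff] at ha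
        obtain ⟨ϖ, -, -, hm, hker⟩ := CoeffRing.exists_dualNumber_eps p k
        rw [pow_two] at ha
        refine Submodule.mul_induction_on ha (fun x hx y hy => ?_) fun x y hx hy => ?_
        · rw [R'.mem_maximalIdeal_iff, ← CoeffRing.residue_map g] at hx hy
          obtain ⟨z, hz⟩ := hker _ hx
          rw [map_mul, hz, mul_right_comm, hm _ hy, zero_mul]
        · rw [map_add, hx, hy, add_zero]
    obtain ⟨σ, hσ⟩ := ξ'.exists_isBaseChange hG (R'.toTruncation 1)
    obtain ⟨τ, hτ⟩ := σ.exists_isBaseChange hG g₂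
    have h1 := hσ.comp hτ
    rw [hg₂] at h1
    obtain rfl := h1.unique hG hη
    have h2 := (hf 1 σ hσ).comp hG ⟨τ, hτ, Lift.Equivalent.refl _⟩
    rwa [← AlgHom.comp_assoc, hg₂] at h2
  obtain ⟨η, hη⟩ := ξ'.exists_isBaseChange hG g
  obtain ⟨η', hη'⟩ := ξ'.exists_isBaseChange hG g'
  obtain ⟨σ, hσ, hση⟩ := hind g η hη
  obtain ⟨σ', hσ', hση'⟩ := hind g' η' hη'
  rw [hgg'] at hσ
  obtain rfl := hσ.unique hG hσ'
  exact (hξ'.tangent η').unique ⟨η, hη, hση.symm.trans hση'⟩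
    ⟨η', hη', Lift.Equivalent.refl _⟩

end Hull

/-! ### Uniqueness of versal rings -/

section HullUniqueness

namespace CoeffRing

variable {p : ℕ} [Fact p.Prime] {k : Type u} [Field k] {A B R R' : CoeffRing p k}

/-- A coefficient ring of characteristic `p` whose maximal ideal is principal of square zero is
the ring of dual numbers. -/
theorem exists_hom_dualNumber [CharP k p] [PerfectRing k p] (hA : (p : A) = 0) {ϖ : A} (hϖ : ϖ ≠ 0)
    (hϖm : A.residue ϖ = 0) (hm : ∀ a, A.residue a = 0 → ϖ * a = 0)
    (hker : ∀ a, A.residue a = 0 → ∃ x, a = ϖ * x) :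
    ∃ g : A →ₐ[WittVector p k] dualNumber p k, Function.Injective g := by
  obtain ⟨s, hs, hsw⟩ : ∃ s : k →+* A, (∀ x, A.residue (s x) = x) ∧
      ∀ w : WittVector p k, s (WittVector.constantCoeff w) = algebraMap _ A w := by
    obtain ⟨s⟩ := exists_residueField_hom hA
    exact ⟨(s : residueField p k →+* A), residue_map s, s.commutes⟩
  let F : k[ε] →+* A :=
    { toFun := fun x => s x.fst + ϖ * s x.snd
      map_one' := by simp
      map_zero' := by simp
      map_add' := fun x y => by
        simp only [TrivSqZeroExt.fst_add, TrivSqZeroExt.snd_add, map_add]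
        ring
      map_mul' := fun x y => by
        simp only [TrivSqZeroExt.fst_mul, DualNumber.snd_mul, map_add, map_mul]
        linear_combination (-(s x.snd) * s y.snd) * hm ϖ hϖm }
  let F' : dualNumber p k →ₐ[WittVector p k] A :=
    { F with
      commutes' := fun w => by
        refine (congrArg₂ (fun x y => x + ϖ * y) (hsw w) (map_zero s)).trans (by simp) }
  have hF' : ∀ x : k[ε], F' x = s (TrivSqZeroExt.fst x) + ϖ * s (TrivSqZeroExt.snd x) :=
    fun _ => rfl
  have hbij : Function.Bijective F' := by
    refine ⟨(injective_iff_map_eq_zero F').mpr fun x hx => ?_, fun a => ?_⟩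
    · have h1 := (hF' x).symm.trans hx
      have h2 : TrivSqZeroExt.fst (R := k) (M := k) x = 0 := by
        have := congrArg A.residue h1
        rwa [map_add, map_mul, hs, hϖm, zero_mul, add_zero, map_zero] at this
      rw [h2] at h1
      have h3 : ϖ * s (TrivSqZeroExt.snd (R := k) (M := k) x) = 0 := by
        rwa [map_zero, zero_add] at h1
      have h4 : TrivSqZeroExt.snd (R := k) (M := k) x = 0 := by
        by_contra h0
        rw [← hs (TrivSqZeroExt.snd (R := k) (M := k) x)] at h0
        exact hϖ ((((A.isUnit_iff _).mpr h0).mul_left_eq_zero).mp h3)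
      exact TrivSqZeroExt.ext h2 h4
    · obtain ⟨y, hy⟩ := hker (a - s (A.residue a)) (by rw [map_sub, hs, sub_self])
      refine ⟨((A.residue a, A.residue y) : k × k), ?_⟩
      refine (hF' _).trans ?_
      change s (A.residue a) + ϖ * s (A.residue y) = a
      have := hm (s (A.residue y) - y) (by rw [map_sub, hs, sub_self])
      linear_combination this - hy
  exact ⟨((AlgEquiv.ofBijective F' hbij).symm : A →ₐ[WittVector p k] dualNumber p k),
    (AlgEquiv.ofBijective F' hbij).symm.injective⟩

/-- A homomorphism that is injective on tangent spaces is surjective. -/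
theorem surjective_of_tangent [CharP k p] [PerfectRing k p] (f : R →ₐ[WittVector p k] R')
    (hf : ∀ g g' : R' →ₐ[WittVector p k] dualNumber p k, g.comp f = g'.comp f → g = g') :
    Function.Surjective f := by
  set J := (IsLocalRing.maximalIdeal R).map (f : R →+* R') with hJ
  have hJle : J ≤ IsLocalRing.maximalIdeal R' := by
    rw [hJ, Ideal.map_le_iff_le_comap]
    intro x hx
    rw [Ideal.mem_comap, R'.mem_maximalIdeal_iff]
    exact (residue_map f x).trans ((R.mem_maximalIdeal_iff x).mp hx)
  have hpJ : (p : R') ∈ J := by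
    rw [← map_natCast (f : R →+* R')]
    refine Ideal.mem_map_of_mem _ ((R.mem_maximalIdeal_iff _).mpr ?_)
    rw [map_natCast, CharP.cast_eq_zero]
  -- Otherwise a maximal H strictly below the maximal ideal and containing J and its square has
  -- quotient k[ε]. The projection and the map through the residue field then agree on R but not on
  -- R'.
  have hmax : IsLocalRing.maximalIdeal R' ≤ J ⊔ IsLocalRing.maximalIdeal R' ^ 2 := by
    by_contra hnot
    have hle : J ⊔ IsLocalRing.maximalIdeal R' ^ 2 ≤ IsLocalRing.maximalIdeal R' :=
      sup_le hJle (Ideal.pow_le_self two_ne_zero)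
    obtain ⟨H, ⟨hH₁, hH₂⟩, hHmax⟩ := (set_has_maximal_iff_noetherian (R := R') (M := R')).mpr
      inferInstance {H | J ⊔ IsLocalRing.maximalIdeal R' ^ 2 ≤ H ∧ H < IsLocalRing.maximalIdeal R'}
      ⟨_, le_rfl, lt_of_le_not_ge hle hnot⟩
    have hH2 : IsLocalRing.maximalIdeal R' ^ 2 ≤ H := le_sup_right.trans hH₁
    have hart : IsArtinianRing (R' ⧸ H) :=
      haveI := R'.isArtinianRing_quotient_pow (n := 2)
      (Ideal.Quotient.factor_surjective hH2).isArtinianRing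
    obtain ⟨C, π, -, hπ, hπH⟩ := R'.exists_quotient H
      (fun h => (h ▸ hH₂).not_ge le_top) hart
    obtain ⟨x, hx, hxH⟩ := SetLike.exists_of_lt hH₂
    have hspan : H ⊔ Ideal.span {x} = IsLocalRing.maximalIdeal R' := by
      have hle' : H ⊔ Ideal.span {x} ≤ IsLocalRing.maximalIdeal R' :=
        sup_le hH₂.le ((Ideal.span_singleton_le_iff_mem _).mpr hx)
      by_contra hne
      refine hHmax _ ⟨hH₁.trans le_sup_left, lt_of_le_of_ne hle' hne⟩ ?_
      refine lt_of_le_of_ne le_sup_left fun h => hxH ?_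
      rw [h]
      exact Ideal.mem_sup_right (Ideal.mem_span_singleton_self x)
    have hlift : ∀ a : C, C.residue a = 0 → ∃ a' ∈ IsLocalRing.maximalIdeal R', π a' = a := by
      intro a ha
      obtain ⟨a', rfl⟩ := hπ a
      exact ⟨a', (R'.mem_maximalIdeal_iff _).mpr ((residue_map π a').symm.trans ha), rfl⟩
    have hx0 : π x ≠ 0 := fun h => hxH ((hπH x).mp h)
    have hxres : C.residue (π x) = 0 := (residue_map π x).trans ((R'.mem_maximalIdeal_iff x).mp hx)
    obtain ⟨g, hg⟩ := exists_hom_dualNumber (A := C) (ϖ := π x)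
      (by rw [← map_natCast π, hπH]; exact (le_sup_left.trans hH₁) hpJ) hx0 hxres
      (fun a ha => by
        obtain ⟨a', ha', rfl⟩ := hlift a ha
        rw [← map_mul, hπH]
        apply hH2
        rw [pow_two]
        exact Ideal.mul_mem_mul hx ha')
      (fun a ha => by
        obtain ⟨a', ha', rfl⟩ := hlift a ha
        rw [← hspan, Submodule.mem_sup] at ha'
        obtain ⟨h, hh, y, hy, rfl⟩ := ha'
        obtain ⟨z, rfl⟩ := Ideal.mem_span_singleton'.mp hy
        exact ⟨π z, by rw [map_add, (hπH h).mpr hh, zero_add, map_mul, mul_comm]⟩)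
    obtain ⟨s⟩ := exists_residueField_hom (A := dualNumber p k) (by
      have h1 : ((p : ℕ) : k[ε]) = 0 := by
        rw [← map_natCast (algebraMap k k[ε]), CharP.cast_eq_zero, map_zero]
      exact h1)
    have hgg : g.comp π = s.comp R'.residueHom := by
      refine hf _ _ (AlgHom.ext fun r => ?_)
      obtain ⟨w, hw⟩ := WittVector.constantCoeff_surjective p (R.residue r)
      obtain ⟨m, hm⟩ : ∃ m, r = algebraMap (WittVector p k) R w + m := ⟨_, (add_sub_cancel _ r).symm⟩
      have hmres : R.residue m = 0 := by
        have := congrArg R.residue hm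
        rw [map_add, R.residue_algebraMap, hw] at this
        exact left_eq_add.mp this
      have h1 : π (f m) = 0 := by
        rw [hπH]
        exact (le_sup_left.trans hH₁)
          (Ideal.mem_map_of_mem (f : R →+* R') ((R.mem_maximalIdeal_iff m).mpr hmres))
      have h2 : R'.residueHom (f m) = 0 := (residue_map f m).trans hmres
      rw [hm, map_add, map_add, AlgHom.commutes, AlgHom.commutes]
      congr 1
      rw [AlgHom.comp_apply, AlgHom.comp_apply, AlgHom.comp_apply, AlgHom.comp_apply, h1, h2,
        map_zero, map_zero]
    have h1 : g (π x) = s (R'.residueHom x) := AlgHom.congr_fun hgg x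
    have h2 : R'.residueHom x = 0 := (R'.mem_maximalIdeal_iff x).mp hx
    rw [h2, map_zero] at h1
    exact hx0 (hg (h1.trans (map_zero g).symm))
  -- Nakayama: the maximal ideal of R generates that of R', and completeness lifts surjectivity from
  -- the residue field.
  have hJeq : J = IsLocalRing.maximalIdeal R' := by
    refine le_antisymm hJle ?_
    refine Submodule.le_of_le_smul_of_le_jacobson_bot (I := IsLocalRing.maximalIdeal R')
      (IsNoetherian.noetherian _) (IsLocalRing.maximalIdeal_le_jacobson _) ?_
    rw [smul_eq_mul, ← pow_two]
    exact hmax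
  have hhaus : IsHausdorff ((IsLocalRing.maximalIdeal R).map (f : R →+* R')) R' := by
    rw [← hJ, hJeq]
    infer_instance
  refine surjective_of_mk_map_comp_surjective (I := IsLocalRing.maximalIdeal R) (f : R →+* R') ?_
  intro y
  obtain ⟨y, rfl⟩ := Ideal.Quotient.mk_surjective y
  obtain ⟨r, hr⟩ := R.residue_surjective (R'.residue y)
  refine ⟨r, ?_⟩
  rw [RingHom.comp_apply, Ideal.Quotient.eq, ← hJ, hJeq, R'.mem_maximalIdeal_iff, map_sub,
    RingHom.coe_coe, residue_map, hr, sub_self]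

end CoeffRing

variable {p : ℕ} [Fact p.Prime] {k : Type u} [Field k] {G : Subgroup (k⟦X⟧ ≃ₐ[k] k⟦X⟧)}
  {A B R R' : CoeffRing p k}

/-- Versal deformation rings are unique up to isomorphism. -/
theorem IsVersalRing.nonempty_algEquiv [CharP k p] [PerfectRing k p] (hG : IsTangentToOne G)
    (hR : IsVersalRing G R) (hR' : IsVersalRing G R') :
    Nonempty (R ≃ₐ[WittVector p k] R') := by
  obtain ⟨ξ, hξ⟩ := hR
  obtain ⟨ξ', hξ'⟩ := hR'
  obtain ⟨f, hf⟩ := hξ.exists_hom_tangent hG hξ'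
  obtain ⟨f', hf'⟩ := hξ'.exists_hom_tangent hG hξ
  have hs := CoeffRing.surjective_of_tangent f hf
  have hs' := CoeffRing.surjective_of_tangent f' hf'
  -- Surjections in both directions compose to a surjective endomorphism of a noetherian ring, which
  -- is injective.
  have hinj := RingHom.injective_of_surjective_of_isNoetherianRing
    ((f'.comp f : R →ₐ[WittVector p k] R) : R →+* R) (hs'.comp hs)
  exact ⟨AlgEquiv.ofBijective f ⟨Function.Injective.of_comp hinj, hs⟩⟩

end HullUniqueness

/-! ### Conclusion -/

section MainTheorem

variable {k : Type u} [Field k] [CharP k 2] {G : Subgroup (k⟦X⟧ ≃ₐ[k] k⟦X⟧)} {t : ℕ}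
  {A : CoeffRing 2 k}

/-- An action of a group of order at least eight with conductor one lifts to characteristic two
only. -/
theorem MobiusFrame.two_eq_zero_of_lift (𝓕 : MobiusFrame G t) (ht : 3 ≤ t) (ρ : Lift G A) :
    (2 : A) = 0 := by
  -- Normal forms are available over the artinian quotients only; Krull's intersection theorem
  -- brings 2 = 0 back to A.
  refine A.eq_zero_of_toTruncation fun n => ?_
  obtain ⟨ρ', -⟩ := ρ.exists_isBaseChange 𝓕.tangent (A.toTruncation n)
  obtain ⟨Y, b, c, h⟩ := 𝓕.exists_normalForm (A.isArtinianRing_truncation n) ρ'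
  rw [map_ofNat]
  exact h.two_eq_zero (i := ⟨0, by omega⟩) (j := ⟨1, by omega⟩) (l := ⟨2, by omega⟩)
    (by simp) (by simp) (by simp)

theorem WittVector.charP_zero (p : ℕ) [Fact p.Prime] (k : Type u) [Field k] [CharP k p]
    [PerfectRing k p] : CharP (WittVector p k) 0 := by
  obtain ⟨q, hq⟩ := CharP.exists (WittVector p k)
  rcases CharP.char_is_prime_or_zero (WittVector p k) q with h | rfl
  · exfalso
    have h1 : (q : k) = 0 := by
      rw [← map_natCast (WittVector.constantCoeff (p := p)), CharP.cast_eq_zero, map_zero]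
    have h2 : p ∣ q := (CharP.cast_eq_zero_iff k p q).mp h1
    have h3 := (Nat.prime_dvd_prime_iff_eq Fact.out h).mp h2
    exact WittVector.p_nonzero p k (h3 ▸ CharP.cast_eq_zero (WittVector p k) q)
  · exact hq

end MainTheorem

theorem mainTheorem5 (k : Type u) [Field k] [CharP k 2] [PerfectRing k 2]
    (t : ℕ) (ht : 1 ≤ t) (G : Subgroup (k⟦X⟧ ≃ₐ[k] k⟦X⟧))
    (hG : Nonempty (G ≃* Multiplicative (Fin t → ZMod 2))) (hcond : HasConductorOne G) :
    (∃ R : CoeffRing 2 k, IsVersalRing G R) ∧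
    (t ≤ 2 →
      (∃ A : CoeffRing 2 k, CharP A 0 ∧ Nonempty (Lift G A)) ∧
      ∀ R : CoeffRing 2 k, IsVersalRing G R →
        CharP R 0 ∧ Nonempty (R ≃ₐ[WittVector 2 k] (WittVector 2 k)⟦X⟧)) ∧
    (3 ≤ t →
      (∀ A : CoeffRing 2 k, CharP A 4 → IsEmpty (Lift G A)) ∧
      ∀ R : CoeffRing 2 k, IsVersalRing G R → CharP R 2) := by
  obtain ⟨e⟩ := hG
  obtain ⟨𝓕⟩ := hcond.exists_mobiusFrame e
  have htwo : t ≤ 2 → ∀ R : CoeffRing 2 k, IsVersalRing G R →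
      CharP R 0 ∧ Nonempty (R ≃ₐ[WittVector 2 k] (WittVector 2 k)⟦X⟧) := by
    intro ht2 R hR
    obtain ⟨φ⟩ : Nonempty (R ≃ₐ[WittVector 2 k] (WittVector 2 k)⟦X⟧) :=
      hR.nonempty_algEquiv 𝓕.tangent (𝓕.isVersalRing_witt_powerSeries ht ht2)
    have hW := WittVector.charP_zero 2 k
    have hinj : Function.Injective ((φ.symm : (WittVector 2 k)⟦X⟧ →+* R).comp PowerSeries.C) :=
      φ.symm.injective.comp PowerSeries.C_injective
    exact ⟨charP_of_injective_ringHom hinj 0, ⟨φ⟩⟩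
  refine ⟨?_, fun ht2 => ⟨?_, htwo ht2⟩, fun ht3 => ⟨fun A hA => ⟨fun ρ => ?_⟩, ?_⟩⟩
  · rcases le_or_gt t 2 with ht2 | ht3
    · exact ⟨_, 𝓕.isVersalRing_witt_powerSeries ht ht2⟩
    · exact 𝓕.exists_isVersalRing_of_three_le ht3
  · have hR := 𝓕.isVersalRing_witt_powerSeries ht ht2
    -- The versal lift is itself a lift to characteristic 0.
    exact ⟨_, (htwo ht2 _ hR).1, ⟨hR.choose⟩⟩
  · have h2 := 𝓕.two_eq_zero_of_lift ht3 ρ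
    have := (CharP.cast_eq_zero_iff A 4 2).mp (by exact_mod_cast h2)
    norm_num at this
  · rintro R ⟨ξ, -⟩
    exact CharTwo.of_one_ne_zero_of_two_eq_zero one_ne_zero (𝓕.two_eq_zero_of_lift ht3 ξ)
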